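/- All manifolds, metrics and functions are smooth. Bartnik data $(\Sigma,\gamma,H)$ consist of a topological 2-sphere $\Sigma$, a Riemannian metric $\gamma$ on $\Sigma$ of positive Gauss curvature, and a positive function $H$ on $\Sigma$. A fill-in of $(\Sigma,\gamma,H)$ is a compact, connected Riemannian 3-manifold $(\Omega,g)$ with boundary together with an isometric embedding $\iota:(\Sigma,\gamma)\to(\Omega,g)$ whose image is a connected component of $\partial\Omega$ and such that $H$ is the mean curvature of $\iota(\Sigma)$ in $(\Omega,g)$ with respect to the outward unit normal (with the sign for which round balls in $\mathbb{R}^3$ have boundary of positive mean curvature); $\Sigma$ is identified with $\iota(\Sigma)$. A fill-in is valid if $g$ has nonnegative scalar curvature and either $\partial\Omega=\Sigma$ or $\partial\Omega\setminus\Sigma$ is a minimal (zero mean curvature) surface. **Lemma 3.3.** Let $(\Omega,g)$ be a fill-in of arbitrary Bartnik data $(\Sigma,\gamma,H)$. Fix $\lambda\in(0,1)$ and a neighborhood $U$ of $\Sigma$ in $\Omega$. There exists a Riemannian metric $\tilde g$ on $\Omega$ such that: (a) $(\Omega,\tilde g)$ is a fill-in of $(\Sigma,\gamma,\lambda H)$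 (with the same embedding of $\Sigma$); (b) $\tilde g\ge g$, with equality outside $U$; (c) $R_{\tilde g}\ge\min(0,R_g)$ pointwise, with strict inequality on a neighborhood of $\Sigma$, where $R_g$ and $R_{\tilde g}$ are the scalar curvatures of $g$ and $\tilde g$; and such that, if $(\Omega,g)$ is a valid fill-in of $(\Sigma,\gamma,H)$, then $(\Omega,\tilde g)$ is a valid fill-in of $(\Sigma,\gamma,\lambda H)$. -/

import Mathlib

open Set Topology Manifold
open scoped ContDiff

noncomputable section

/-! ### Riemannian geometry of a metric given by its coefficient matrix on a subset of `ℝⁿ`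

`G y` is the matrix `(g_ij(y))` and `s` is the coordinate domain (all of `ℝⁿ`, or a half-space);
all derivatives are taken within `s`, so that they make sense up to the boundary of a half-space. -/

namespace Coord

variable {n : ℕ}

/-- The partial derivative `∂_i f` at `y`, taken within `s`. -/
def pderiv (s : Set (EuclideanSpace ℝ (Fin n))) (i : Fin n)
    (f : EuclideanSpace ℝ (Fin n) → ℝ) (y : EuclideanSpace ℝ (Fin n)) : ℝ :=
  fderivWithin ℝ f s y (EuclideanSpace.single i 1)

/-- The Christoffel symbol
`Γ^k_ij = ½ ∑_l g^{kl} (∂_i g_jl + ∂_j g_il - ∂_l g_ij)` of the Levi-Civita connection. -/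
def christoffel (s : Set (EuclideanSpace ℝ (Fin n)))
    (G : EuclideanSpace ℝ (Fin n) → Matrix (Fin n) (Fin n) ℝ)
    (k i j : Fin n) (y : EuclideanSpace ℝ (Fin n)) : ℝ :=
  (1 / 2) * ∑ l, (G y)⁻¹ k l *
    (pderiv s i (fun z => G z j l) y + pderiv s j (fun z => G z i l) y
      - pderiv s l (fun z => G z i j) y)

/-- The curvature coefficient `R^l_kij`, defined by `R(∂_i, ∂_j) ∂_k = ∑_l R^l_kij ∂_l`, where
`R(X, Y) Z = ∇_X ∇_Y Z - ∇_Y ∇_X Z - ∇_[X,Y] Z`. -/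
def riemann (s : Set (EuclideanSpace ℝ (Fin n)))
    (G : EuclideanSpace ℝ (Fin n) → Matrix (Fin n) (Fin n) ℝ)
    (l k i j : Fin n) (y : EuclideanSpace ℝ (Fin n)) : ℝ :=
  pderiv s i (christoffel s G l j k) y - pderiv s j (christoffel s G l i k) y
    + ∑ p, (christoffel s G l i p y * christoffel s G p j k y
        - christoffel s G l j p y * christoffel s G p i k y)

/-- The Ricci curvature `Ric_kj = ∑_i R^i_kij`. -/
def ricci (s : Set (EuclideanSpace ℝ (Fin n)))
    (G : EuclideanSpace ℝ (Fin n) → Matrix (Fin n) (Fin n) ℝ)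
    (k j : Fin n) (y : EuclideanSpace ℝ (Fin n)) : ℝ :=
  ∑ i, riemann s G i k i j y

/-- The scalar curvature `R = ∑_{k,j} g^{kj} Ric_kj`. -/
def scalar (s : Set (EuclideanSpace ℝ (Fin n)))
    (G : EuclideanSpace ℝ (Fin n) → Matrix (Fin n) (Fin n) ℝ)
    (y : EuclideanSpace ℝ (Fin n)) : ℝ :=
  ∑ k, ∑ j, (G y)⁻¹ k j * ricci s G k j y

/-- The Gauss curvature `K = g(R(∂_0, ∂_1) ∂_1, ∂_0) / det(g_ij)` of a surface metric. -/
def gauss (s : Set (EuclideanSpace ℝ (Fin 2)))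
    (G : EuclideanSpace ℝ (Fin 2) → Matrix (Fin 2) (Fin 2) ℝ)
    (y : EuclideanSpace ℝ (Fin 2)) : ℝ :=
  (∑ l, G y 0 l * riemann s G l 1 0 1 y) / (G y).det

/-- The covector `g(n, ·)`, in coordinates, of the unit normal `n` to the surface `{x₀ = 0}` that
points out of the half-space `{x₀ ≥ 0}`: it is `-dx₀ / |dx₀|_g`, and `|dx₀|_g² = g^{00}`. -/
def outwardConormal (G : EuclideanSpace ℝ (Fin 3) → Matrix (Fin 3) (Fin 3) ℝ)
    (y : EuclideanSpace ℝ (Fin 3)) (k : Fin 3) : ℝ :=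
  if k = 0 then -(Real.sqrt ((G y)⁻¹ 0 0))⁻¹ else 0

/-- The second fundamental form `h_ab = -g(∇_{∂_a} ∂_b, n) = -∑_k Γ^k_ab n_k` of the surface
`{x₀ = 0}`, where `∂_a, ∂_b` are two of the tangential coordinate fields `∂_1, ∂_2` (indexed by
`Fin 2` through `Fin.succ`) and `n` is the outward unit normal. -/
def secondFundamentalForm (s : Set (EuclideanSpace ℝ (Fin 3)))
    (G : EuclideanSpace ℝ (Fin 3) → Matrix (Fin 3) (Fin 3) ℝ)
    (y : EuclideanSpace ℝ (Fin 3)) (a b : Fin 2) : ℝ :=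
  -∑ k, christoffel s G k a.succ b.succ y * outwardConormal G y k

/-- The mean curvature of the surface `{x₀ = 0}` bounding the half-space `{x₀ ≥ 0}`: the trace
of the second fundamental form with respect to the induced metric. It is `-g(H⃗, n)` where
`H⃗` is the mean curvature vector (the trace of the normal part of `∇_X Y`) and `n` the outward
unit normal; a round ball in flat space has boundary of positive mean curvature. -/
def meanCurvature (s : Set (EuclideanSpace ℝ (Fin 3)))
    (G : EuclideanSpace ℝ (Fin 3) → Matrix (Fin 3) (Fin 3) ℝ)
    (y : EuclideanSpace ℝ (Fin 3)) : ℝ :=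
  ∑ a, ∑ b, ((G y).submatrix Fin.succ Fin.succ)⁻¹ a b * secondFundamentalForm s G y a b

end Coord

/-! ### Curvatures of Riemannian metrics on manifolds -/

section Metric

variable {n : ℕ} {H : Type*} [TopologicalSpace H]

/-- Smooth Riemannian metrics on a smooth manifold (possibly with boundary) of dimension `n`. -/
abbrev SmoothMetric (I : ModelWithCorners ℝ (EuclideanSpace ℝ (Fin n)) H)
    (M : Type*) [TopologicalSpace M] [ChartedSpace H M] [IsManifold I ∞ M] :=
  Bundle.ContMDiffRiemannianMetric I ∞ (EuclideanSpace ℝ (Fin n))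
    (fun p : M => TangentSpace I p)

variable {I : ModelWithCorners ℝ (EuclideanSpace ℝ (Fin n)) H}
  {M : Type*} [TopologicalSpace M] [ChartedSpace H M] [IsManifold I ∞ M]

/-- The coordinate vector `∂_i`, with respect to the preferred chart `φ` at `x`, at the point with
coordinates `y`: the image of the `i`-th basis vector under the differential of `φ⁻¹`. -/
def coordVector (I : ModelWithCorners ℝ (EuclideanSpace ℝ (Fin n)) H) (x : M)
    (y : EuclideanSpace ℝ (Fin n)) (i : Fin n) : TangentSpace I ((extChartAt I x).symm y) :=
  mfderivWithin 𝓘(ℝ, EuclideanSpace ℝ (Fin n)) I (extChartAt I x).symm (range I) y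
    (EuclideanSpace.single i 1 : EuclideanSpace ℝ (Fin n))

/-- The coefficients `g_ij = g(∂_i, ∂_j)` with respect to the preferred chart at `x`, as a
function of the coordinates. -/
def metricCoeff (g : SmoothMetric I M) (x : M) (y : EuclideanSpace ℝ (Fin n)) :
    Matrix (Fin n) (Fin n) ℝ :=
  Matrix.of fun i j =>
    g.inner ((extChartAt I x).symm y) (coordVector I x y i) (coordVector I x y j)

/-- The scalar curvature of `g` at `x` (computed in the preferred chart at `x`). -/
def scalarCurvature (g : SmoothMetric I M) (x : M) : ℝ :=
  Coord.scalar (range I) (metricCoeff g x) (extChartAt I x x)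

end Metric

/-- The Gauss curvature at `x` of a Riemannian metric on a surface. -/
def gaussCurvature {S : Type*} [TopologicalSpace S] [ChartedSpace (EuclideanSpace ℝ (Fin 2)) S]
    [IsManifold (𝓡 2) ∞ S] (γ : SmoothMetric (𝓡 2) S) (x : S) : ℝ :=
  Coord.gauss (range (𝓡 2)) (metricCoeff γ x) (extChartAt (𝓡 2) x x)

/-- The mean curvature at `p` of the boundary of a Riemannian 3-manifold with boundary, with
respect to the outward unit normal. It is meaningful only for `p` in the boundary: there the
charts take values in the half-space `{x₀ ≥ 0}` and map the boundary to `{x₀ = 0}`. -/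
def boundaryMeanCurvature {Ω : Type*} [TopologicalSpace Ω]
    [ChartedSpace (EuclideanHalfSpace 3) Ω] [IsManifold (𝓡∂ 3) ∞ Ω]
    (g : SmoothMetric (𝓡∂ 3) Ω) (p : Ω) : ℝ :=
  Coord.meanCurvature (range (𝓡∂ 3)) (metricCoeff g p) (extChartAt (𝓡∂ 3) p p)

/-! ### Bartnik data and fill-ins -/

/-- Bartnik data `(Σ, γ, H)` on a smooth surface `S = Σ`: the surface is a topological 2-sphere,
`γ` is a smooth metric of positive Gauss curvature and `H` is a positive smooth function. -/
structure BartnikData (S : Type*) [TopologicalSpace S]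
    [ChartedSpace (EuclideanSpace ℝ (Fin 2)) S] [IsManifold (𝓡 2) ∞ S] where
  sphere : Nonempty (S ≃ₜ Metric.sphere (0 : EuclideanSpace ℝ (Fin 3)) 1)
  γ : SmoothMetric (𝓡 2) S
  gauss_pos : ∀ x, 0 < gaussCurvature γ x
  H : S → ℝ
  H_smooth : ContMDiff (𝓡 2) 𝓘(ℝ, ℝ) ∞ H
  H_pos : ∀ x, 0 < H x

/-- The Bartnik data `(Σ, γ, c H)` for a constant `c > 0`. -/
def BartnikData.scale {S : Type*} [TopologicalSpace S]
    [ChartedSpace (EuclideanSpace ℝ (Fin 2)) S] [IsManifold (𝓡 2) ∞ S]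
    (B : BartnikData S) (c : ℝ) (hc : 0 < c) : BartnikData S where
  sphere := B.sphere
  γ := B.γ
  gauss_pos := B.gauss_pos
  H := fun x => c * B.H x
  H_smooth := contMDiff_const.mul B.H_smooth
  H_pos := fun x => mul_pos hc (B.H_pos x)

section FillIn

variable {S : Type*} [TopologicalSpace S] [ChartedSpace (EuclideanSpace ℝ (Fin 2)) S]
  [IsManifold (𝓡 2) ∞ S]
  {Ω : Type*} [TopologicalSpace Ω] [ChartedSpace (EuclideanHalfSpace 3) Ω]
  [IsManifold (𝓡∂ 3) ∞ Ω]

/-- `ι : (S, γ) → (Ω, g)` is an isometric embedding: a smooth topological embedding with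
`ι^* g = γ` (so its differentials are injective). -/
structure IsIsometricEmbedding (γ : SmoothMetric (𝓡 2) S) (g : SmoothMetric (𝓡∂ 3) Ω)
    (ι : S → Ω) : Prop where
  smooth : ContMDiff (𝓡 2) (𝓡∂ 3) ∞ ι
  isEmbedding : IsEmbedding ι
  isometric : ∀ (x : S) (v w : TangentSpace (𝓡 2) x),
    g.inner (ι x) (mfderiv (𝓡 2) (𝓡∂ 3) ι x v) (mfderiv (𝓡 2) (𝓡∂ 3) ι x w) = γ.inner x v w

/-- `(Ω, g)` is a fill-in of the Bartnik data `B = (S, γ, H)` by means of `ι : S → Ω`. -/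
structure IsFillIn (B : BartnikData S) (g : SmoothMetric (𝓡∂ 3) Ω) (ι : S → Ω) : Prop where
  t2 : T2Space Ω
  compact : CompactSpace Ω
  connected : ConnectedSpace Ω
  isometricEmbedding : IsIsometricEmbedding B.γ g ι
  /-- The image of `ι` is a connected component of `∂Ω`. -/
  component : ∃ p ∈ (𝓡∂ 3).boundary Ω,
    range ι = connectedComponentIn ((𝓡∂ 3).boundary Ω) p
  mean_curvature : ∀ x, B.H x = boundaryMeanCurvature g (ι x)

/-- A fill-in is valid if `g` has nonnegative scalar curvature and either `∂Ω = Σ` or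
`∂Ω ∖ Σ` is a minimal surface. -/
structure IsValidFillIn (B : BartnikData S) (g : SmoothMetric (𝓡∂ 3) Ω) (ι : S → Ω) : Prop
    extends IsFillIn B g ι where
  scalar_nonneg : ∀ p, 0 ≤ scalarCurvature g p
  minimal : (𝓡∂ 3).boundary Ω = range ι ∨
    ∀ p ∈ (𝓡∂ 3).boundary Ω \ range ι, boundaryMeanCurvature g p = 0

end FillIn

end

open Filter

noncomputable section

namespace Coord

variable {n : ℕ} {s : Set (EuclideanSpace ℝ (Fin n))} {y : EuclideanSpace ℝ (Fin n)}

/-! ### Calculus of partial derivatives within a set -/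

/-! The metric is stretched in the direction normal to Σ. Put g̃ = g + φ(ρ) dρ ⊗ dρ, where ρ ≥ 0 is
smooth, vanishes exactly on Σ and has |dρ|_g = 1 there (`exists_unit_defining`), and φ ≥ 0 decreases
from λ⁻² - 1 at 0 to zero at a small ε (`exists_profile`). Then g̃ ≥ g, with equality where ρ ≥ ε.
Since dρ kills the vectors tangent to Σ, the induced metric on Σ is still γ, and the mean curvature
is divided by √(1 + φ(0)|dρ|²) = λ⁻¹ (`Coord.meanCurvature_perturb`).

For the scalar curvature at a point where φ(ρ) = c, compare with the frozen metric g + c dρ ⊗ dρ.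
The exact formula `Coord.scalar_perturb_eq_frozen` reads R(g̃) = R(g + c dρ²) + φ'(ρ) B_c, where B_c
= |∇ρ|²Δρ - ∇²ρ(∇ρ,∇ρ) is taken in the frozen metric; φ'' does not occur. On Σ, B_c is a negative
multiple of the mean curvature of the frozen metric, hence negative because H > 0
(`Coord.levelBend_frozen_neg`). This is the only use of H > 0. Compactness of the range [0, λ⁻² - 1]
of c gives, near each point of Σ, constants a > 0 and C with B_c ≤ -a and R(g + c dρ²) ≥ R(g) - C c,
so that R(g̃) ≥ R(g) - a φ' - C φ. The profile φ(t) proportional to exp(-1/(ε - t)) satisfies -φ' ≥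
φ/ε², so for small ε the good term wins: R(g̃) ≥ R(g), strictly where ρ < ε. Compactness of Σ gives
one threshold for ε (`exists_uniform_bendsUp`). If moreover {ρ ≤ ε} lies in U and misses the rest of
∂Ω, the other boundary components keep their mean curvature and validity is preserved.

Scalar curvature at a point is defined in the chart preferred at that point, whereas the estimates
live in one chart around a point of Σ. Its invariance (`Coord.scalar_change`) is therefore needed,
and is proved by matrix calculus with the connection form. The mean curvature is only ever evaluated
in the chart at the point itself, so no invariance is required for it. -/

lemma pderiv_congr {f f' : EuclideanSpace ℝ (Fin n) → ℝ} (i : Fin n)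
    (h : f =ᶠ[𝓝[s] y] f') (hy : y ∈ s) : pderiv s i f y = pderiv s i f' y := by
  unfold pderiv
  rw [h.fderivWithin_eq_of_mem hy]

lemma pderiv_add (hs : UniqueDiffOn ℝ s) (hy : y ∈ s) {f f' : EuclideanSpace ℝ (Fin n) → ℝ}
    (i : Fin n) (hf : DifferentiableWithinAt ℝ f s y) (hf' : DifferentiableWithinAt ℝ f' s y) :
    pderiv s i (fun z => f z + f' z) y = pderiv s i f y + pderiv s i f' y := by
  unfold pderiv
  rw [fderivWithin_fun_add (hs y hy) hf hf']
  rfl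

lemma pderiv_mul (hs : UniqueDiffOn ℝ s) (hy : y ∈ s) {f f' : EuclideanSpace ℝ (Fin n) → ℝ}
    (i : Fin n) (hf : DifferentiableWithinAt ℝ f s y) (hf' : DifferentiableWithinAt ℝ f' s y) :
    pderiv s i (fun z => f z * f' z) y = pderiv s i f y * f' y + f y * pderiv s i f' y := by
  unfold pderiv
  rw [fderivWithin_fun_mul (hs y hy) hf hf']
  simp
  ring

lemma pderiv_sum (hs : UniqueDiffOn ℝ s) (hy : y ∈ s) {ι : Type*} (u : Finset ι)
    {f : ι → EuclideanSpace ℝ (Fin n) → ℝ} (i : Fin n)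
    (hf : ∀ a ∈ u, DifferentiableWithinAt ℝ (f a) s y) :
    pderiv s i (fun z => ∑ a ∈ u, f a z) y = ∑ a ∈ u, pderiv s i (f a) y := by
  unfold pderiv
  rw [fderivWithin_fun_sum (hs y hy) hf]
  simp

lemma contDiffWithinAt_pderiv (hs : UniqueDiffOn ℝ s) (hy : y ∈ s)
    {f : EuclideanSpace ℝ (Fin n) → ℝ} (i : Fin n) (hf : ContDiffWithinAt ℝ ∞ f s y) :
    ContDiffWithinAt ℝ ∞ (pderiv s i f) s y :=
  hf.fderivWithin_right_apply contDiffWithinAt_const hs (by simp) hy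

/-- Up to the boundary of a half-space, symmetry of second derivatives taken within `s` comes from
symmetry in the interior, whence the condition that `s` lie in the closure of its interior. -/
lemma pderiv_comm (hs : UniqueDiffOn ℝ s) (hy : y ∈ s) (hcl : s ⊆ closure (interior s))
    {f : EuclideanSpace ℝ (Fin n) → ℝ} (hf : ContDiffWithinAt ℝ ∞ f s y) (i j : Fin n) :
    pderiv s i (pderiv s j f) y = pderiv s j (pderiv s i f) y := by
  have hd : DifferentiableWithinAt ℝ (fderivWithin ℝ f s) s y :=
    (hf.fderivWithin_right (m := ∞) hs (by simp) hy).differentiableWithinAt (by simp)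
  have key : ∀ i j : Fin n, pderiv s i (pderiv s j f) y =
      fderivWithin ℝ (fderivWithin ℝ f s) s y (EuclideanSpace.single i 1)
        (EuclideanSpace.single j 1) := by
    intro i j
    have h1 : pderiv s j f = fun z => fderivWithin ℝ f s z (EuclideanSpace.single j 1) := rfl
    rw [h1, pderiv, fderivWithin_clm_apply (hs y hy) hd (differentiableWithinAt_const _)]
    simp
  rw [key, key]
  exact (hf.isSymmSndFDerivWithinAt
    (by rw [minSmoothness_of_isRCLikeNormedField]; exact WithTop.coe_le_coe.2 le_top) hs (hcl hy) hy) _ _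

/-- The chain rule for partial derivatives. -/
lemma pderiv_comp (hs : UniqueDiffOn ℝ s) (hy : y ∈ s)
    {τ : EuclideanSpace ℝ (Fin n) → EuclideanSpace ℝ (Fin n)}
    {f : EuclideanSpace ℝ (Fin n) → ℝ} (i : Fin n)
    (hτs : Tendsto τ (𝓝[s] y) (𝓝[s] (τ y)))
    (hτ : DifferentiableWithinAt ℝ τ s y) (hf : DifferentiableWithinAt ℝ f s (τ y)) :
    pderiv s i (fun z => f (τ z)) y =
      ∑ a, pderiv s a f (τ y) * pderiv s i (fun z => τ z a) y := by
  have h1 := hf.hasFDerivWithinAt.comp_of_tendsto y hτ.hasFDerivWithinAt hτs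
  have h2 : ∀ a, pderiv s i (fun z => τ z a) y =
      (fderivWithin ℝ τ s y (EuclideanSpace.single i 1)) a := by
    intro a
    have h3 := ((EuclideanSpace.proj (𝕜 := ℝ) a).hasFDerivAt.comp_hasFDerivWithinAt y
      hτ.hasFDerivWithinAt).fderivWithin (hs y hy)
    have h4 : (fun z => τ z a) = (EuclideanSpace.proj (𝕜 := ℝ) a) ∘ τ := rfl
    rw [pderiv, h4, h3]
    rfl
  have h5 : fderivWithin ℝ (fun z => f (τ z)) s y = _ := h1.fderivWithin (hs y hy)
  rw [pderiv, h5]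
  set v := fderivWithin ℝ τ s y (EuclideanSpace.single i 1) with hv
  have h6 : v = ∑ a, v a • (EuclideanSpace.single a (1 : ℝ)) := by
    ext b
    simp [Finset.sum_apply, Pi.single_apply]
  calc (fderivWithin ℝ f s (τ y)) v
      = (fderivWithin ℝ f s (τ y)) (∑ a, v a • (EuclideanSpace.single a (1 : ℝ))) := by rw [← h6]
    _ = _ := by
      rw [map_sum]
      refine Finset.sum_congr rfl fun a _ => ?_
      rw [map_smul, h2 a, smul_eq_mul, mul_comm]
      rfl

/-- The chain rule for post-composition with a function of one variable. -/
lemma pderiv_comp_left (hs : UniqueDiffOn ℝ s) (hy : y ∈ s) {φ : ℝ → ℝ}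
    {f : EuclideanSpace ℝ (Fin n) → ℝ} (i : Fin n)
    (hφ : DifferentiableAt ℝ φ (f y)) (hf : DifferentiableWithinAt ℝ f s y) :
    pderiv s i (fun z => φ (f z)) y = deriv φ (f y) * pderiv s i f y := by
  have h := (hφ.hasDerivAt.comp_hasFDerivWithinAt y hf.hasFDerivWithinAt).fderivWithin (hs y hy)
  have h' : fderivWithin ℝ (fun z => φ (f z)) s y = _ := h
  rw [pderiv, h']
  rfl

/-! ### Matrix-valued functions -/

/-- The entrywise partial derivative of a matrix-valued function. -/
def pderivMat (s : Set (EuclideanSpace ℝ (Fin n))) (i : Fin n) {l m : Type*}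
    (A : EuclideanSpace ℝ (Fin n) → Matrix l m ℝ) (y : EuclideanSpace ℝ (Fin n)) : Matrix l m ℝ :=
  Matrix.of fun a b => pderiv s i (fun z => A z a b) y

/-- Entrywise differentiability of a matrix-valued function. -/
def MatDiff (s : Set (EuclideanSpace ℝ (Fin n))) {l m : Type*}
    (A : EuclideanSpace ℝ (Fin n) → Matrix l m ℝ) (y : EuclideanSpace ℝ (Fin n)) : Prop :=
  ∀ a b, DifferentiableWithinAt ℝ (fun z => A z a b) s y

/-- Entrywise smoothness of a matrix-valued function. -/
def MatSmooth (s : Set (EuclideanSpace ℝ (Fin n))) {l m : Type*}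
    (A : EuclideanSpace ℝ (Fin n) → Matrix l m ℝ) (y : EuclideanSpace ℝ (Fin n)) : Prop :=
  ∀ a b, ContDiffWithinAt ℝ ∞ (fun z => A z a b) s y

section Mat

variable {l m k : Type*}

lemma MatSmooth.matDiff {A : EuclideanSpace ℝ (Fin n) → Matrix l m ℝ} (h : MatSmooth s A y) :
    MatDiff s A y := fun a b => (h a b).differentiableWithinAt (by simp)

lemma pderivMat_congr {A A' : EuclideanSpace ℝ (Fin n) → Matrix l m ℝ} (i : Fin n)
    (h : A =ᶠ[𝓝[s] y] A') (hy : y ∈ s) : pderivMat s i A y = pderivMat s i A' y := by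
  ext a b
  exact pderiv_congr i (h.mono fun z hz => by simp [hz]) hy

lemma pderivMat_transpose (i : Fin n) (A : EuclideanSpace ℝ (Fin n) → Matrix l m ℝ) :
    pderivMat s i (fun z => (A z).transpose) y = (pderivMat s i A y).transpose := rfl

lemma pderivMat_add (hs : UniqueDiffOn ℝ s) (hy : y ∈ s)
    {A B : EuclideanSpace ℝ (Fin n) → Matrix l m ℝ} (i : Fin n)
    (hA : MatDiff s A y) (hB : MatDiff s B y) :
    pderivMat s i (fun z => A z + B z) y = pderivMat s i A y + pderivMat s i B y := by
  ext a b
  exact pderiv_add hs hy i (hA a b) (hB a b)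

lemma pderivMat_mul [Fintype m] (hs : UniqueDiffOn ℝ s) (hy : y ∈ s)
    {A : EuclideanSpace ℝ (Fin n) → Matrix l m ℝ} {B : EuclideanSpace ℝ (Fin n) → Matrix m k ℝ}
    (i : Fin n) (hA : MatDiff s A y) (hB : MatDiff s B y) :
    pderivMat s i (fun z => A z * B z) y = pderivMat s i A y * B y + A y * pderivMat s i B y := by
  ext a b
  simp only [pderivMat, Matrix.mul_apply, Matrix.of_apply, Matrix.add_apply]
  rw [pderiv_sum hs hy _ (f := fun c z => A z a c * B z c b) i
    (fun c _ => (hA a c).mul (hB c b)), ← Finset.sum_add_distrib]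
  exact Finset.sum_congr rfl fun c _ => pderiv_mul hs hy i (hA a c) (hB c b)

lemma pderivMat_smul (hs : UniqueDiffOn ℝ s) (hy : y ∈ s) {f : EuclideanSpace ℝ (Fin n) → ℝ}
    {A : EuclideanSpace ℝ (Fin n) → Matrix l m ℝ}
    (i : Fin n) (hf : DifferentiableWithinAt ℝ f s y) (hA : MatDiff s A y) :
    pderivMat s i (fun z => f z • A z) y = pderiv s i f y • A y + f y • pderivMat s i A y := by
  ext a b
  exact pderiv_mul hs hy i hf (hA a b)

lemma MatSmooth.add {A B : EuclideanSpace ℝ (Fin n) → Matrix l m ℝ}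
    (hA : MatSmooth s A y) (hB : MatSmooth s B y) : MatSmooth s (fun z => A z + B z) y :=
  fun a b => (hA a b).add (hB a b)

lemma MatSmooth.smul {f : EuclideanSpace ℝ (Fin n) → ℝ}
    {A : EuclideanSpace ℝ (Fin n) → Matrix l m ℝ}
    (hf : ContDiffWithinAt ℝ ∞ f s y) (hA : MatSmooth s A y) :
    MatSmooth s (fun z => f z • A z) y :=
  fun a b => hf.mul (hA a b)

lemma MatSmooth.mul [Fintype m] {A : EuclideanSpace ℝ (Fin n) → Matrix l m ℝ}
    {B : EuclideanSpace ℝ (Fin n) → Matrix m k ℝ}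
    (hA : MatSmooth s A y) (hB : MatSmooth s B y) : MatSmooth s (fun z => A z * B z) y := by
  intro a b
  simp only [Matrix.mul_apply]
  exact ContDiffWithinAt.sum fun c _ => (hA a c).mul (hB c b)

lemma MatSmooth.transpose {A : EuclideanSpace ℝ (Fin n) → Matrix l m ℝ}
    (hA : MatSmooth s A y) : MatSmooth s (fun z => (A z).transpose) y := fun a b => hA b a

lemma MatSmooth.pderivMat (hs : UniqueDiffOn ℝ s) (hy : y ∈ s)
    {A : EuclideanSpace ℝ (Fin n) → Matrix l m ℝ} (hA : MatSmooth s A y) (i : Fin n) :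
    MatSmooth s (pderivMat s i A) y := fun a b => contDiffWithinAt_pderiv hs hy i (hA a b)

end Mat

/-- Determinants of smooth families of matrices are smooth; `X` is an arbitrary parameter space. -/
lemma contDiffWithinAt_det {X : Type*} [NormedAddCommGroup X] [NormedSpace ℝ X] {t : Set X} {x : X}
    {m : Type*} [Fintype m] [DecidableEq m] {A : X → Matrix m m ℝ}
    (hA : ∀ a b, ContDiffWithinAt ℝ ∞ (fun z => A z a b) t x) :
    ContDiffWithinAt ℝ ∞ (fun z => (A z).det) t x := by
  simp only [Matrix.det_apply']
  exact ContDiffWithinAt.sum fun σ _ => contDiffWithinAt_const.mul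
    (contDiffWithinAt_prod fun i _ => hA _ _)

/-- Inverses of smooth families of invertible matrices are smooth. -/
lemma contDiffWithinAt_inv {X : Type*} [NormedAddCommGroup X] [NormedSpace ℝ X] {t : Set X} {x : X}
    {m : Type*} [Fintype m] [DecidableEq m] {A : X → Matrix m m ℝ}
    (hA : ∀ a b, ContDiffWithinAt ℝ ∞ (fun z => A z a b) t x) (hdet : (A x).det ≠ 0) (a b : m) :
    ContDiffWithinAt ℝ ∞ (fun z => (A z)⁻¹ a b) t x := by
  simp only [Matrix.inv_def, Ring.inverse_eq_inv', Matrix.smul_apply, smul_eq_mul]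
  refine ((contDiffWithinAt_det hA).inv hdet).mul ?_
  simp only [Matrix.adjugate_apply]
  refine contDiffWithinAt_det fun i j => ?_
  by_cases h : i = b
  · subst h
    simp only [Matrix.updateRow_self]
    exact contDiffWithinAt_const
  · simp only [Matrix.updateRow_ne h]
    exact hA i j

/-! ### The Levi-Civita connection -/

/-- The matrix `(Γ_i)_{lk} = Γ^l_ik` of the connection form. -/
def connMat (s : Set (EuclideanSpace ℝ (Fin n)))
    (G : EuclideanSpace ℝ (Fin n) → Matrix (Fin n) (Fin n) ℝ) (i : Fin n)
    (y : EuclideanSpace ℝ (Fin n)) : Matrix (Fin n) (Fin n) ℝ :=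
  Matrix.of fun l k => christoffel s G l i k y

/-- The curvature matrix of a family of connection matrices. -/
def curvMat (s : Set (EuclideanSpace ℝ (Fin n)))
    (A : Fin n → EuclideanSpace ℝ (Fin n) → Matrix (Fin n) (Fin n) ℝ) (i j : Fin n)
    (y : EuclideanSpace ℝ (Fin n)) : Matrix (Fin n) (Fin n) ℝ :=
  pderivMat s i (A j) y - pderivMat s j (A i) y + (A i y * A j y - A j y * A i y)

/-- Reading the Christoffel symbols as a matrix-valued 1-form A turns curvature into dA + A ∧ A, so
that both coordinate changes and metric perturbations become matrix algebra. -/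
lemma riemann_eq_curvMat (G : EuclideanSpace ℝ (Fin n) → Matrix (Fin n) (Fin n) ℝ)
    (l k i j : Fin n) : riemann s G l k i j y = curvMat s (connMat s G) i j y l k := by
  simp [riemann, curvMat, connMat, pderivMat, Matrix.mul_apply, Finset.sum_sub_distrib]

/-- The scalar curvature as a contraction of a family of curvature matrices. -/
def scalarOf (K : Matrix (Fin n) (Fin n) ℝ) (F : Fin n → Fin n → Matrix (Fin n) (Fin n) ℝ) : ℝ :=
  ∑ k, ∑ j, K k j * ∑ i, F i j i k

lemma scalar_eq_scalarOf (G : EuclideanSpace ℝ (Fin n) → Matrix (Fin n) (Fin n) ℝ) :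
    scalar s G y = scalarOf (G y)⁻¹ (fun i j => curvMat s (connMat s G) i j y) := by
  simp only [scalar, scalarOf, ricci, riemann_eq_curvMat]

/-- `G` is, at the point `y`, a smooth field of nondegenerate symmetric matrices. -/
structure MetricAt (s : Set (EuclideanSpace ℝ (Fin n)))
    (G : EuclideanSpace ℝ (Fin n) → Matrix (Fin n) (Fin n) ℝ) (y : EuclideanSpace ℝ (Fin n)) :
    Prop where
  smooth : MatSmooth s G y
  symm : (G y).transpose = G y
  det_ne : (G y).det ≠ 0

section Conn

variable {G : EuclideanSpace ℝ (Fin n) → Matrix (Fin n) (Fin n) ℝ}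

lemma MetricAt.smooth_inv (h : MetricAt s G y) : MatSmooth s (fun z => (G z)⁻¹) y :=
  fun a b => contDiffWithinAt_inv h.smooth h.det_ne a b

lemma MetricAt.inv_mul (h : MetricAt s G y) : (G y)⁻¹ * G y = 1 :=
  Matrix.nonsing_inv_mul _ (isUnit_iff_ne_zero.2 h.det_ne)

lemma MetricAt.mul_inv (h : MetricAt s G y) : G y * (G y)⁻¹ = 1 :=
  Matrix.mul_nonsing_inv _ (isUnit_iff_ne_zero.2 h.det_ne)

lemma MetricAt.symm_inv (h : MetricAt s G y) : ((G y)⁻¹).transpose = (G y)⁻¹ := by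
  rw [Matrix.transpose_nonsing_inv, h.symm]

lemma MetricAt.smooth_connMat (hs : UniqueDiffOn ℝ s) (hy : y ∈ s) (h : MetricAt s G y)
    (i : Fin n) : MatSmooth s (connMat s G i) y := by
  intro l k
  change ContDiffWithinAt ℝ ∞ (fun z => (1 / 2) * ∑ m, (G z)⁻¹ l m * _) s y
  refine contDiffWithinAt_const.mul (ContDiffWithinAt.sum fun m _ => (h.smooth_inv l m).mul ?_)
  exact ((contDiffWithinAt_pderiv hs hy _ (h.smooth _ _)).add
    (contDiffWithinAt_pderiv hs hy _ (h.smooth _ _))).sub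
    (contDiffWithinAt_pderiv hs hy _ (h.smooth _ _))

/-- The entries of a metric which is symmetric near `y` have symmetric derivatives. -/
lemma pderiv_entry_symm (hy : y ∈ s) (h : ∀ᶠ z in 𝓝[s] y, (G z).transpose = G z) (m i j : Fin n) :
    pderiv s m (fun z => G z i j) y = pderiv s m (fun z => G z j i) y := by
  refine pderiv_congr m (h.mono fun z hz => ?_) hy
  change G z i j = (G z).transpose i j
  rw [hz]

lemma connMat_torsion (hy : y ∈ s) (h : ∀ᶠ z in 𝓝[s] y, (G z).transpose = G z) (l i k : Fin n) :
    connMat s G i y l k = connMat s G k y l i := by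
  simp only [connMat, Matrix.of_apply, christoffel]
  congr 1
  refine Finset.sum_congr rfl fun m _ => ?_
  rw [pderiv_entry_symm hy h m i k]
  ring

/-- Metric compatibility of the Levi-Civita connection. -/
lemma pderivMat_metric (hy : y ∈ s) (h : ∀ᶠ z in 𝓝[s] y, (G z).transpose = G z)
    (hdet : (G y).det ≠ 0) (i : Fin n) :
    pderivMat s i G y = G y * connMat s G i y + (G y * connMat s G i y).transpose := by
  -- Lowering the upper index cancels the inverse metric and leaves the Christoffel symbols of the
  -- first kind; their symmetrisation is the derivative of the metric.
  have key : ∀ j k, (G y * connMat s G i y) j k = (1 / 2) *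
      (pderiv s i (fun z => G z k j) y + pderiv s k (fun z => G z i j) y
        - pderiv s j (fun z => G z i k) y) := by
    intro j k
    set w : Fin n → ℝ := fun m => (1 / 2) *
      (pderiv s i (fun z => G z k m) y + pderiv s k (fun z => G z i m) y
        - pderiv s m (fun z => G z i k) y) with hw
    have h1 : ∀ l, connMat s G i y l k = ((G y)⁻¹.mulVec w) l := by
      intro l
      simp only [connMat, Matrix.of_apply, christoffel, Matrix.mulVec, dotProduct, Finset.mul_sum, hw]
      exact Finset.sum_congr rfl fun m _ => by ring
    have h2 : (G y * connMat s G i y) j k = ((G y).mulVec ((G y)⁻¹.mulVec w)) j := by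
      simp only [Matrix.mul_apply, h1, Matrix.mulVec, dotProduct]
    rw [h2, Matrix.mulVec_mulVec, Matrix.mul_nonsing_inv _ (isUnit_iff_ne_zero.2 hdet),
      Matrix.one_mulVec]
  ext j k
  rw [Matrix.add_apply, Matrix.transpose_apply, key, key]
  simp only [pderivMat, Matrix.of_apply]
  rw [pderiv_entry_symm hy h i j k, pderiv_entry_symm hy h j i k, pderiv_entry_symm hy h k i j,
    pderiv_entry_symm hy h j k i]
  ring

/-- The Levi-Civita connection is the only torsion-free metric connection. -/
lemma connMat_unique (hdet : (G y).det ≠ 0)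
    (C : Fin n → Matrix (Fin n) (Fin n) ℝ) (htor : ∀ l i k, C i l k = C k l i)
    (hmet : ∀ i, pderivMat s i G y = G y * C i + (G y * C i).transpose) (i : Fin n) :
    connMat s G i y = C i := by
  have htor' : ∀ j i k, (G y * C i) j k = (G y * C k) j i := by
    intro j i k
    simp only [Matrix.mul_apply]
    exact Finset.sum_congr rfl fun m _ => by rw [htor]
  have hm : ∀ i j k, pderiv s i (fun z => G z j k) y = (G y * C i) j k + (G y * C i) k j := by
    intro i j k
    have := congrFun (congrFun (hmet i) j) k
    exact this
  have h1 : C i = (G y)⁻¹ * (G y * C i) := by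
    rw [← Matrix.mul_assoc, Matrix.nonsing_inv_mul _ (isUnit_iff_ne_zero.2 hdet), Matrix.one_mul]
  rw [h1]
  ext l k
  simp only [connMat, Matrix.of_apply, christoffel]
  rw [Matrix.mul_apply, Finset.mul_sum]
  refine Finset.sum_congr rfl fun m _ => ?_
  -- The Koszul combination: compatibility expands the three derivatives into six terms, and
  -- torsion-freeness cancels all but two copies of `(G C_i)_{mk}`.
  rw [hm, hm, hm, htor' m k i, htor' i m k, htor' k m i]
  ring

end Conn

end Coord

namespace Coord

variable {n : ℕ} {s : Set (EuclideanSpace ℝ (Fin n))} {y : EuclideanSpace ℝ (Fin n)}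

/-! ### Invariance of the scalar curvature under changes of coordinates -/

/-- The Ricci matrix of a family of curvature matrices. -/
def ricciOf (F : Fin n → Fin n → Matrix (Fin n) (Fin n) ℝ) : Matrix (Fin n) (Fin n) ℝ :=
  Matrix.of fun k j => ∑ i, F i j i k

lemma scalarOf_eq_trace (K : Matrix (Fin n) (Fin n) ℝ)
    (F : Fin n → Fin n → Matrix (Fin n) (Fin n) ℝ) :
    scalarOf K F = (K * (ricciOf F).transpose).trace := by
  simp [scalarOf, ricciOf, Matrix.trace, Matrix.mul_apply]

/-- The Jacobian matrix of a map. -/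
def jac (s : Set (EuclideanSpace ℝ (Fin n))) (τ : EuclideanSpace ℝ (Fin n) → EuclideanSpace ℝ (Fin n))
    (y : EuclideanSpace ℝ (Fin n)) : Matrix (Fin n) (Fin n) ℝ :=
  Matrix.of fun a i => pderiv s i (fun z => τ z a) y

/-- `τ` is, at the point `y`, a smooth map into `s` with invertible Jacobian. -/
structure ChangeAt (s : Set (EuclideanSpace ℝ (Fin n)))
    (τ : EuclideanSpace ℝ (Fin n) → EuclideanSpace ℝ (Fin n)) (y : EuclideanSpace ℝ (Fin n)) :
    Prop where
  maps : ∀ᶠ z in 𝓝[s] y, τ z ∈ s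
  smooth : ContDiffWithinAt ℝ ∞ τ s y
  det_ne : (jac s τ y).det ≠ 0

section

variable {τ : EuclideanSpace ℝ (Fin n) → EuclideanSpace ℝ (Fin n)}

lemma ChangeAt.tendsto (h : ChangeAt s τ y) : Tendsto τ (𝓝[s] y) (𝓝[s] (τ y)) :=
  tendsto_nhdsWithin_iff.2 ⟨h.smooth.continuousWithinAt, h.maps⟩

lemma ChangeAt.mem (h : ChangeAt s τ y) (hy : y ∈ s) : τ y ∈ s := h.maps.self_of_nhdsWithin hy

lemma ChangeAt.smooth_apply (h : ChangeAt s τ y) (a : Fin n) :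
    ContDiffWithinAt ℝ ∞ (fun z => τ z a) s y :=
  (EuclideanSpace.proj (𝕜 := ℝ) a).contDiff.contDiffAt.comp_contDiffWithinAt y h.smooth

lemma ChangeAt.smooth_jac (hs : UniqueDiffOn ℝ s) (hy : y ∈ s) (h : ChangeAt s τ y) :
    MatSmooth s (jac s τ) y :=
  fun a i => contDiffWithinAt_pderiv hs hy i (h.smooth_apply a)

lemma ChangeAt.jac_symm (hs : UniqueDiffOn ℝ s) (hy : y ∈ s) (hcl : s ⊆ closure (interior s))
    (h : ChangeAt s τ y) (i j a : Fin n) :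
    pderivMat s i (jac s τ) y a j = pderivMat s j (jac s τ) y a i :=
  pderiv_comm hs hy hcl (h.smooth_apply a) i j

lemma ChangeAt.inv_mul (h : ChangeAt s τ y) : (jac s τ y)⁻¹ * jac s τ y = 1 :=
  Matrix.nonsing_inv_mul _ (isUnit_iff_ne_zero.2 h.det_ne)

lemma ChangeAt.mul_inv (h : ChangeAt s τ y) : jac s τ y * (jac s τ y)⁻¹ = 1 :=
  Matrix.mul_nonsing_inv _ (isUnit_iff_ne_zero.2 h.det_ne)

lemma MatSmooth.comp_change {l m : Type*} {A : EuclideanSpace ℝ (Fin n) → Matrix l m ℝ}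
    (h : ChangeAt s τ y) (hA : MatSmooth s A (τ y)) : MatSmooth s (fun z => A (τ z)) y :=
  fun a b => (hA a b).comp_of_preimage_mem_nhdsWithin y h.smooth h.maps

lemma pderivMat_comp {l m : Type*} (hs : UniqueDiffOn ℝ s) (hy : y ∈ s)
    {A : EuclideanSpace ℝ (Fin n) → Matrix l m ℝ} (i : Fin n)
    (h : ChangeAt s τ y) (hA : MatDiff s A (τ y)) :
    pderivMat s i (fun z => A (τ z)) y = ∑ a, jac s τ y a i • pderivMat s a A (τ y) := by
  ext p q
  rw [Matrix.sum_apply]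
  simp only [Matrix.smul_apply, smul_eq_mul, pderivMat, jac, Matrix.of_apply]
  rw [pderiv_comp (f := fun w => A w p q) hs hy i h.tendsto
    (h.smooth.differentiableWithinAt (by simp)) (hA p q)]
  exact Finset.sum_congr rfl fun a _ => mul_comm _ _

/-- The pulled back connection matrices, before the change of frame. -/
def pullConn (s : Set (EuclideanSpace ℝ (Fin n)))
    (τ : EuclideanSpace ℝ (Fin n) → EuclideanSpace ℝ (Fin n))
    (A : Fin n → EuclideanSpace ℝ (Fin n) → Matrix (Fin n) (Fin n) ℝ) (i : Fin n)
    (y : EuclideanSpace ℝ (Fin n)) : Matrix (Fin n) (Fin n) ℝ :=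
  ∑ a, jac s τ y a i • A a (τ y)

lemma smooth_pullConn (hs : UniqueDiffOn ℝ s) (hy : y ∈ s) (h : ChangeAt s τ y)
    {A : Fin n → EuclideanSpace ℝ (Fin n) → Matrix (Fin n) (Fin n) ℝ}
    (hA : ∀ a, MatSmooth s (A a) (τ y)) (i : Fin n) : MatSmooth s (pullConn s τ A i) y := by
  intro p q
  simp only [pullConn, Matrix.sum_apply, Matrix.smul_apply, smul_eq_mul]
  exact ContDiffWithinAt.sum fun a _ => (h.smooth_jac hs hy a i).mul ((hA a).comp_change h p q)

variable {G G' : EuclideanSpace ℝ (Fin n) → Matrix (Fin n) (Fin n) ℝ}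

/-- The transformation law of the Christoffel symbols. -/
lemma jac_mul_connMat (hs : UniqueDiffOn ℝ s) (hy : y ∈ s) (hcl : s ⊆ closure (interior s))
    (h : ChangeAt s τ y) (hG : ∀ᶠ w in 𝓝[s] (τ y), MetricAt s G w)
    (hG' : G' =ᶠ[𝓝[s] y] fun z => (jac s τ z).transpose * G (τ z) * jac s τ z) (i : Fin n) :
    jac s τ y * connMat s G' i y =
      pullConn s τ (connMat s G) i y * jac s τ y + pderivMat s i (jac s τ) y := by
  have hGy : MetricAt s G (τ y) := hG.self_of_nhdsWithin (h.mem hy)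
  have hsymm : ∀ᶠ w in 𝓝[s] (τ y), (G w).transpose = G w := hG.mono fun _ hw => hw.symm
  have hG'y : G' y = (jac s τ y).transpose * G (τ y) * jac s τ y := hG'.self_of_nhdsWithin hy
  have hdet : (G' y).det ≠ 0 := by
    rw [hG'y, Matrix.det_mul, Matrix.det_mul, Matrix.det_transpose]
    exact mul_ne_zero (mul_ne_zero h.det_ne hGy.det_ne) h.det_ne
  have hsm := h.smooth_jac hs hy
  -- The candidate J⁻¹(MJ + ∂J) is checked to be torsion-free, by symmetry of ∂J, and compatible
  -- with `G'`. Uniqueness then identifies it, and no Christoffel symbol is expanded.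
  have key := connMat_unique (s := s) (y := y) hdet
    (fun i => (jac s τ y)⁻¹ *
      (pullConn s τ (connMat s G) i y * jac s τ y + pderivMat s i (jac s τ) y)) ?_ ?_ i
  · rw [key, ← Matrix.mul_assoc, h.mul_inv, Matrix.one_mul]
  · intro l i k
    simp only [Matrix.mul_apply]
    refine Finset.sum_congr rfl fun m _ => ?_
    congr 1
    rw [Matrix.add_apply, Matrix.add_apply, h.jac_symm hs hy hcl]
    congr 1
    simp only [pullConn, Matrix.mul_apply, Matrix.sum_apply, Matrix.smul_apply, smul_eq_mul,
      Finset.sum_mul]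
    rw [Finset.sum_comm]
    refine Finset.sum_congr rfl fun a _ => Finset.sum_congr rfl fun b _ => ?_
    rw [connMat_torsion (h.mem hy) hsymm m b a]
    ring
  · intro i
    rw [pderivMat_congr i hG' hy,
      pderivMat_mul hs hy i ((hsm.transpose.mul (hGy.smooth.comp_change h)).matDiff) hsm.matDiff,
      pderivMat_mul hs hy i hsm.transpose.matDiff (hGy.smooth.comp_change h).matDiff,
      pderivMat_comp hs hy i h hGy.smooth.matDiff, pderivMat_transpose, hG'y]
    have h1 : ∑ a, jac s τ y a i • pderivMat s a G (τ y) =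
        G (τ y) * pullConn s τ (connMat s G) i y +
          (G (τ y) * pullConn s τ (connMat s G) i y).transpose := by
      simp only [pullConn, Matrix.mul_sum, Matrix.transpose_sum, ← Finset.sum_add_distrib]
      refine Finset.sum_congr rfl fun a _ => ?_
      rw [pderivMat_metric (h.mem hy) hsymm hGy.det_ne a, smul_add, Matrix.mul_smul,
        Matrix.transpose_smul]
    have h2 : ∀ X : Matrix (Fin n) (Fin n) ℝ, jac s τ y * ((jac s τ y)⁻¹ * X) = X := fun X => by
      rw [← Matrix.mul_assoc, h.mul_inv, Matrix.one_mul]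
    rw [h1, Matrix.mul_assoc _ (jac s τ y), h2]
    simp only [Matrix.transpose_mul, Matrix.transpose_add, Matrix.transpose_transpose, hGy.symm]
    noncomm_ring

/-- Curvature commutes with pullback. The chain rule also produces second derivatives of τ, which
are symmetric in i and j and disappear in the antisymmetrisation. -/
lemma curvMat_pullConn (hs : UniqueDiffOn ℝ s) (hy : y ∈ s) (hcl : s ⊆ closure (interior s))
    (h : ChangeAt s τ y) {A : Fin n → EuclideanSpace ℝ (Fin n) → Matrix (Fin n) (Fin n) ℝ}
    (hA : ∀ a, MatSmooth s (A a) (τ y)) (i j : Fin n) :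
    curvMat s (pullConn s τ A) i j y =
      ∑ b, ∑ a, (jac s τ y b i * jac s τ y a j) • curvMat s A b a (τ y) := by
  have hd : ∀ i j, pderivMat s i (pullConn s τ A j) y =
      ∑ a, pderivMat s i (jac s τ) y a j • A a (τ y) +
        ∑ b, ∑ a, (jac s τ y b i * jac s τ y a j) • pderivMat s b (A a) (τ y) := by
    intro i j
    have h1 : ∀ a, pderivMat s i (fun z => jac s τ z a j • A a (τ z)) y =
        pderivMat s i (jac s τ) y a j • A a (τ y) +
          ∑ b, (jac s τ y b i * jac s τ y a j) • pderivMat s b (A a) (τ y) := by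
      intro a
      rw [pderivMat_smul hs hy i ((h.smooth_jac hs hy).matDiff a j)
        ((hA a).comp_change h).matDiff, pderivMat_comp hs hy i h (hA a).matDiff]
      congr 1
      rw [Finset.smul_sum]
      exact Finset.sum_congr rfl fun b _ => by rw [smul_smul, mul_comm]
    have h2 : pderivMat s i (pullConn s τ A j) y =
        ∑ a, pderivMat s i (fun z => jac s τ z a j • A a (τ z)) y := by
      ext p q
      rw [Matrix.sum_apply]
      simp only [pderivMat, pullConn, Matrix.of_apply, Matrix.sum_apply]
      exact pderiv_sum hs hy _ i fun a _ =>
        (MatSmooth.smul (h.smooth_jac hs hy a j) ((hA a).comp_change h)).matDiff p q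
    rw [h2, Finset.sum_congr rfl fun a _ => h1 a, Finset.sum_add_distrib, Finset.sum_comm]
  have hc : ∀ i j, pullConn s τ A i y * pullConn s τ A j y =
      ∑ b, ∑ a, (jac s τ y b i * jac s τ y a j) • (A b (τ y) * A a (τ y)) := by
    intro i j
    simp only [pullConn, Finset.sum_mul, Finset.mul_sum]
    rw [Finset.sum_comm]
    refine Finset.sum_congr rfl fun b _ => Finset.sum_congr rfl fun a _ => ?_
    rw [Matrix.smul_mul, Matrix.mul_smul, smul_smul, mul_comm]
  have hswap : ∀ X : Fin n → Fin n → Matrix (Fin n) (Fin n) ℝ,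
      ∑ b, ∑ a, (jac s τ y b j * jac s τ y a i) • X b a =
        ∑ b, ∑ a, (jac s τ y b i * jac s τ y a j) • X a b := by
    intro X
    rw [Finset.sum_comm]
    exact Finset.sum_congr rfl fun b _ => Finset.sum_congr rfl fun a _ => by rw [mul_comm]
  rw [curvMat, hd, hd, hc, hc, hswap, hswap]
  simp only [h.jac_symm hs hy hcl j i, curvMat, smul_add, smul_sub, Finset.sum_add_distrib,
    Finset.sum_sub_distrib]
  abel

/-- Gauge covariance of curvature: differentiate JΓ' = MJ + ∂J once more and antisymmetrise. The
second derivatives of J cancel, and substituting the same relation back absorbs the remaining ∂J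
terms. -/
lemma jac_mul_curvMat (hs : UniqueDiffOn ℝ s) (hy : y ∈ s) (hcl : s ⊆ closure (interior s))
    (h : ∀ᶠ z in 𝓝[s] y, ChangeAt s τ z) (hG : ∀ᶠ w in 𝓝[s] (τ y), MetricAt s G w)
    (hG' : G' =ᶠ[𝓝[s] y] fun z => (jac s τ z).transpose * G (τ z) * jac s τ z)
    (hG's : MetricAt s G' y) (i j : Fin n) :
    jac s τ y * curvMat s (connMat s G') i j y =
      curvMat s (pullConn s τ (connMat s G)) i j y * jac s τ y := by
  have hc : ChangeAt s τ y := h.self_of_nhdsWithin hy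
  have hJ := hc.smooth_jac hs hy
  have hGτ : MetricAt s G (τ y) := hG.self_of_nhdsWithin (hc.mem hy)
  have hM : ∀ i, MatSmooth s (pullConn s τ (connMat s G) i) y :=
    smooth_pullConn hs hy hc fun a => hGτ.smooth_connMat hs (hc.mem hy) a
  have hΓ : ∀ i, MatSmooth s (connMat s G' i) y := fun i => hG's.smooth_connMat hs hy i
  have key : ∀ i, ∀ᶠ z in 𝓝[s] y, jac s τ z * connMat s G' i z =
      pullConn s τ (connMat s G) i z * jac s τ z + pderivMat s i (jac s τ) z := by
    intro i
    filter_upwards [h, hc.tendsto.eventually (eventually_eventually_nhdsWithin.2 hG),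
      eventually_eventually_nhdsWithin.2 hG', self_mem_nhdsWithin] with z h1 h2 h3 h4
    exact jac_mul_connMat hs h4 hcl h1 h2 h3 i
  have hdiff : ∀ j i, pderivMat s j (jac s τ) y * connMat s G' i y +
      jac s τ y * pderivMat s j (connMat s G' i) y =
      pderivMat s j (pullConn s τ (connMat s G) i) y * jac s τ y +
      pullConn s τ (connMat s G) i y * pderivMat s j (jac s τ) y +
      pderivMat s j (pderivMat s i (jac s τ)) y := by
    intro j i
    have h1 := pderivMat_congr j (key i) hy
    rw [pderivMat_mul hs hy j hJ.matDiff (hΓ i).matDiff,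
      pderivMat_add hs hy j ((hM i).mul hJ).matDiff (hJ.pderivMat hs hy i).matDiff,
      pderivMat_mul hs hy j (hM i).matDiff hJ.matDiff] at h1
    exact h1
  have hcomm : pderivMat s j (pderivMat s i (jac s τ)) y = pderivMat s i (pderivMat s j (jac s τ)) y := by
    ext a b
    exact pderiv_comm hs hy hcl (hJ a b) j i
  have e1 := hdiff i j
  have e2 := hdiff j i
  rw [hcomm] at e2
  have k1 := (key i).self_of_nhdsWithin hy
  have k2 := (key j).self_of_nhdsWithin hy
  simp only [curvMat]
  set J := jac s τ y
  set M := pullConn s τ (connMat s G)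
  set Γ := connMat s G'
  have f1 : J * pderivMat s i (Γ j) y = pderivMat s i (M j) y * J +
      M j y * pderivMat s i (jac s τ) y + pderivMat s i (pderivMat s j (jac s τ)) y
        - pderivMat s i (jac s τ) y * Γ j y := eq_sub_of_add_eq' e1
  have f2 : J * pderivMat s j (Γ i) y = pderivMat s j (M i) y * J +
      M i y * pderivMat s j (jac s τ) y + pderivMat s i (pderivMat s j (jac s τ)) y
        - pderivMat s j (jac s τ) y * Γ i y := eq_sub_of_add_eq' e2
  calc J * (pderivMat s i (Γ j) y - pderivMat s j (Γ i) y + (Γ i y * Γ j y - Γ j y * Γ i y))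
      = J * pderivMat s i (Γ j) y - J * pderivMat s j (Γ i) y + (J * Γ i y) * Γ j y
          - (J * Γ j y) * Γ i y := by noncomm_ring
    _ = pderivMat s i (M j) y * J + M j y * pderivMat s i (jac s τ) y
          - (pderivMat s j (M i) y * J + M i y * pderivMat s j (jac s τ) y)
          + M i y * (J * Γ j y) - M j y * (J * Γ i y) := by
        conv_lhs => rw [f1, f2, k1, k2, Matrix.add_mul, Matrix.add_mul]
        simp only [Matrix.mul_assoc]
        abel
    _ = _ := by rw [k1, k2]; noncomm_ring

/-- The scalar curvature does not depend on the coordinates. -/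
theorem scalar_change (hs : UniqueDiffOn ℝ s) (hy : y ∈ s) (hcl : s ⊆ closure (interior s))
    (h : ∀ᶠ z in 𝓝[s] y, ChangeAt s τ z) (hG : ∀ᶠ w in 𝓝[s] (τ y), MetricAt s G w)
    (hG' : G' =ᶠ[𝓝[s] y] fun z => (jac s τ z).transpose * G (τ z) * jac s τ z)
    (hG's : MetricAt s G' y) :
    scalar s G' y = scalar s G (τ y) := by
  have hc : ChangeAt s τ y := h.self_of_nhdsWithin hy
  have hGτ : MetricAt s G (τ y) := hG.self_of_nhdsWithin (hc.mem hy)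
  have hG'y : G' y = (jac s τ y).transpose * G (τ y) * jac s τ y := hG'.self_of_nhdsWithin hy
  set J := jac s τ y with hJ
  set F : Fin n → Fin n → Matrix (Fin n) (Fin n) ℝ :=
    fun b a => curvMat s (connMat s G) b a (τ y) with hF
  have hcurv : ∀ i j, curvMat s (connMat s G') i j y =
      J⁻¹ * ((∑ b, ∑ a, (J b i * J a j) • F b a) * J) := by
    intro i j
    rw [hF, ← curvMat_pullConn hs hy hcl hc (fun a => hGτ.smooth_connMat hs (hc.mem hy) a) i j,
      ← jac_mul_curvMat hs hy hcl h hG hG' hG's i j, ← Matrix.mul_assoc, hc.inv_mul,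
      Matrix.one_mul]
  have hinv : ∀ b c, ∑ i, J b i * J⁻¹ i c = if b = c then 1 else 0 := by
    intro b c
    rw [← Matrix.mul_apply, hc.mul_inv, Matrix.one_apply]
  -- In the trace defining Ricci, the Jacobian of the contracted form index meets the J⁻¹ of the
  -- frame change, and the product is the identity. What is left is the law of a bilinear form.
  have hric : ricciOf (fun i j => curvMat s (connMat s G') i j y) =
      J.transpose * ricciOf F * J := by
    ext k j
    simp only [ricciOf, hcurv, Matrix.of_apply, Matrix.mul_apply, Matrix.sum_apply,
      Matrix.smul_apply, smul_eq_mul, Matrix.transpose_apply]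
    calc ∑ i, ∑ c, J⁻¹ i c * ∑ d, (∑ b, ∑ a, J b i * J a j * F b a c d) * J d k
        = ∑ i, ∑ c, ∑ d, ∑ b, ∑ a, (J b i * J⁻¹ i c) * (J a j * F b a c d * J d k) := by
          simp only [Finset.mul_sum, Finset.sum_mul]
          refine Finset.sum_congr rfl fun i _ => Finset.sum_congr rfl fun c _ =>
            Finset.sum_congr rfl fun d _ => Finset.sum_congr rfl fun b _ =>
            Finset.sum_congr rfl fun a _ => by ring
      _ = ∑ c, ∑ d, ∑ b, ∑ a, ∑ i, (J b i * J⁻¹ i c) * (J a j * F b a c d * J d k) := by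
          rw [Finset.sum_comm]
          refine Finset.sum_congr rfl fun c _ => ?_
          rw [Finset.sum_comm]
          refine Finset.sum_congr rfl fun d _ => ?_
          rw [Finset.sum_comm]
          refine Finset.sum_congr rfl fun b _ => ?_
          rw [Finset.sum_comm]
      _ = ∑ c, ∑ d, ∑ a, J a j * F c a c d * J d k := by
          refine Finset.sum_congr rfl fun c _ => Finset.sum_congr rfl fun d _ => ?_
          rw [Finset.sum_eq_single c]
          · exact Finset.sum_congr rfl fun a _ => by rw [← Finset.sum_mul, hinv]; simp
          · intro b _ hbc
            exact Finset.sum_eq_zero fun a _ => by rw [← Finset.sum_mul, hinv]; simp [hbc]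
          · simp
      _ = ∑ a, (∑ d, J d k * ∑ c, F c a c d) * J a j := by
          simp only [Finset.mul_sum, Finset.sum_mul]
          trans ∑ d, ∑ c, ∑ a, J a j * F c a c d * J d k
          · exact Finset.sum_comm
          trans ∑ d, ∑ a, ∑ c, J d k * F c a c d * J a j
          · refine Finset.sum_congr rfl fun d _ => ?_
            rw [Finset.sum_comm]
            exact Finset.sum_congr rfl fun a _ => Finset.sum_congr rfl fun c _ => by ring
          · exact Finset.sum_comm
  rw [scalar_eq_scalarOf, scalar_eq_scalarOf, scalarOf_eq_trace, scalarOf_eq_trace, hric]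
  have hinvG : (G' y)⁻¹ = J⁻¹ * (G (τ y))⁻¹ * (J⁻¹).transpose := by
    rw [hG'y, Matrix.mul_inv_rev, Matrix.mul_inv_rev, Matrix.transpose_nonsing_inv,
      Matrix.mul_assoc]
  have hJt : (J⁻¹).transpose * J.transpose = 1 := by
    rw [← Matrix.transpose_mul, hc.mul_inv, Matrix.transpose_one]
  rw [hinvG, Matrix.transpose_mul, Matrix.transpose_mul, Matrix.transpose_transpose]
  calc (J⁻¹ * (G (τ y))⁻¹ * (J⁻¹).transpose * (J.transpose * ((ricciOf F).transpose * J))).trace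
      = (J⁻¹ * ((G (τ y))⁻¹ * ((J⁻¹).transpose * J.transpose) * (ricciOf F).transpose * J)).trace := by
        simp only [Matrix.mul_assoc]
    _ = ((G (τ y))⁻¹ * (ricciOf F).transpose * (J * J⁻¹)).trace := by
        rw [hJt, Matrix.mul_one, Matrix.trace_mul_comm]; simp only [Matrix.mul_assoc]
    _ = _ := by rw [hc.mul_inv, Matrix.mul_one]

end

end Coord

namespace Coord

variable {n : ℕ} {s : Set (EuclideanSpace ℝ (Fin n))} {y : EuclideanSpace ℝ (Fin n)}

/-! ### Rank one perturbations of a metric -/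

/-- The differential of `ρ` as a column. -/
def gradCol (s : Set (EuclideanSpace ℝ (Fin n))) (ρ : EuclideanSpace ℝ (Fin n) → ℝ)
    (y : EuclideanSpace ℝ (Fin n)) : Matrix (Fin n) Unit ℝ :=
  Matrix.of fun a _ => pderiv s a ρ y

/-- The `i`-th column of the covariant Hessian of `ρ`. -/
def hessCol (s : Set (EuclideanSpace ℝ (Fin n)))
    (G : EuclideanSpace ℝ (Fin n) → Matrix (Fin n) (Fin n) ℝ)
    (ρ : EuclideanSpace ℝ (Fin n) → ℝ) (i : Fin n)
    (y : EuclideanSpace ℝ (Fin n)) : Matrix (Fin n) Unit ℝ :=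
  pderivMat s i (gradCol s ρ) y - (connMat s G i y).transpose * gradCol s ρ y

/-- The metric `G + f dρ ⊗ dρ`. -/
def perturb (s : Set (EuclideanSpace ℝ (Fin n)))
    (G : EuclideanSpace ℝ (Fin n) → Matrix (Fin n) (Fin n) ℝ)
    (ρ f : EuclideanSpace ℝ (Fin n) → ℝ) (y : EuclideanSpace ℝ (Fin n)) :
    Matrix (Fin n) (Fin n) ℝ :=
  G y + f y • (gradCol s ρ y * (gradCol s ρ y).transpose)

/-- The gradient vector of `ρ` as a column. -/
def gradVec (s : Set (EuclideanSpace ℝ (Fin n)))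
    (G : EuclideanSpace ℝ (Fin n) → Matrix (Fin n) (Fin n) ℝ)
    (ρ : EuclideanSpace ℝ (Fin n) → ℝ)
    (y : EuclideanSpace ℝ (Fin n)) : Matrix (Fin n) Unit ℝ :=
  (G y)⁻¹ * gradCol s ρ y

/-- The squared norm of the gradient of `ρ`. -/
def gradSq (s : Set (EuclideanSpace ℝ (Fin n)))
    (G : EuclideanSpace ℝ (Fin n) → Matrix (Fin n) (Fin n) ℝ)
    (ρ : EuclideanSpace ℝ (Fin n) → ℝ)
    (y : EuclideanSpace ℝ (Fin n)) : ℝ :=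
  ∑ i, gradVec s G ρ y i () * gradCol s ρ y i ()

/-- The quantity `|∇ρ|² Δρ - ∇²ρ(∇ρ, ∇ρ)`. It is `-|∇ρ|³` times the mean curvature of the level
set of `ρ` with respect to `-∇ρ`. -/
def levelBend (s : Set (EuclideanSpace ℝ (Fin n)))
    (G : EuclideanSpace ℝ (Fin n) → Matrix (Fin n) (Fin n) ℝ)
    (ρ : EuclideanSpace ℝ (Fin n) → ℝ)
    (y : EuclideanSpace ℝ (Fin n)) : ℝ :=
  gradSq s G ρ y * (∑ i, ((G y)⁻¹ * hessCol s G ρ i y) i ()) -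
    ∑ i, ∑ j, gradVec s G ρ y i () * gradVec s G ρ y j () * hessCol s G ρ i y j ()

variable {G : EuclideanSpace ℝ (Fin n) → Matrix (Fin n) (Fin n) ℝ}
  {ρ : EuclideanSpace ℝ (Fin n) → ℝ} {ψ : ℝ → ℝ}

lemma smooth_gradCol (hs : UniqueDiffOn ℝ s) (hy : y ∈ s) (hρ : ContDiffWithinAt ℝ ∞ ρ s y) :
    MatSmooth s (gradCol s ρ) y := fun a _ => contDiffWithinAt_pderiv hs hy a hρ

lemma smooth_hessCol (hs : UniqueDiffOn ℝ s) (hy : y ∈ s) (hG : MetricAt s G y)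
    (hρ : ContDiffWithinAt ℝ ∞ ρ s y) (i : Fin n) : MatSmooth s (hessCol s G ρ i) y :=
  fun a b => ((smooth_gradCol hs hy hρ).pderivMat hs hy i a b).sub
    ((hG.smooth_connMat hs hy i).transpose.mul (smooth_gradCol hs hy hρ) a b)

lemma hessCol_symm (hs : UniqueDiffOn ℝ s) (hy : y ∈ s) (hcl : s ⊆ closure (interior s))
    (hG : ∀ᶠ z in 𝓝[s] y, MetricAt s G z) (hρ : ContDiffWithinAt ℝ ∞ ρ s y) (i j : Fin n)
    (u : Unit) : hessCol s G ρ i y j u = hessCol s G ρ j y i u := by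
  have h1 : pderivMat s i (gradCol s ρ) y j u = pderivMat s j (gradCol s ρ) y i u :=
    pderiv_comm hs hy hcl hρ i j
  simp only [hessCol, Matrix.sub_apply, Matrix.mul_apply, Matrix.transpose_apply, h1]
  congr 1
  exact Finset.sum_congr rfl fun m _ => by
    rw [connMat_torsion hy (hG.mono fun _ h => h.symm) m i j]

lemma pderivMat_perturb (hs : UniqueDiffOn ℝ s) (hy : y ∈ s)
    (hG : MetricAt s G y) (hρ : ContDiffWithinAt ℝ ∞ ρ s y) (hψ : ContDiff ℝ ∞ ψ) (i : Fin n) :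
    pderivMat s i (perturb s G ρ (fun z => ψ (ρ z))) y = pderivMat s i G y +
      ((deriv ψ (ρ y) * pderiv s i ρ y) • (gradCol s ρ y * (gradCol s ρ y).transpose) +
      ψ (ρ y) • (pderivMat s i (gradCol s ρ) y * (gradCol s ρ y).transpose +
        gradCol s ρ y * (pderivMat s i (gradCol s ρ) y).transpose)) := by
  have hr := smooth_gradCol hs hy hρ
  have hψρ : ContDiffWithinAt ℝ ∞ (fun z => ψ (ρ z)) s y :=
    hψ.contDiffAt.comp_contDiffWithinAt y hρ
  have h1 : perturb s G ρ (fun z => ψ (ρ z)) = fun z => G z +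
      (fun z => (fun z => ψ (ρ z)) z • (fun z => gradCol s ρ z * (gradCol s ρ z).transpose) z) z :=
    rfl
  rw [h1, pderivMat_add hs hy i hG.smooth.matDiff (MatSmooth.smul hψρ (hr.mul hr.transpose)).matDiff,
    pderivMat_smul hs hy i (hψρ.differentiableWithinAt (by simp)) (hr.mul hr.transpose).matDiff,
    pderivMat_mul hs hy i hr.matDiff hr.transpose.matDiff,
    pderiv_comp_left hs hy i (hψ.differentiable (by simp) _) (hρ.differentiableWithinAt (by simp))]
  rfl

/-- The covector `E_i` in the difference of the two connections. -/
def pertCol (s : Set (EuclideanSpace ℝ (Fin n)))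
    (G : EuclideanSpace ℝ (Fin n) → Matrix (Fin n) (Fin n) ℝ)
    (ρ : EuclideanSpace ℝ (Fin n) → ℝ) (ψ : ℝ → ℝ) (i : Fin n)
    (y : EuclideanSpace ℝ (Fin n)) : Matrix (Fin n) Unit ℝ :=
  ψ (ρ y) • hessCol s G ρ i y + (deriv ψ (ρ y) / 2 * pderiv s i ρ y) • gradCol s ρ y

/-- The Levi-Civita connection of the perturbed metric. -/
lemma connMat_perturb (hs : UniqueDiffOn ℝ s) (hy : y ∈ s) (hcl : s ⊆ closure (interior s))
    (hG : ∀ᶠ z in 𝓝[s] y, MetricAt s G z) (hρ : ContDiffWithinAt ℝ ∞ ρ s y) (hψ : ContDiff ℝ ∞ ψ)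
    (hdet : (perturb s G ρ (fun z => ψ (ρ z)) y).det ≠ 0) (i : Fin n) :
    connMat s (perturb s G ρ (fun z => ψ (ρ z))) i y = connMat s G i y +
      gradVec s (perturb s G ρ (fun z => ψ (ρ z))) ρ y * (pertCol s G ρ ψ i y).transpose := by
  have hGy := hG.self_of_nhdsWithin hy
  have hGs : ∀ᶠ z in 𝓝[s] y, (G z).transpose = G z := hG.mono fun _ h => h.symm
  have hV : perturb s G ρ (fun z => ψ (ρ z)) y *
      gradVec s (perturb s G ρ (fun z => ψ (ρ z))) ρ y = gradCol s ρ y := by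
    rw [gradVec, ← Matrix.mul_assoc, Matrix.mul_nonsing_inv _ (isUnit_iff_ne_zero.2 hdet),
      Matrix.one_mul]
  -- The candidate is Γ_i + ∇'ρ E_iᵀ, with ∇' the gradient of the perturbed metric `G'`. As `G'`
  -- sends ∇'ρ to dρ, lowering the index gives dρ E_iᵀ, whose symmetrisation is the covariant
  -- derivative of ψ(ρ) dρ ⊗ dρ. Symmetry of the Hessian gives torsion-freeness.
  refine connMat_unique hdet (fun i => connMat s G i y +
      gradVec s (perturb s G ρ (fun z => ψ (ρ z))) ρ y * (pertCol s G ρ ψ i y).transpose) ?_ ?_ i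
  · intro l i k
    simp only [Matrix.add_apply, Matrix.mul_apply, Matrix.transpose_apply]
    rw [connMat_torsion hy hGs]
    congr 1
    refine Finset.sum_congr rfl fun u _ => ?_
    congr 1
    simp only [pertCol, Matrix.add_apply, Matrix.smul_apply, smul_eq_mul]
    rw [hessCol_symm hs hy hcl hG hρ i k]
    simp only [gradCol, Matrix.of_apply]
    ring
  · intro i
    rw [pderivMat_perturb hs hy hGy hρ hψ, pderivMat_metric hy hGs hGy.det_ne i, Matrix.mul_add,
      ← Matrix.mul_assoc, hV, perturb, pertCol, hessCol]
    set r := gradCol s ρ y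
    set d := pderivMat s i (gradCol s ρ) y
    set Γ := connMat s G i y
    set c := deriv ψ (ρ y) / 2 * pderiv s i ρ y with hc
    have hc2 : deriv ψ (ρ y) * pderiv s i ρ y = c + c := by rw [hc]; ring
    rw [hc2]
    generalize ψ (ρ y) = p
    simp only [Matrix.transpose_add, Matrix.transpose_sub, Matrix.transpose_mul,
      Matrix.transpose_smul, Matrix.transpose_transpose, Matrix.mul_add, Matrix.add_mul,
      Matrix.mul_sub, Matrix.smul_mul, Matrix.mul_smul, add_smul, smul_add,
      smul_sub, Matrix.mul_assoc, hGy.symm]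
    abel

/-- The derivative of the gradient field of the perturbed metric. -/
lemma pderivMat_gradVec_perturb (hs : UniqueDiffOn ℝ s) (hy : y ∈ s)
    (hG : ∀ᶠ z in 𝓝[s] y, MetricAt s G z) (hρ : ContDiffWithinAt ℝ ∞ ρ s y) (hψ : ContDiff ℝ ∞ ψ)
    (hG' : ∀ᶠ z in 𝓝[s] y, MetricAt s (perturb s G ρ (fun z => ψ (ρ z))) z)
    (h0 : ψ (ρ y) = 0) (i : Fin n) :
    pderivMat s i (gradVec s (perturb s G ρ (fun z => ψ (ρ z))) ρ) y +
        connMat s G i y * gradVec s G ρ y =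
      (G y)⁻¹ * hessCol s G ρ i y -
        (deriv ψ (ρ y) * gradSq s G ρ y * pderiv s i ρ y) • gradVec s G ρ y := by
  have hGy := hG.self_of_nhdsWithin hy
  have hGy' := hG'.self_of_nhdsWithin hy
  have hGs : ∀ᶠ z in 𝓝[s] y, (G z).transpose = G z := hG.mono fun _ h => h.symm
  set G' := perturb s G ρ (fun z => ψ (ρ z)) with hG'def
  have hG'y : G' y = G y := by simp [hG'def, perturb, h0]
  have hr := smooth_gradCol hs hy hρ
  have hVs : MatSmooth s (gradVec s G' ρ) y := MatSmooth.mul hGy'.smooth_inv hr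
  have hVy : gradVec s G' ρ y = gradVec s G ρ y := by rw [gradVec, gradVec, hG'y]
  -- Differentiating this identity avoids differentiating an inverse matrix.
  have key : ∀ᶠ z in 𝓝[s] y, G' z * gradVec s G' ρ z = gradCol s ρ z := by
    filter_upwards [hG'] with z hz
    rw [gradVec, ← Matrix.mul_assoc, hz.mul_inv, Matrix.one_mul]
  have hd := pderivMat_congr i key hy
  rw [pderivMat_mul hs hy i hGy'.smooth.matDiff hVs.matDiff, hG'y, hVy, hG'def,
    pderivMat_perturb hs hy hGy hρ hψ i, h0, zero_smul, add_zero, ← hG'def,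
    pderivMat_metric hy hGs hGy.det_ne i] at hd
  have hGV : G y * gradVec s G ρ y = gradCol s ρ y := by
    rw [gradVec, ← Matrix.mul_assoc, hGy.mul_inv, Matrix.one_mul]
  have hw : (gradCol s ρ y).transpose * gradVec s G ρ y = gradSq s G ρ y • 1 := by
    ext u v
    simp [gradSq, Matrix.mul_apply, mul_comm]
  have hd2 : G y * pderivMat s i (gradVec s G' ρ) y = hessCol s G ρ i y -
      G y * (connMat s G i y * gradVec s G ρ y) -
      (deriv ψ (ρ y) * gradSq s G ρ y * pderiv s i ρ y) • gradCol s ρ y := by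
    have e1 : (G y * connMat s G i y).transpose * gradVec s G ρ y =
        (connMat s G i y).transpose * gradCol s ρ y := by
      rw [Matrix.transpose_mul, hGy.symm, Matrix.mul_assoc, hGV]
    have e2 : (deriv ψ (ρ y) * pderiv s i ρ y) • (gradCol s ρ y * (gradCol s ρ y).transpose) *
        gradVec s G ρ y =
        (deriv ψ (ρ y) * gradSq s G ρ y * pderiv s i ρ y) • gradCol s ρ y := by
      rw [Matrix.smul_mul, Matrix.mul_assoc, hw, Matrix.mul_smul, Matrix.mul_one, smul_smul]
      congr 1
      ring
    rw [Matrix.add_mul, Matrix.add_mul, e1, e2, Matrix.mul_assoc] at hd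
    rw [hessCol, ← hd]
    abel
  have hfin : pderivMat s i (gradVec s G' ρ) y =
      (G y)⁻¹ * (G y * pderivMat s i (gradVec s G' ρ) y) := by
    rw [← Matrix.mul_assoc, hGy.inv_mul, Matrix.one_mul]
  rw [hfin, hd2, Matrix.mul_sub, Matrix.mul_sub, ← Matrix.mul_assoc (G y)⁻¹ (G y), hGy.inv_mul,
    Matrix.one_mul, Matrix.mul_smul]
  change _ - _ - _ • gradVec s G ρ y + _ = _
  abel

/-- The curvature of the perturbed metric at a point where the perturbation vanishes. -/
lemma curvMat_perturb (hs : UniqueDiffOn ℝ s) (hy : y ∈ s) (hcl : s ⊆ closure (interior s))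
    (hG : ∀ᶠ z in 𝓝[s] y, MetricAt s G z) (hρ : ∀ᶠ z in 𝓝[s] y, ContDiffWithinAt ℝ ∞ ρ s z)
    (hψ : ContDiff ℝ ∞ ψ)
    (hG' : ∀ᶠ z in 𝓝[s] y, MetricAt s (perturb s G ρ (fun z => ψ (ρ z))) z)
    (h0 : ψ (ρ y) = 0) (i j : Fin n) :
    curvMat s (connMat s (perturb s G ρ (fun z => ψ (ρ z)))) i j y =
      curvMat s (connMat s G) i j y + (deriv ψ (ρ y) / 2) •
        ((G y)⁻¹ * (pderiv s j ρ y • hessCol s G ρ i y - pderiv s i ρ y • hessCol s G ρ j y) *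
            (gradCol s ρ y).transpose +
          gradVec s G ρ y * (pderiv s i ρ y • hessCol s G ρ j y -
            pderiv s j ρ y • hessCol s G ρ i y).transpose) := by
  have hGy := hG.self_of_nhdsWithin hy
  have hGy' := hG'.self_of_nhdsWithin hy
  have hρy := hρ.self_of_nhdsWithin hy
  set G' := perturb s G ρ (fun z => ψ (ρ z)) with hG'def
  have hG'y : G' y = G y := by simp [hG'def, perturb, h0]
  have hr := smooth_gradCol hs hy hρy
  have hVs : MatSmooth s (gradVec s G' ρ) y := MatSmooth.mul hGy'.smooth_inv hr
  have hVy : gradVec s G' ρ y = gradVec s G ρ y := by rw [gradVec, gradVec, hG'y]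
  have hψρ : ContDiffWithinAt ℝ ∞ (fun z => ψ (ρ z)) s y :=
    hψ.contDiffAt.comp_contDiffWithinAt y hρy
  have hψ' : ContDiff ℝ ∞ (deriv ψ) := by
    exact (contDiff_infty_iff_deriv.1 hψ).2
  have hψ'ρ : ContDiffWithinAt ℝ ∞ (fun z => deriv ψ (ρ z)) s y :=
    hψ'.contDiffAt.comp_contDiffWithinAt y hρy
  have hcoef : ∀ i, ContDiffWithinAt ℝ ∞ (fun z => deriv ψ (ρ z) / 2 * pderiv s i ρ z) s y :=
    fun i => (hψ'ρ.div_const 2).mul (contDiffWithinAt_pderiv hs hy i hρy)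
  have hEs : ∀ i, MatSmooth s (pertCol s G ρ ψ i) y := fun i =>
    MatSmooth.add (MatSmooth.smul hψρ (smooth_hessCol hs hy hGy hρy i))
      (MatSmooth.smul (hcoef i) hr)
  have hconn : ∀ i, ∀ᶠ z in 𝓝[s] y, connMat s G' i z =
      connMat s G i z + gradVec s G' ρ z * (pertCol s G ρ ψ i z).transpose := by
    intro i
    filter_upwards [eventually_eventually_nhdsWithin.2 hG, hρ, hG', self_mem_nhdsWithin]
      with z h1 h2 h3 h4
    exact connMat_perturb hs h4 hcl h1 h2 hψ h3.det_ne i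
  -- Since ψ(ρ y) = 0, the Hessian part of E_i vanishes at y and contributes only through its first
  -- derivative.
  have hE0 : ∀ i, pertCol s G ρ ψ i y = (deriv ψ (ρ y) / 2 * pderiv s i ρ y) • gradCol s ρ y := by
    intro i; simp [pertCol, h0]
  have hdE : ∀ i j, pderivMat s i (pertCol s G ρ ψ j) y =
      (deriv ψ (ρ y) * pderiv s i ρ y) • hessCol s G ρ j y +
      ((deriv (deriv ψ) (ρ y) * pderiv s i ρ y / 2 * pderiv s j ρ y +
        deriv ψ (ρ y) / 2 * pderiv s i (pderiv s j ρ) y) • gradCol s ρ y +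
       (deriv ψ (ρ y) / 2 * pderiv s j ρ y) • pderivMat s i (gradCol s ρ) y) := by
    intro i j
    have e : pertCol s G ρ ψ j = fun z => (fun z => (fun z => ψ (ρ z)) z • hessCol s G ρ j z) z +
        (fun z => (fun z => deriv ψ (ρ z) / 2 * pderiv s j ρ z) z • gradCol s ρ z) z := rfl
    rw [e, pderivMat_add hs hy i (MatSmooth.smul hψρ (smooth_hessCol hs hy hGy hρy j)).matDiff
        (MatSmooth.smul (hcoef j) hr).matDiff,
      pderivMat_smul hs hy i (hψρ.differentiableWithinAt (by simp))
        (smooth_hessCol hs hy hGy hρy j).matDiff,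
      pderivMat_smul hs hy i ((hcoef j).differentiableWithinAt (by simp)) hr.matDiff,
      pderiv_comp_left hs hy i (hψ.differentiable (by simp) _)
        (hρy.differentiableWithinAt (by simp)), h0, zero_smul, add_zero]
    have e2 : pderiv s i (fun z => deriv ψ (ρ z) / 2 * pderiv s j ρ z) y =
        deriv (deriv ψ) (ρ y) * pderiv s i ρ y / 2 * pderiv s j ρ y +
        deriv ψ (ρ y) / 2 * pderiv s i (pderiv s j ρ) y := by
      rw [pderiv_mul hs hy i ((hψ'ρ.div_const 2).differentiableWithinAt (by simp))
        ((contDiffWithinAt_pderiv hs hy j hρy).differentiableWithinAt (by simp))]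
      have e3 : pderiv s i (fun z => deriv ψ (ρ z) / 2) y =
          deriv (deriv ψ) (ρ y) * pderiv s i ρ y / 2 := by
        have := pderiv_comp_left (φ := fun t => deriv ψ t / 2) hs hy i
          ((hψ'.differentiable (by simp) _).div_const 2)
          (hρy.differentiableWithinAt (by simp))
        rw [this, deriv_div_const]
        ring
      rw [e3]
    rw [e2]
  have hX : ∀ i j, pderivMat s i (connMat s G' j) y = pderivMat s i (connMat s G j) y +
      (pderivMat s i (gradVec s G' ρ) y * (pertCol s G ρ ψ j y).transpose +
        gradVec s G ρ y * (pderivMat s i (pertCol s G ρ ψ j) y).transpose) := by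
    intro i j
    rw [pderivMat_congr i (hconn j) hy,
      pderivMat_add hs hy i (hGy.smooth_connMat hs hy j).matDiff
        (hVs.mul (hEs j).transpose).matDiff,
      pderivMat_mul hs hy i hVs.matDiff (hEs j).transpose.matDiff, pderivMat_transpose, hVy]
  have hN : ∀ i, pderivMat s i (gradVec s G' ρ) y = (G y)⁻¹ * hessCol s G ρ i y -
        (deriv ψ (ρ y) * gradSq s G ρ y * pderiv s i ρ y) • gradVec s G ρ y -
        connMat s G i y * gradVec s G ρ y := fun i =>
    eq_sub_of_add_eq (pderivMat_gradVec_perturb hs hy hG hρy hψ hG' h0 i)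
  have hdr : ∀ i, pderivMat s i (gradCol s ρ) y = hessCol s G ρ i y +
      (connMat s G i y).transpose * gradCol s ρ y := fun i => by rw [hessCol]; abel
  have hsym : pderiv s j (pderiv s i ρ) y = pderiv s i (pderiv s j ρ) y :=
    pderiv_comm hs hy hcl hρy j i
  have hw : (gradCol s ρ y).transpose * gradVec s G ρ y = gradSq s G ρ y • 1 := by
    ext u v
    simp [gradSq, Matrix.mul_apply, mul_comm]
  have hw' : ∀ X : Matrix Unit (Fin n) ℝ, (gradCol s ρ y).transpose * (gradVec s G ρ y * X) =
      gradSq s G ρ y • X := fun X => by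
    rw [← Matrix.mul_assoc, hw, Matrix.smul_mul, Matrix.one_mul]
  rw [curvMat, curvMat, hX, hX, (hconn i).self_of_nhdsWithin hy,
    (hconn j).self_of_nhdsWithin hy, hVy, hdE, hdE, hE0, hE0, hN, hN, hdr, hdr, hsym]
  set r := gradCol s ρ y
  set V := gradVec s G ρ y
  set K := (G y)⁻¹
  set hi := hessCol s G ρ i y
  set hj := hessCol s G ρ j y
  set Γi := connMat s G i y
  set Γj := connMat s G j y
  generalize pderivMat s i (connMat s G j) y = A
  generalize pderivMat s j (connMat s G i) y = B
  generalize pderiv s i ρ y = ri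
  generalize pderiv s j ρ y = rj
  generalize pderiv s i (pderiv s j ρ) y = rij
  generalize gradSq s G ρ y = w at *
  generalize deriv ψ (ρ y) = a
  generalize deriv (deriv ψ) (ρ y) = b
  -- The terms in ψ'', in ∂_i∂_jρ and those quadratic in ψ' are symmetric in i and j, so they
  -- cancel; the result is linear in ψ'.
  simp only [Matrix.transpose_add, Matrix.transpose_sub, Matrix.transpose_mul,
    Matrix.transpose_smul, Matrix.transpose_transpose, Matrix.mul_add, Matrix.add_mul,
    Matrix.mul_sub, Matrix.sub_mul, Matrix.smul_mul, Matrix.mul_smul, smul_add,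
    smul_sub, Matrix.mul_assoc, smul_smul, hw']
  module

/-- The scalar curvature of the perturbed metric at a point where the perturbation vanishes. -/
theorem scalar_perturb (hs : UniqueDiffOn ℝ s) (hy : y ∈ s) (hcl : s ⊆ closure (interior s))
    (hG : ∀ᶠ z in 𝓝[s] y, MetricAt s G z) (hρ : ∀ᶠ z in 𝓝[s] y, ContDiffWithinAt ℝ ∞ ρ s z)
    (hψ : ContDiff ℝ ∞ ψ)
    (hG' : ∀ᶠ z in 𝓝[s] y, MetricAt s (perturb s G ρ (fun z => ψ (ρ z))) z)
    (h0 : ψ (ρ y) = 0) :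
    scalar s (perturb s G ρ (fun z => ψ (ρ z))) y =
      scalar s G y + deriv ψ (ρ y) * levelBend s G ρ y := by
  have hGy := hG.self_of_nhdsWithin hy
  have hρy := hρ.self_of_nhdsWithin hy
  have hG'y : perturb s G ρ (fun z => ψ (ρ z)) y = G y := by simp [perturb, h0]
  rw [scalar_eq_scalarOf, scalar_eq_scalarOf, hG'y]
  simp only [curvMat_perturb hs hy hcl hG hρ hψ hG' h0]
  set K := (G y)⁻¹ with hK
  set H : Fin n → Fin n → ℝ := fun i j => hessCol s G ρ i y j () with hH
  have hHs : ∀ i j, H i j = H j i := fun i j => hessCol_symm hs hy hcl hG hρy i j ()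
  set r : Fin n → ℝ := fun i => pderiv s i ρ y with hr
  set V : Fin n → ℝ := fun i => gradVec s G ρ y i () with hV
  have hVr : ∀ i, V i = ∑ j, K i j * r j := fun i => by
    simp only [hV, gradVec, Matrix.mul_apply]; rfl
  have hKs : ∀ i j, K i j = K j i := fun i j => by
    rw [hK]; conv_lhs => rw [← hGy.symm_inv]
    rfl
  have hw : gradSq s G ρ y = ∑ i, V i * r i := rfl
  have hbend : levelBend s G ρ y = (∑ i, V i * r i) * (∑ i, ∑ m, K i m * H i m) -
      ∑ i, ∑ j, V i * V j * H i j := rfl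
  have hent : ∀ i j k, ((deriv ψ (ρ y) / 2) •
        (K * (pderiv s j ρ y • hessCol s G ρ i y - pderiv s i ρ y • hessCol s G ρ j y) *
            (gradCol s ρ y).transpose +
          gradVec s G ρ y * (pderiv s i ρ y • hessCol s G ρ j y -
            pderiv s j ρ y • hessCol s G ρ i y).transpose)) i k =
      (deriv ψ (ρ y) / 2) * ((∑ m, K i m * (r j * H i m - r i * H j m)) * r k +
        V i * (r i * H j k - r j * H i k)) := by
    intro i j k
    simp [Matrix.mul_apply, hH, hr, hV, gradCol]
  set L := ∑ i, ∑ m, K i m * H i m with hL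
  set q : Fin n → ℝ := fun j => ∑ m, V m * H j m with hq
  have hVr' : ∀ j, V j = ∑ k, K k j * r k := fun j => by
    rw [hVr]; exact Finset.sum_congr rfl fun k _ => by rw [hKs]
  have t1 : ∀ j k, ∑ i, (∑ m, K i m * (r j * H i m - r i * H j m)) * r k =
      r k * (r j * L - q j) := by
    intro j k
    rw [← Finset.sum_mul, mul_comm]
    congr 1
    have e : q j = ∑ i, ∑ m, K i m * r i * H j m := by
      rw [Finset.sum_comm]
      exact Finset.sum_congr rfl fun m _ => by rw [hVr', Finset.sum_mul]
    rw [e, hL, Finset.mul_sum, ← Finset.sum_sub_distrib]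
    refine Finset.sum_congr rfl fun i _ => ?_
    rw [Finset.mul_sum, ← Finset.sum_sub_distrib]
    exact Finset.sum_congr rfl fun m _ => by ring
  have t2 : ∀ j k, ∑ i, V i * (r i * H j k - r j * H i k) =
      (∑ i, V i * r i) * H j k - r j * q k := by
    intro j k
    rw [hq, Finset.sum_mul, Finset.mul_sum, ← Finset.sum_sub_distrib]
    exact Finset.sum_congr rfl fun i _ => by rw [hHs k i]; ring
  -- The two rank-one pieces of the curvature variation contract to the same quantity |∇ρ|²Δρ -
  -- ∇²ρ(∇ρ,∇ρ), which makes up for the factor 1/2 in ψ'/2.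
  have s1 : ∑ k, ∑ j, K k j * ∑ i, (∑ m, K i m * (r j * H i m - r i * H j m)) * r k =
      (∑ i, V i * r i) * L - ∑ j, V j * q j := by
    rw [Finset.sum_comm, Finset.sum_mul, ← Finset.sum_sub_distrib]
    refine Finset.sum_congr rfl fun j _ => ?_
    trans V j * (r j * L - q j)
    · rw [hVr', Finset.sum_mul]
      exact Finset.sum_congr rfl fun k _ => by rw [t1]; ring
    · ring
  have s2 : ∑ k, ∑ j, K k j * ∑ i, V i * (r i * H j k - r j * H i k) =
      (∑ i, V i * r i) * L - ∑ j, V j * q j := by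
    rw [hL, Finset.mul_sum, ← Finset.sum_sub_distrib]
    refine Finset.sum_congr rfl fun k _ => ?_
    have e : V k * q k = ∑ j, K k j * r j * q k := by rw [hVr, Finset.sum_mul]
    rw [e, Finset.mul_sum, ← Finset.sum_sub_distrib]
    exact Finset.sum_congr rfl fun j _ => by rw [t2, hHs k j]; ring
  have hbend' : levelBend s G ρ y = (∑ i, V i * r i) * L - ∑ j, V j * q j := by
    rw [hbend]
    congr 1
    refine Finset.sum_congr rfl fun i _ => ?_
    rw [hq, Finset.mul_sum]
    exact Finset.sum_congr rfl fun j _ => by ring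
  have hsum : scalarOf K (fun i j => curvMat s (connMat s G) i j y + (deriv ψ (ρ y) / 2) •
        (K * (pderiv s j ρ y • hessCol s G ρ i y - pderiv s i ρ y • hessCol s G ρ j y) *
            (gradCol s ρ y).transpose +
          gradVec s G ρ y * (pderiv s i ρ y • hessCol s G ρ j y -
            pderiv s j ρ y • hessCol s G ρ i y).transpose)) =
      scalarOf K (fun i j => curvMat s (connMat s G) i j y) + (deriv ψ (ρ y) / 2) *
        (∑ k, ∑ j, K k j * ∑ i, (∑ m, K i m * (r j * H i m - r i * H j m)) * r k +
          ∑ k, ∑ j, K k j * ∑ i, V i * (r i * H j k - r j * H i k)) := by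
    simp only [scalarOf, Matrix.add_apply, hent]
    rw [← Finset.sum_add_distrib, Finset.mul_sum, ← Finset.sum_add_distrib]
    refine Finset.sum_congr rfl fun k _ => ?_
    rw [← Finset.sum_add_distrib, Finset.mul_sum, ← Finset.sum_add_distrib]
    refine Finset.sum_congr rfl fun j _ => ?_
    rw [Finset.sum_add_distrib, ← Finset.mul_sum, Finset.sum_add_distrib]
    ring
  rw [hsum, s1, s2, hbend']
  ring

end Coord

namespace Coord

/-! ### Mean curvature -/

/-- The inverse of the tangential block of a metric, in terms of the inverse metric. -/
lemma submatrix_inv (A : Matrix (Fin 3) (Fin 3) ℝ) (hA : A.det ≠ 0) (h0 : A⁻¹ 0 0 ≠ 0)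
    (a b : Fin 2) : (A.submatrix Fin.succ Fin.succ)⁻¹ a b =
      A⁻¹ a.succ b.succ - A⁻¹ a.succ 0 * A⁻¹ 0 b.succ / A⁻¹ 0 0 := by
  -- The Schur complement formula, verified by multiplication: splitting off the index 0 in A A⁻¹ =
  -- 1 accounts for the correction term.
  have key : A.submatrix Fin.succ Fin.succ * (Matrix.of fun a b : Fin 2 =>
      A⁻¹ a.succ b.succ - A⁻¹ a.succ 0 * A⁻¹ 0 b.succ / A⁻¹ 0 0) = 1 := by
    have h1 : ∀ i j, ∑ k, A i k * A⁻¹ k j = if i = j then 1 else 0 := fun i j => by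
      rw [← Matrix.mul_apply, Matrix.mul_nonsing_inv _ (isUnit_iff_ne_zero.2 hA), Matrix.one_apply]
    ext a c
    have h2 := h1 a.succ c.succ
    have h3 := h1 a.succ 0
    rw [Fin.sum_univ_succ] at h2 h3
    simp only [Fin.succ_inj, Fin.succ_ne_zero, if_false] at h2 h3
    rw [Matrix.mul_apply, Matrix.one_apply]
    simp only [Matrix.submatrix_apply, Matrix.of_apply, mul_sub, Finset.sum_sub_distrib]
    have h4 : ∑ b : Fin 2, A a.succ b.succ * (A⁻¹ b.succ 0 * A⁻¹ 0 c.succ / A⁻¹ 0 0) =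
        (∑ b : Fin 2, A a.succ b.succ * A⁻¹ b.succ 0) * (A⁻¹ 0 c.succ / A⁻¹ 0 0) := by
      rw [Finset.sum_mul]
      exact Finset.sum_congr rfl fun _ _ => by ring
    rw [h4, eq_neg_of_add_eq_zero_right h3, eq_sub_of_add_eq' h2]
    field_simp
    ring
  rw [Matrix.inv_eq_right_inv key]
  rfl

variable {n : ℕ} {s : Set (EuclideanSpace ℝ (Fin n))} {y : EuclideanSpace ℝ (Fin n)}

/-- The gradient field of a rank one perturbation. -/
lemma gradVec_perturb {G : EuclideanSpace ℝ (Fin n) → Matrix (Fin n) (Fin n) ℝ}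
    {ρ f : EuclideanSpace ℝ (Fin n) → ℝ} (hG : (G y).det ≠ 0)
    (hG' : (perturb s G ρ f y).det ≠ 0) (hD : 1 + f y * gradSq s G ρ y ≠ 0) :
    gradVec s (perturb s G ρ f) ρ y = (1 + f y * gradSq s G ρ y)⁻¹ • gradVec s G ρ y := by
  have hGV : G y * gradVec s G ρ y = gradCol s ρ y := by
    rw [gradVec, ← Matrix.mul_assoc, Matrix.mul_nonsing_inv _ (isUnit_iff_ne_zero.2 hG),
      Matrix.one_mul]
  have hw : (gradCol s ρ y).transpose * gradVec s G ρ y = gradSq s G ρ y • 1 := by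
    ext u v
    simp [gradSq, Matrix.mul_apply, mul_comm]
  -- The Sherman–Morrison formula in the only direction needed: the rescaled gradient solves the
  -- linear system that defines the new one.
  have h1 : perturb s G ρ f y * ((1 + f y * gradSq s G ρ y)⁻¹ • gradVec s G ρ y) =
      gradCol s ρ y := by
    rw [perturb, Matrix.mul_smul, Matrix.add_mul, hGV, Matrix.smul_mul, Matrix.mul_assoc, hw,
      Matrix.mul_smul, Matrix.mul_one, smul_smul]
    have h2 : gradCol s ρ y + (f y * gradSq s G ρ y) • gradCol s ρ y =
        (1 + f y * gradSq s G ρ y) • gradCol s ρ y := by rw [add_smul, one_smul]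
    rw [h2, smul_smul, inv_mul_cancel₀ hD, one_smul]
  rw [gradVec, ← h1, ← Matrix.mul_assoc, Matrix.nonsing_inv_mul _ (isUnit_iff_ne_zero.2 hG'),
    Matrix.one_mul]

section Three

variable {s : Set (EuclideanSpace ℝ (Fin 3))} {y : EuclideanSpace ℝ (Fin 3)}
  {G : EuclideanSpace ℝ (Fin 3) → Matrix (Fin 3) (Fin 3) ℝ}
  {ρ : EuclideanSpace ℝ (Fin 3) → ℝ} {ψ : ℝ → ℝ}

/-- The conormal has only a component of index 0, so just Γ^0_ab survives; the sign of the conormal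
cancels the sign in the second fundamental form. -/
lemma meanCurvature_eq : meanCurvature s G y =
    (∑ a, ∑ b, ((G y).submatrix Fin.succ Fin.succ)⁻¹ a b * christoffel s G 0 a.succ b.succ y) *
      (Real.sqrt ((G y)⁻¹ 0 0))⁻¹ := by
  simp only [meanCurvature, Finset.sum_mul]
  refine Finset.sum_congr rfl fun a _ => Finset.sum_congr rfl fun b _ => ?_
  rw [secondFundamentalForm, Finset.sum_eq_single 0]
  · simp only [outwardConormal, if_true]; ring
  · intro k _ hk; simp [outwardConormal, hk]
  · simp

/-- `ρ` vanishes to first order along the boundary `{x₀ = 0}` at `y`, with derivatives up to second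
order tangential to it equal to zero. -/
structure FlatAt (s : Set (EuclideanSpace ℝ (Fin 3))) (ρ : EuclideanSpace ℝ (Fin 3) → ℝ)
    (y : EuclideanSpace ℝ (Fin 3)) : Prop where
  first : ∀ a : Fin 2, pderiv s a.succ ρ y = 0
  second : ∀ a b : Fin 2, pderiv s a.succ (pderiv s b.succ ρ) y = 0

/-- Once the tangential derivatives are gone, the tangential Hessian sees only Γ^0_ab. This is the
bridge from the Hessian of a defining function to the second fundamental form. -/
lemma FlatAt.hessCol (h : FlatAt s ρ y) (a b : Fin 2) (u : Unit) :
    hessCol s G ρ a.succ y b.succ u = -(pderiv s 0 ρ y * christoffel s G 0 a.succ b.succ y) := by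
  have h2 : pderivMat s a.succ (gradCol s ρ) y b.succ u = 0 := h.second a b
  rw [Coord.hessCol, Matrix.sub_apply, h2, Matrix.mul_apply, Fin.sum_univ_succ]
  have h3 : ∀ i : Fin 2, gradCol s ρ y i.succ u = 0 := h.first
  simp only [h3, mul_zero, Finset.sum_const_zero, add_zero, zero_sub, Matrix.transpose_apply]
  simp only [connMat, gradCol, Matrix.of_apply]
  ring

lemma FlatAt.gradVec (h : FlatAt s ρ y) (i : Fin 3) (u : Unit) :
    gradVec s G ρ y i u = (G y)⁻¹ i 0 * pderiv s 0 ρ y := by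
  rw [Coord.gradVec, Matrix.mul_apply, Fin.sum_univ_succ]
  have h3 : ∀ i : Fin 2, gradCol s ρ y i.succ u = 0 := h.first
  simp only [h3, mul_zero, Finset.sum_const_zero, add_zero]
  rfl

lemma FlatAt.gradSq (h : FlatAt s ρ y) : gradSq s G ρ y = (G y)⁻¹ 0 0 * pderiv s 0 ρ y ^ 2 := by
  rw [Coord.gradSq, Fin.sum_univ_succ]
  have h3 : ∀ i : Fin 2, gradCol s ρ y i.succ () = 0 := h.first
  simp only [h3, mul_zero, Finset.sum_const_zero, add_zero, h.gradVec]
  simp only [gradCol, Matrix.of_apply]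
  ring

/-- The mean curvature of the boundary in terms of a defining function. -/
theorem levelBend_eq (hs : UniqueDiffOn ℝ s) (hy : y ∈ s) (hcl : s ⊆ closure (interior s))
    (hG : ∀ᶠ z in 𝓝[s] y, MetricAt s G z) (hρ : ContDiffWithinAt ℝ ∞ ρ s y)
    (h : FlatAt s ρ y) (hK : 0 < (G y)⁻¹ 0 0) :
    levelBend s G ρ y =
      -((pderiv s 0 ρ y ^ 3 * (G y)⁻¹ 0 0 * Real.sqrt ((G y)⁻¹ 0 0)) * meanCurvature s G y) := by
  have hGy := hG.self_of_nhdsWithin hy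
  have hKs : ∀ i j, (G y)⁻¹ i j = (G y)⁻¹ j i := fun i j => by
    conv_lhs => rw [← hGy.symm_inv]
    rfl
  have hHs : ∀ i j, hessCol s G ρ i y j () = hessCol s G ρ j y i () :=
    fun i j => hessCol_symm hs hy hcl hG hρ i j ()
  have hsq : Real.sqrt ((G y)⁻¹ 0 0) ≠ 0 := (Real.sqrt_pos.2 hK).ne'
  rw [meanCurvature_eq, mul_comm (∑ a, _), ← mul_assoc, mul_inv_cancel_right₀ hsq]
  simp only [levelBend, h.gradSq, h.gradVec, Matrix.mul_apply,
    submatrix_inv (G y) hGy.det_ne hK.ne']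
  have hab : ∀ a b, pderiv s 0 ρ y * christoffel s G 0 (Fin.succ a) (Fin.succ b) y =
    -hessCol s G ρ a.succ y b.succ () := fun a b => by rw [h.hessCol]; ring
  have e : pderiv s 0 ρ y ^ 3 * (G y)⁻¹ 0 0 * ∑ a : Fin 2, ∑ b : Fin 2,
      ((G y)⁻¹ a.succ b.succ - (G y)⁻¹ a.succ 0 * (G y)⁻¹ 0 b.succ / (G y)⁻¹ 0 0) *
        christoffel s G 0 a.succ b.succ y = -(pderiv s 0 ρ y ^ 2 * ∑ a : Fin 2, ∑ b : Fin 2,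
      ((G y)⁻¹ 0 0 * (G y)⁻¹ a.succ b.succ - (G y)⁻¹ a.succ 0 * (G y)⁻¹ 0 b.succ) *
        hessCol s G ρ a.succ y b.succ ()) := by
    simp only [Finset.mul_sum, ← Finset.sum_neg_distrib]
    refine Finset.sum_congr rfl fun a _ => Finset.sum_congr rfl fun b _ => ?_
    rw [← neg_neg (hessCol s G ρ a.succ y b.succ ()), ← hab]
    field_simp
  rw [e]
  -- In `levelBend` the entry h_ij carries the coefficient ρ_0²(K_00 K_ij - K_i0 K_0j), with K the
  -- inverse metric. It vanishes when i or j is 0, so only the tangential trace remains.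
  simp only [Fin.sum_univ_succ, Finset.univ_eq_empty, Finset.sum_empty, Fin.succ_zero_eq_one,
    Fin.isValue, add_zero]
  rw [hKs 0 1, hKs 0 (Fin.succ 1), hHs 0 1, hHs 0 (Fin.succ 1)]
  ring

/-- The mean curvature of the boundary for a rank one perturbation of the metric. -/
theorem meanCurvature_perturb (hs : UniqueDiffOn ℝ s) (hy : y ∈ s) (hcl : s ⊆ closure (interior s))
    (hG : ∀ᶠ z in 𝓝[s] y, MetricAt s G z) (hρ : ContDiffWithinAt ℝ ∞ ρ s y) (hψ : ContDiff ℝ ∞ ψ)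
    (h : FlatAt s ρ y) (hc : pderiv s 0 ρ y ≠ 0) (hK : 0 < (G y)⁻¹ 0 0)
    (hdet : (perturb s G ρ (fun z => ψ (ρ z)) y).det ≠ 0) (h0 : 0 ≤ ψ (ρ y)) :
    meanCurvature s (perturb s G ρ (fun z => ψ (ρ z))) y =
      (Real.sqrt (1 + ψ (ρ y) * gradSq s G ρ y))⁻¹ * meanCurvature s G y := by
  have hGy := hG.self_of_nhdsWithin hy
  have hD : 0 < 1 + ψ (ρ y) * gradSq s G ρ y := by
    rw [h.gradSq]; positivity
  have hVG := gradVec_perturb (f := fun z => ψ (ρ z)) hGy.det_ne hdet hD.ne'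
  set D := 1 + ψ (ρ y) * gradSq s G ρ y with hDdef
  have hV0 : gradVec s (perturb s G ρ (fun z => ψ (ρ z))) ρ y 0 () =
      D⁻¹ * ((G y)⁻¹ 0 0 * pderiv s 0 ρ y) := by
    rw [hVG, Matrix.smul_apply, h.gradVec]; rfl
  have hK' : (perturb s G ρ (fun z => ψ (ρ z)) y)⁻¹ 0 0 = D⁻¹ * (G y)⁻¹ 0 0 := by
    rw [h.gradVec, ← mul_assoc] at hV0
    exact mul_right_cancel₀ hc hV0
  have hsub : (perturb s G ρ (fun z => ψ (ρ z)) y).submatrix Fin.succ Fin.succ =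
      (G y).submatrix (Fin.succ : Fin 2 → Fin 3) Fin.succ := by
    ext a b
    have h3 : ∀ i : Fin 2, ∀ u, gradCol s ρ y i.succ u = 0 := fun i _ => h.first i
    simp [perturb, Matrix.mul_apply, h3]
  -- The term of E_a with ψ' carries a tangential derivative of ρ and vanishes. Thus Γ^0_ab scales
  -- by D⁻¹, the induced metric is unchanged, and the unit conormal scales by √D, for a total factor
  -- D^(-1/2).
  have hΓ : ∀ a b : Fin 2, christoffel s (perturb s G ρ (fun z => ψ (ρ z))) 0 a.succ b.succ y =
      D⁻¹ * christoffel s G 0 a.succ b.succ y := by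
    intro a b
    have h1 := congrFun (congrFun (connMat_perturb hs hy hcl hG hρ hψ hdet a.succ) 0) b.succ
    have h2 : pertCol s G ρ ψ a.succ y b.succ () =
        -(ψ (ρ y) * (pderiv s 0 ρ y * christoffel s G 0 a.succ b.succ y)) := by
      simp only [pertCol, Matrix.add_apply, Matrix.smul_apply, h.hessCol, h.first, smul_eq_mul]
      ring
    rw [Matrix.add_apply, Matrix.mul_apply] at h1
    simp only [Finset.univ_unique, Finset.sum_singleton, Matrix.transpose_apply,
      PUnit.default_eq_unit, hV0, h2] at h1
    change _ = christoffel s G 0 a.succ b.succ y + _ at h1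
    refine h1.trans ?_
    have : ψ (ρ y) * ((G y)⁻¹ 0 0 * pderiv s 0 ρ y ^ 2) = D - 1 := by
      rw [hDdef, h.gradSq]; ring
    field_simp
    linear_combination (-christoffel s G 0 a.succ b.succ y) * this
  rw [meanCurvature_eq, meanCurvature_eq, hsub, hK', Real.sqrt_mul (by positivity), Real.sqrt_inv,
    mul_inv, inv_inv]
  simp only [hΓ]
  have e : ∑ a : Fin 2, ∑ b : Fin 2, ((G y).submatrix Fin.succ Fin.succ)⁻¹ a b *
      (D⁻¹ * christoffel s G 0 a.succ b.succ y) = D⁻¹ * ∑ a : Fin 2, ∑ b : Fin 2,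
      ((G y).submatrix Fin.succ Fin.succ)⁻¹ a b * christoffel s G 0 a.succ b.succ y := by
    simp only [Finset.mul_sum]
    exact Finset.sum_congr rfl fun a _ => Finset.sum_congr rfl fun b _ => by ring
  have hsD : D⁻¹ * Real.sqrt D = (Real.sqrt D)⁻¹ := by
    have := Real.mul_self_sqrt hD.le
    have hne := (Real.sqrt_pos.2 hD).ne'
    field_simp
    nlinarith
  rw [e, ← hsD]
  ring

end Three

end Coord

namespace Coord

variable {n : ℕ} {s : Set (EuclideanSpace ℝ (Fin n))} {y : EuclideanSpace ℝ (Fin n)}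

/-! ### Smooth dependence of the curvature on the size of the perturbation -/

/-- The size c of the perturbation is carried as an extra variable: joint regularity in (point, c)
is what lets constants be uniform over a compact range of c. -/
lemma contDiffWithinAt_pderiv_param (hs : UniqueDiffOn ℝ s) (hy : y ∈ s)
    {f : EuclideanSpace ℝ (Fin n) × ℝ → ℝ} {c : ℝ} (i : Fin n)
    (hf : ContDiffWithinAt ℝ ∞ f (s ×ˢ univ) (y, c)) :
    ContDiffWithinAt ℝ ∞ (fun p : EuclideanSpace ℝ (Fin n) × ℝ => pderiv s i (fun z => f (z, p.2)) p.1)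
      (s ×ˢ univ) (y, c) := by
  refine ContDiffWithinAt.fderivWithin_apply (s := s ×ˢ univ) (n := ∞) (f := fun p z => f (z, p.2)) (g := Prod.fst)
    (k := fun _ => EuclideanSpace.single i 1) (t := s) ?_ contDiffWithinAt_fst
    contDiffWithinAt_const hs (by simp) ⟨hy, mem_univ _⟩ (fun p hp => hp.1)
  have h : ContDiffWithinAt ℝ ∞ (fun q : (EuclideanSpace ℝ (Fin n) × ℝ) × EuclideanSpace ℝ (Fin n) =>
      ((q.2, q.1.2) : EuclideanSpace ℝ (Fin n) × ℝ)) ((s ×ˢ univ) ×ˢ s) ((y, c), y) :=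
    (contDiff_snd.prodMk (contDiff_snd.comp contDiff_fst)).contDiffWithinAt
  exact ContDiffWithinAt.comp (((y, c), y) : (EuclideanSpace ℝ (Fin n) × ℝ) × EuclideanSpace ℝ (Fin n))
    hf h (fun q hq => ⟨hq.2, mem_univ _⟩)

lemma contDiffWithinAt_fst_param {f : EuclideanSpace ℝ (Fin n) → ℝ} (c : ℝ)
    (hf : ContDiffWithinAt ℝ ∞ f s y) :
    ContDiffWithinAt ℝ ∞ (fun p : EuclideanSpace ℝ (Fin n) × ℝ => f p.1) (s ×ˢ univ) (y, c) :=
  ContDiffWithinAt.comp ((y, c) : EuclideanSpace ℝ (Fin n) × ℝ) hf contDiffWithinAt_fst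
    (fun _ hq => hq.1)

/-- A family of metrics depending smoothly on a parameter. -/
structure FamilyAt (s : Set (EuclideanSpace ℝ (Fin n)))
    (G : ℝ → EuclideanSpace ℝ (Fin n) → Matrix (Fin n) (Fin n) ℝ) (y : EuclideanSpace ℝ (Fin n))
    (c : ℝ) : Prop where
  smooth : ∀ i j, ContDiffWithinAt ℝ ∞
    (fun p : EuclideanSpace ℝ (Fin n) × ℝ => G p.2 p.1 i j) (s ×ˢ univ) (y, c)
  det_ne : (G c y).det ≠ 0

section Family

variable {G : ℝ → EuclideanSpace ℝ (Fin n) → Matrix (Fin n) (Fin n) ℝ} {c : ℝ}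

lemma FamilyAt.smooth_inv (h : FamilyAt s G y c) (i j : Fin n) : ContDiffWithinAt ℝ ∞
    (fun p : EuclideanSpace ℝ (Fin n) × ℝ => (G p.2 p.1)⁻¹ i j) (s ×ˢ univ) (y, c) :=
  contDiffWithinAt_inv (A := fun p : EuclideanSpace ℝ (Fin n) × ℝ => G p.2 p.1) h.smooth h.det_ne i j

lemma FamilyAt.smooth_christoffel (h : FamilyAt s G y c) (hs : UniqueDiffOn ℝ s) (hy : y ∈ s)
    (k i j : Fin n) : ContDiffWithinAt ℝ ∞
    (fun p : EuclideanSpace ℝ (Fin n) × ℝ => christoffel s (G p.2) k i j p.1)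
      (s ×ˢ univ) (y, c) := by
  unfold christoffel
  have hp := fun m i j => contDiffWithinAt_pderiv_param hs hy m (h.smooth i j)
  exact contDiffWithinAt_const.mul (ContDiffWithinAt.sum fun l _ =>
    (h.smooth_inv k l).mul (((hp i j l).add (hp j i l)).sub (hp l i j)))

lemma FamilyAt.smooth_scalar (h : FamilyAt s G y c) (hs : UniqueDiffOn ℝ s) (hy : y ∈ s) :
    ContDiffWithinAt ℝ ∞
      (fun p : EuclideanSpace ℝ (Fin n) × ℝ => scalar s (G p.2) p.1) (s ×ˢ univ) (y, c) := by
  unfold scalar ricci riemann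
  have hΓ := h.smooth_christoffel hs hy
  have hp := fun m k i j => contDiffWithinAt_pderiv_param hs hy m (hΓ k i j)
  refine ContDiffWithinAt.sum fun k _ => ContDiffWithinAt.sum fun j _ => (h.smooth_inv k j).mul
    (ContDiffWithinAt.sum fun i _ => ((hp i i j k).sub (hp j i i k)).add
      (ContDiffWithinAt.sum fun p _ => ((hΓ i i p).mul (hΓ p j k)).sub ((hΓ i j p).mul (hΓ p i k))))

lemma FamilyAt.smooth_gradVec (h : FamilyAt s G y c) (hs : UniqueDiffOn ℝ s) (hy : y ∈ s)
    {ρ : EuclideanSpace ℝ (Fin n) → ℝ} (hρ : ContDiffWithinAt ℝ ∞ ρ s y) (i : Fin n) (u : Unit) :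
    ContDiffWithinAt ℝ ∞
      (fun p : EuclideanSpace ℝ (Fin n) × ℝ => gradVec s (G p.2) ρ p.1 i u) (s ×ˢ univ) (y, c) := by
  simp only [gradVec, Matrix.mul_apply]
  exact ContDiffWithinAt.sum fun m _ => (h.smooth_inv i m).mul
    (contDiffWithinAt_fst_param c (smooth_gradCol hs hy hρ m u))

lemma FamilyAt.smooth_hessCol (h : FamilyAt s G y c) (hs : UniqueDiffOn ℝ s) (hy : y ∈ s)
    {ρ : EuclideanSpace ℝ (Fin n) → ℝ} (hρ : ContDiffWithinAt ℝ ∞ ρ s y) (i j : Fin n) (u : Unit) :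
    ContDiffWithinAt ℝ ∞
      (fun p : EuclideanSpace ℝ (Fin n) × ℝ => hessCol s (G p.2) ρ i p.1 j u)
      (s ×ˢ univ) (y, c) := by
  simp only [hessCol, Matrix.mul_apply, Matrix.sub_apply]
  exact (contDiffWithinAt_fst_param c ((smooth_gradCol hs hy hρ).pderivMat hs hy i j u)).sub
    (ContDiffWithinAt.sum fun m _ => (h.smooth_christoffel hs hy m i j).mul
      (contDiffWithinAt_fst_param c (smooth_gradCol hs hy hρ m u)))

lemma FamilyAt.smooth_levelBend (h : FamilyAt s G y c) (hs : UniqueDiffOn ℝ s) (hy : y ∈ s)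
    {ρ : EuclideanSpace ℝ (Fin n) → ℝ} (hρ : ContDiffWithinAt ℝ ∞ ρ s y) :
    ContDiffWithinAt ℝ ∞
      (fun p : EuclideanSpace ℝ (Fin n) × ℝ => levelBend s (G p.2) ρ p.1) (s ×ˢ univ) (y, c) := by
  have hr := fun m => contDiffWithinAt_fst_param c (smooth_gradCol hs hy hρ m ())
  have hV := fun m => h.smooth_gradVec hs hy hρ m ()
  have hH := fun i j => h.smooth_hessCol hs hy hρ i j ()
  simp only [levelBend, gradSq, Matrix.mul_apply]
  exact ((ContDiffWithinAt.sum fun m _ => (hV m).mul (hr m)).mul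
    (ContDiffWithinAt.sum fun i _ => ContDiffWithinAt.sum fun m _ =>
      (h.smooth_inv i m).mul (hH i m))).sub
    (ContDiffWithinAt.sum fun i _ => ContDiffWithinAt.sum fun j _ =>
      ((hV i).mul (hV j)).mul (hH i j))

end Family

/-! ### Lower bounds for the scalar curvature, uniform in the perturbation -/

/-- `G` is, at the point `y`, a smooth field of positive definite matrices. -/
structure RiemAt (s : Set (EuclideanSpace ℝ (Fin n)))
    (G : EuclideanSpace ℝ (Fin n) → Matrix (Fin n) (Fin n) ℝ) (y : EuclideanSpace ℝ (Fin n)) :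
    Prop where
  smooth : MatSmooth s G y
  posDef : (G y).PosDef

variable {G : EuclideanSpace ℝ (Fin n) → Matrix (Fin n) (Fin n) ℝ}
  {ρ : EuclideanSpace ℝ (Fin n) → ℝ}

lemma RiemAt.metricAt (h : RiemAt s G y) : MetricAt s G y where
  smooth := h.smooth
  symm := by simpa using h.posDef.isHermitian.eq
  det_ne := h.posDef.det_pos.ne'

lemma RiemAt.inv_diag_pos (h : RiemAt s G y) (i : Fin n) : 0 < (G y)⁻¹ i i :=
  h.posDef.inv.diag_pos

lemma RiemAt.perturb (hs : UniqueDiffOn ℝ s) (hy : y ∈ s) (h : RiemAt s G y)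
    (hρ : ContDiffWithinAt ℝ ∞ ρ s y) {f : EuclideanSpace ℝ (Fin n) → ℝ}
    (hf : ContDiffWithinAt ℝ ∞ f s y) (h0 : 0 ≤ f y) : RiemAt s (perturb s G ρ f) y where
  smooth := h.smooth.add (MatSmooth.smul hf
    ((smooth_gradCol hs hy hρ).mul (smooth_gradCol hs hy hρ).transpose))
  posDef := by
    refine h.posDef.add_posSemidef (Matrix.PosSemidef.smul ?_ h0)
    have := Matrix.posSemidef_self_mul_conjTranspose (gradCol s ρ y)
    simpa using this

lemma RiemAt.familyAt (hs : UniqueDiffOn ℝ s) (hy : y ∈ s) (h : RiemAt s G y)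
    (hρ : ContDiffWithinAt ℝ ∞ ρ s y) {c : ℝ} (h0 : 0 ≤ c) :
    FamilyAt s (fun c => Coord.perturb s G ρ (fun _ => c)) y c where
  smooth i j := by
    simp only [Coord.perturb, Matrix.add_apply, Matrix.smul_apply, smul_eq_mul]
    exact (contDiffWithinAt_fst_param c (h.smooth i j)).add (contDiffWithinAt_snd.mul
      (contDiffWithinAt_fst_param c
        ((smooth_gradCol hs hy hρ).mul (smooth_gradCol hs hy hρ).transpose i j)))
  det_ne := (h.perturb hs hy hρ contDiffWithinAt_const h0).metricAt.det_ne

/-- A continuously differentiable function of a parameter decreases at most linearly. -/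
lemma eventually_sub_mul_le {X : Type*} [NormedAddCommGroup X] [NormedSpace ℝ X] {t : Set X}
    (ht : Convex ℝ t) {x : X} {F : X × ℝ → ℝ} {c₀ : ℝ} (hc₀ : 0 ≤ c₀)
    (hF : ∀ c, 0 ≤ c → ContDiffWithinAt ℝ 1 F (t ×ˢ univ) (x, c)) :
    ∃ C, ∀ᶠ p in 𝓝[t ×ˢ univ] (x, c₀), 0 ≤ p.2 → F (p.1, 0) - C * p.2 ≤ F p := by
  rcases hc₀.eq_or_lt with rfl | h0
  -- At c₀ = 0 a linear bound is genuinely needed; it is the local Lipschitz estimate between (x, c)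
  -- and (x, 0), which uses convexity of the domain.
  · obtain ⟨K, u, hu, hK⟩ := (hF 0 le_rfl).exists_lipschitzOnWith (ht.prod convex_univ)
    refine ⟨K, ?_⟩
    rw [nhdsWithin_prod_eq, nhdsWithin_univ] at hu ⊢
    obtain ⟨u₁, hu₁, v, hv, huv⟩ := mem_prod_iff.1 hu
    filter_upwards [prod_mem_prod hu₁ hv] with p hp hp0
    have h1 := hK.dist_le_mul (p.1, p.2) (huv ⟨hp.1, hp.2⟩) (p.1, 0)
      (huv ⟨hp.1, mem_of_mem_nhds hv⟩)
    have h2 : dist (p.1, p.2) (p.1, (0 : ℝ)) = p.2 := by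
      simp [Prod.dist_eq, abs_of_nonneg hp0, hp0]
    rw [h2, Real.dist_eq] at h1
    have := neg_abs_le (F (p.1, p.2) - F (p.1, 0))
    change _ ≤ F (p.1, p.2)
    linarith
  · have hF0 : ContinuousWithinAt (fun p : X × ℝ => F (p.1, 0)) (t ×ˢ univ) (x, c₀) :=
      ContinuousWithinAt.comp (t := t ×ˢ univ) (g := F) (f := fun p : X × ℝ => (p.1, (0 : ℝ)))
        (x := (x, c₀)) (hF 0 le_rfl).continuousWithinAt
        (by fun_prop : Continuous fun p : X × ℝ => (p.1, (0 : ℝ))).continuousWithinAt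
        (fun p hp => ⟨hp.1, mem_univ _⟩)
    set M := F (x, 0) - F (x, c₀) with hM
    have hd : ∀ᶠ p in 𝓝[t ×ˢ univ] (x, c₀), F (p.1, 0) - F p < |M| + 1 :=
      (hF0.sub (hF c₀ hc₀).continuousWithinAt).eventually (gt_mem_nhds (by
        change M < |M| + 1
        linarith [le_abs_self M]))
    have hc' : ∀ᶠ p in 𝓝[t ×ˢ univ] (x, c₀), c₀ / 2 < p.2 :=
      continuousWithinAt_snd.eventually (lt_mem_nhds (by change c₀ / 2 < c₀; linarith))
    -- Away from c = 0 continuity suffices: the loss stays below |M| + 1 while the parameter exceeds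
    -- c₀/2, so a large constant pays for it.
    refine ⟨(|M| + 1) / (c₀ / 2), ?_⟩
    filter_upwards [hd, hc'] with p h1 h2 _
    have h3 : |M| + 1 ≤ (|M| + 1) / (c₀ / 2) * p.2 := by
      rw [div_mul_eq_mul_div, le_div_iff₀ (by linarith)]
      exact mul_le_mul_of_nonneg_left h2.le (by positivity)
    linarith

/-- The lower bound that governs the scalar curvature of the perturbed metrics. -/
lemma frozen_estimate (hs : UniqueDiffOn ℝ s) (hconv : Convex ℝ s) (hy : y ∈ s)
    (h : RiemAt s G y) (hρ : ContDiffWithinAt ℝ ∞ ρ s y) (Φ : ℝ)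
    (hb : ∀ c ∈ Icc 0 Φ, levelBend s (perturb s G ρ (fun _ => c)) ρ y < 0) :
    ∃ a > 0, ∃ C, ∀ᶠ z in 𝓝[s] y, ∀ c ∈ Icc 0 Φ,
      scalar s G z - C * c ≤ scalar s (perturb s G ρ (fun _ => c)) z ∧
        levelBend s (perturb s G ρ (fun _ => c)) ρ z ≤ -a := by
  have hzero : perturb s G ρ (fun _ => 0) = G := by
    funext z; simp [perturb]
  -- Compactness induction over [0, Φ]. The clause `0 ≤ c` is part of the property because the
  -- neighbourhoods met in the induction may contain negative values of c.
  set P : Set ℝ → Prop := fun K => ∃ a > 0, ∃ C, ∀ᶠ z in 𝓝[s] y, ∀ c ∈ K, 0 ≤ c →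
      scalar s G z - C * c ≤ scalar s (perturb s G ρ (fun _ => c)) z ∧
        levelBend s (perturb s G ρ (fun _ => c)) ρ z ≤ -a with hP
  suffices hK : P (Icc 0 Φ) by
    obtain ⟨a, ha, C, hC⟩ := hK
    exact ⟨a, ha, C, hC.mono fun z hz c hc => hz c hc hc.1⟩
  refine isCompact_Icc.induction_on (p := P) ⟨1, one_pos, 0, by simp⟩ ?_ ?_ ?_
  · rintro K K' hKK ⟨a, ha, C, hC⟩
    exact ⟨a, ha, C, hC.mono fun z hz c hc => hz c (hKK hc)⟩
  · rintro K K' ⟨a, ha, C, hC⟩ ⟨a', ha', C', hC'⟩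
    refine ⟨min a a', lt_min ha ha', max C C', ?_⟩
    filter_upwards [hC, hC'] with z hz hz' c hc hc0
    rcases hc with hc | hc
    · obtain ⟨h1, h2⟩ := hz c hc hc0
      have := mul_le_mul_of_nonneg_right (le_max_left C C') hc0
      exact ⟨by linarith, h2.trans (neg_le_neg (min_le_left _ _))⟩
    · obtain ⟨h1, h2⟩ := hz' c hc hc0
      have := mul_le_mul_of_nonneg_right (le_max_right C C') hc0
      exact ⟨by linarith, h2.trans (neg_le_neg (min_le_right _ _))⟩
  · intro c₀ hc₀
    have hfam := fun c hc => h.familyAt (c := c) hs hy hρ hc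
    have hL := ((hfam c₀ hc₀.1).smooth_levelBend hs hy hρ).continuousWithinAt
    have hLb := hb c₀ hc₀
    set b := levelBend s (perturb s G ρ (fun _ => c₀)) ρ y with hbdef
    have hLe : ∀ᶠ p in 𝓝[s ×ˢ univ] ((y, c₀) : EuclideanSpace ℝ (Fin n) × ℝ),
        levelBend s (perturb s G ρ (fun _ => p.2)) ρ p.1 < b / 2 :=
      hL.eventually (gt_mem_nhds (by change b < b / 2; linarith))
    obtain ⟨C, hC⟩ := eventually_sub_mul_le hconv hc₀.1
      (F := fun p => scalar s (perturb s G ρ (fun _ => p.2)) p.1)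
      (fun c hc => ((hfam c hc).smooth_scalar hs hy).of_le (WithTop.coe_le_coe.2 le_top))
    simp only [hzero] at hC
    have hall := hC.and hLe
    rw [nhdsWithin_prod_eq, nhdsWithin_univ] at hall
    obtain ⟨pa, hpa, pb, hpb, hab⟩ := Filter.eventually_prod_iff.1 hall
    refine ⟨{c | pb c}, mem_nhdsWithin_of_mem_nhds hpb, -b / 2, by linarith, C, ?_⟩
    filter_upwards [hpa] with z hz c hc hc0
    have := hab hz hc
    exact ⟨this.1 hc0, by linarith [this.2]⟩

/-- The scalar curvature of `G + φ(ρ) dρ ⊗ dρ`, for a function `φ` of one variable. -/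
lemma scalar_perturb_eq_frozen (hs : UniqueDiffOn ℝ s) (hy : y ∈ s) (hcl : s ⊆ closure (interior s))
    (h : ∀ᶠ z in 𝓝[s] y, RiemAt s G z) (hρ : ∀ᶠ z in 𝓝[s] y, ContDiffWithinAt ℝ ∞ ρ s z)
    {φ : ℝ → ℝ} (hφ : ContDiff ℝ ∞ φ) (h0 : ∀ t, 0 ≤ φ t) :
    scalar s (perturb s G ρ (fun z => φ (ρ z))) y =
      scalar s (perturb s G ρ (fun _ => φ (ρ y))) y +
        deriv φ (ρ y) * levelBend s (perturb s G ρ (fun _ => φ (ρ y))) ρ y := by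
  set c := φ (ρ y) with hc
  -- Freezing: with c = φ(ρ y), the constant part c dρ ⊗ dρ is moved into the base metric. The
  -- remaining perturbation φ - c vanishes at y, where `scalar_perturb` is exact.
  have e : perturb s G ρ (fun z => φ (ρ z)) =
      perturb s (perturb s G ρ (fun _ => c)) ρ (fun z => (fun t => φ t - c) (ρ z)) := by
    funext z
    simp only [perturb, add_assoc, ← add_smul]
    congr 2
    ring
  have hfr : ∀ᶠ z in 𝓝[s] y, MetricAt s (perturb s G ρ (fun _ => c)) z := by
    filter_upwards [h, hρ, self_mem_nhdsWithin] with z h1 h2 h3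
    exact (h1.perturb hs h3 h2 contDiffWithinAt_const (h0 _)).metricAt
  have hpe : ∀ᶠ z in 𝓝[s] y, MetricAt s (perturb s G ρ (fun z => φ (ρ z))) z := by
    filter_upwards [h, hρ, self_mem_nhdsWithin] with z h1 h2 h3
    exact (h1.perturb hs h3 h2 (hφ.contDiffAt.comp_contDiffWithinAt z h2) (h0 _)).metricAt
  rw [e, scalar_perturb hs hy hcl hfr hρ (hφ.sub contDiff_const) (e ▸ hpe) (by simp [hc])]
  simp

/-- Lower bound for the scalar curvature of `G + φ(ρ) dρ ⊗ dρ` near a point. -/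
theorem scalar_perturb_ge (hs : UniqueDiffOn ℝ s) (hconv : Convex ℝ s)
    (hcl : s ⊆ closure (interior s)) (hy : y ∈ s)
    (h : ∀ᶠ z in 𝓝[s] y, RiemAt s G z) (hρ : ∀ᶠ z in 𝓝[s] y, ContDiffWithinAt ℝ ∞ ρ s z) (Φ : ℝ)
    (hb : ∀ c ∈ Icc 0 Φ, levelBend s (perturb s G ρ (fun _ => c)) ρ y < 0) :
    ∃ a > 0, ∃ C, ∀ᶠ z in 𝓝[s] y, ∀ φ : ℝ → ℝ, ContDiff ℝ ∞ φ → (∀ t, 0 ≤ φ t) →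
      φ (ρ z) ≤ Φ → deriv φ (ρ z) ≤ 0 →
      scalar s G z - a * deriv φ (ρ z) - C * φ (ρ z) ≤
        scalar s (perturb s G ρ (fun z => φ (ρ z))) z := by
  obtain ⟨a, ha, C, hC⟩ := frozen_estimate hs hconv hy (h.self_of_nhdsWithin hy)
    (hρ.self_of_nhdsWithin hy) Φ hb
  refine ⟨a, ha, C, ?_⟩
  filter_upwards [hC, eventually_eventually_nhdsWithin.2 h, eventually_eventually_nhdsWithin.2 hρ,
    self_mem_nhdsWithin] with z hz h1 h2 h3 φ hφ hφ0 hφΦ hφ'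
  obtain ⟨h4, h5⟩ := hz (φ (ρ z)) ⟨hφ0 _, hφΦ⟩
  rw [scalar_perturb_eq_frozen hs h3 hcl h1 h2 hφ hφ0]
  -- As φ' ≤ 0, multiplying the bound `levelBend` ≤ -a by φ' gives a contribution of at least -a φ'.
  nlinarith

section Three

variable {s : Set (EuclideanSpace ℝ (Fin 3))} {y : EuclideanSpace ℝ (Fin 3)}
  {G : EuclideanSpace ℝ (Fin 3) → Matrix (Fin 3) (Fin 3) ℝ}
  {ρ : EuclideanSpace ℝ (Fin 3) → ℝ}

/-- `levelBend` is a negative multiple of the mean curvature, and the mean curvature of the frozen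
metric is a positive multiple of the original one; hence the sign persists for every c ≥ 0. -/
lemma levelBend_frozen_neg (hs : UniqueDiffOn ℝ s) (hcl : s ⊆ closure (interior s)) (hy : y ∈ s)
    (h : ∀ᶠ z in 𝓝[s] y, RiemAt s G z) (hρ : ∀ᶠ z in 𝓝[s] y, ContDiffWithinAt ℝ ∞ ρ s z)
    (hflat : FlatAt s ρ y) (hpos : 0 < pderiv s 0 ρ y) (hH : 0 < meanCurvature s G y) {c : ℝ}
    (hc : 0 ≤ c) : levelBend s (perturb s G ρ (fun _ => c)) ρ y < 0 := by
  have hρy := hρ.self_of_nhdsWithin hy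
  have hR : ∀ᶠ z in 𝓝[s] y, RiemAt s (perturb s G ρ (fun _ => c)) z := by
    filter_upwards [h, hρ, self_mem_nhdsWithin] with z h1 h2 h3
    exact h1.perturb hs h3 h2 contDiffWithinAt_const hc
  have hRy := hR.self_of_nhdsWithin hy
  have hK := hRy.inv_diag_pos 0
  have hGy := h.self_of_nhdsWithin hy
  rw [levelBend_eq hs hy hcl (hR.mono fun _ h => h.metricAt) hρy hflat hK]
  have hm := meanCurvature_perturb (ψ := fun _ => c) hs hy hcl (h.mono fun _ h => h.metricAt) hρy
    contDiff_const hflat hpos.ne' (hGy.inv_diag_pos 0) hRy.metricAt.det_ne hc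
  have hD : 0 < 1 + c * gradSq s G ρ y := by
    have := hGy.inv_diag_pos 0
    rw [hflat.gradSq]; positivity
  rw [hm]
  have h1 := Real.sqrt_pos.2 hD
  have h2 := Real.sqrt_pos.2 hK
  rw [neg_lt_zero]
  positivity

end Three

end Coord

/-! ### Metric coefficients in charts -/

lemma bilin_sum {V ι : Type*} [AddCommGroup V] [Module ℝ V] [TopologicalSpace V] [Fintype ι]
    (B : V →L[ℝ] V →L[ℝ] ℝ) (a b : ι → ℝ) (c : ι → V) :
    B (∑ i, a i • c i) (∑ j, b j • c j) = ∑ i, ∑ j, a i * b j * B (c i) (c j) := by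
  simp only [map_sum, map_smul, sum_apply, smul_apply, smul_eq_mul]
  rw [Finset.sum_comm]
  refine Finset.sum_congr rfl fun j _ => ?_
  rw [Finset.mul_sum]
  exact Finset.sum_congr rfl fun i _ => by ring

section Charts

set_option linter.unusedSectionVars false

variable {n : ℕ} {H : Type*} [TopologicalSpace H]
  {I : ModelWithCorners ℝ (EuclideanSpace ℝ (Fin n)) H}
  {M : Type*} [TopologicalSpace M] [ChartedSpace H M] [IsManifold I ∞ M]

variable (I) in
omit [IsManifold I ∞ M] in
lemma isManifold_one [IsManifold I ∞ M] : IsManifold I 1 M :=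
  IsManifold.of_le (n := ∞) (WithTop.coe_le_coe.2 le_top)

/-- The differential of the inverse chart. -/
def chartFrame (I : ModelWithCorners ℝ (EuclideanSpace ℝ (Fin n)) H) (p : M)
    (y : EuclideanSpace ℝ (Fin n)) :
    EuclideanSpace ℝ (Fin n) →L[ℝ] TangentSpace I ((extChartAt I p).symm y) :=
  mfderivWithin 𝓘(ℝ, EuclideanSpace ℝ (Fin n)) I (extChartAt I p).symm (range I) y

lemma coordVector_eq (p : M) (y : EuclideanSpace ℝ (Fin n)) (i : Fin n) :
    coordVector I p y i = chartFrame I p y (EuclideanSpace.single i 1) := rfl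

lemma chartFrame_apply (p : M) (y v : EuclideanSpace ℝ (Fin n)) :
    chartFrame I p y v = ∑ i, v i • coordVector I p y i := by
  have h : v = ∑ a, v a • (EuclideanSpace.single a (1 : ℝ)) := by
    ext b
    simp [Finset.sum_apply, Pi.single_apply]
  conv_lhs => rw [h]
  rw [map_sum]
  exact Finset.sum_congr rfl fun i _ => by rw [map_smul]; rfl

lemma inner_chartFrame (g : SmoothMetric I M) (p : M) (y v w : EuclideanSpace ℝ (Fin n)) :
    g.inner ((extChartAt I p).symm y) (chartFrame I p y v) (chartFrame I p y w) =
      ∑ i, ∑ j, v i * w j * metricCoeff g p y i j := by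
  rw [chartFrame_apply, chartFrame_apply]
  exact bilin_sum (g.inner ((extChartAt I p).symm y)) v w _

lemma chartFrame_bijective {p : M} {y : EuclideanSpace ℝ (Fin n)}
    (hy : y ∈ (extChartAt I p).target) : Function.Bijective (chartFrame I p y) := by
  have : IsManifold I 1 M := isManifold_one I
  exact (isInvertible_mfderivWithin_extChartAt_symm hy).bijective

lemma metricCoeff_posDef (g : SmoothMetric I M) {p : M} {y : EuclideanSpace ℝ (Fin n)}
    (hy : y ∈ (extChartAt I p).target) : (metricCoeff g p y).PosDef := by
  refine Matrix.PosDef.of_dotProduct_mulVec_pos ?_ ?_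
  · ext i j
    simp only [Matrix.conjTranspose_apply, star_trivial, metricCoeff, Matrix.of_apply]
    exact g.symm _ _ _
  · intro x hx
    have h1 := inner_chartFrame g p y (WithLp.toLp 2 x) (WithLp.toLp 2 x)
    have h2 : chartFrame I p y (WithLp.toLp 2 x) ≠ 0 := by
      intro h0
      have := (chartFrame_bijective hy).1 (h0.trans (map_zero _).symm)
      exact hx (by simpa using congrArg (WithLp.ofLp (p := 2)) this)
    have h3 := g.pos _ _ h2
    rw [h1] at h3
    simp only [Matrix.mulVec, dotProduct, star_trivial, Pi.star_apply, Finset.mul_sum]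
    refine h3.trans_eq (Finset.sum_congr rfl fun i _ => Finset.sum_congr rfl fun j _ => ?_)
    ring

lemma contMDiffOn_coordVector (p : M) (i : Fin n) :
    ContMDiffOn 𝓘(ℝ, EuclideanSpace ℝ (Fin n)) (I.prod 𝓘(ℝ, EuclideanSpace ℝ (Fin n))) ∞
      (fun y => Bundle.TotalSpace.mk' (EuclideanSpace ℝ (Fin n)) ((extChartAt I p).symm y)
        (coordVector I p y i)) (extChartAt I p).target := by
  have : IsManifold I 1 M := isManifold_one I
  have h1 := (contMDiffOn_extChartAt_symm (I := I) (n := ∞) p).contMDiffOn_tangentMapWithin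
    (m := ∞) (by simp) (uniqueDiffOn_extChartAt_target p).uniqueMDiffOn
  have h2 : ContMDiffOn 𝓘(ℝ, EuclideanSpace ℝ (Fin n))
      (𝓘(ℝ, EuclideanSpace ℝ (Fin n)).prod 𝓘(ℝ, EuclideanSpace ℝ (Fin n))) ∞
      (fun y : EuclideanSpace ℝ (Fin n) => (⟨y, (EuclideanSpace.single i 1 : EuclideanSpace ℝ (Fin n))⟩ :
        TangentBundle 𝓘(ℝ, EuclideanSpace ℝ (Fin n)) (EuclideanSpace ℝ (Fin n))))
      (extChartAt I p).target :=
    contMDiffOn_vectorSpace_iff_contDiffOn.2 contDiffOn_const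
  refine (h1.comp h2 (fun y hy => hy)).congr fun y hy => ?_
  -- The tangent map above is taken within the chart target but `coordVector` within `range I`; at
  -- points of the target the two differentials agree.
  have h3 : mfderivWithin 𝓘(ℝ, EuclideanSpace ℝ (Fin n)) I (extChartAt I p).symm (range I) y =
      mfderivWithin 𝓘(ℝ, EuclideanSpace ℝ (Fin n)) I (extChartAt I p).symm
        (extChartAt I p).target y := by
    refine (mfderivWithin_subset (extChartAt_target_subset_range p) ?_ ?_).symm
    · exact (uniqueDiffOn_extChartAt_target p).uniqueMDiffOn y hy
    · exact mdifferentiableWithinAt_extChartAt_symm hy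
  simp only [coordVector, h3]
  rfl

lemma metricCoeff_smooth (g : SmoothMetric I M) {p : M} {y : EuclideanSpace ℝ (Fin n)}
    (hy : y ∈ (extChartAt I p).target) : Coord.MatSmooth (range I) (metricCoeff g p) y := by
  intro i j
  have h1 : ContMDiffOn 𝓘(ℝ, EuclideanSpace ℝ (Fin n))
      (I.prod 𝓘(ℝ, EuclideanSpace ℝ (Fin n) →L[ℝ] EuclideanSpace ℝ (Fin n) →L[ℝ] ℝ)) ∞
      (fun y => Bundle.TotalSpace.mk' (EuclideanSpace ℝ (Fin n) →L[ℝ] EuclideanSpace ℝ (Fin n) →L[ℝ] ℝ)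
        (E := fun x : M => TangentSpace I x →L[ℝ] TangentSpace I x →L[ℝ] ℝ)
        ((extChartAt I p).symm y) (g.inner ((extChartAt I p).symm y))) (extChartAt I p).target :=
    g.contMDiff.comp_contMDiffOn (contMDiffOn_extChartAt_symm p)
  have h2 : ContMDiffWithinAt 𝓘(ℝ, EuclideanSpace ℝ (Fin n)) (I.prod 𝓘(ℝ)) ∞
      (fun y => Bundle.TotalSpace.mk' ℝ (E := Bundle.Trivial M ℝ) ((extChartAt I p).symm y)
        (metricCoeff g p y i j)) (extChartAt I p).target y := by
    refine ContMDiffWithinAt.clm_bundle_apply₂ (F₁ := EuclideanSpace ℝ (Fin n))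
      (F₂ := EuclideanSpace ℝ (Fin n)) (h1 y hy) ?_ ?_
    · exact contMDiffOn_coordVector p i y hy
    · exact contMDiffOn_coordVector p j y hy
  simp only [Bundle.contMDiffWithinAt_totalSpace] at h2
  exact (contMDiffWithinAt_iff_contDiffWithinAt.1 h2.2).mono_of_mem_nhdsWithin
    (extChartAt_target_mem_nhdsWithin_of_mem hy)

lemma riemAt_metricCoeff (g : SmoothMetric I M) {p : M} {y : EuclideanSpace ℝ (Fin n)}
    (hy : y ∈ (extChartAt I p).target) : Coord.RiemAt (range I) (metricCoeff g p) y :=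
  ⟨metricCoeff_smooth g hy, metricCoeff_posDef g hy⟩

lemma eventually_mem_target {p : M} {y : EuclideanSpace ℝ (Fin n)}
    (hy : y ∈ (extChartAt I p).target) : ∀ᶠ z in 𝓝[range I] y, z ∈ (extChartAt I p).target :=
  extChartAt_target_mem_nhdsWithin_of_mem hy

lemma eventually_riemAt (g : SmoothMetric I M) {p : M} {y : EuclideanSpace ℝ (Fin n)}
    (hy : y ∈ (extChartAt I p).target) :
    ∀ᶠ z in 𝓝[range I] y, Coord.RiemAt (range I) (metricCoeff g p) z :=
  (eventually_mem_target hy).mono fun _ hz => riemAt_metricCoeff g hz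

/-- The change of coordinates between the preferred charts at `p` and `q`. -/
def transition (I : ModelWithCorners ℝ (EuclideanSpace ℝ (Fin n)) H) (p q : M)
    (y : EuclideanSpace ℝ (Fin n)) : EuclideanSpace ℝ (Fin n) :=
  extChartAt I q ((extChartAt I p).symm y)

lemma continuousWithinAt_chart_symm {p : M} {y : EuclideanSpace ℝ (Fin n)}
    (hy : y ∈ (extChartAt I p).target) :
    ContinuousWithinAt (extChartAt I p).symm (range I) y :=
  (contMDiffWithinAt_extChartAt_symm_range (n := ∞) p hy).continuousWithinAt

lemma eventually_mem_source {p q : M} {y : EuclideanSpace ℝ (Fin n)}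
    (hy : y ∈ (extChartAt I p).target) (hq : (extChartAt I p).symm y ∈ (extChartAt I q).source) :
    ∀ᶠ z in 𝓝[range I] y, (extChartAt I p).symm z ∈ (extChartAt I q).source :=
  (continuousWithinAt_chart_symm hy).eventually ((isOpen_extChartAt_source q).mem_nhds hq)

lemma transition_smooth {p q : M} {y : EuclideanSpace ℝ (Fin n)}
    (hy : y ∈ (extChartAt I p).target) (hq : (extChartAt I p).symm y ∈ (extChartAt I q).source) :
    ContDiffWithinAt ℝ ∞ (transition I p q) (range I) y := by
  rw [extChartAt_source] at hq
  have h1 : ContMDiffWithinAt 𝓘(ℝ, EuclideanSpace ℝ (Fin n)) 𝓘(ℝ, EuclideanSpace ℝ (Fin n)) ∞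
      (transition I p q) (range I) y :=
    (contMDiffAt_extChartAt' hq).comp_contMDiffWithinAt y
      (contMDiffWithinAt_extChartAt_symm_range p hy)
  exact contMDiffWithinAt_iff_contDiffWithinAt.1 h1

lemma jac_apply {s : Set (EuclideanSpace ℝ (Fin n))} {y : EuclideanSpace ℝ (Fin n)}
    (hs : UniqueDiffOn ℝ s) (hy : y ∈ s)
    {τ : EuclideanSpace ℝ (Fin n) → EuclideanSpace ℝ (Fin n)}
    (hτ : DifferentiableWithinAt ℝ τ s y) (a i : Fin n) :
    Coord.jac s τ y a i = (fderivWithin ℝ τ s y (EuclideanSpace.single i 1)) a := by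
  have h3 := ((EuclideanSpace.proj (𝕜 := ℝ) a).hasFDerivAt.comp_hasFDerivWithinAt y
    hτ.hasFDerivWithinAt).fderivWithin (hs y hy)
  have h4 : (fun z => τ z a) = (EuclideanSpace.proj (𝕜 := ℝ) a) ∘ τ := rfl
  rw [Coord.jac, Matrix.of_apply, Coord.pderiv, h4, h3]
  rfl

lemma fderivWithin_transition {p q : M} {y : EuclideanSpace ℝ (Fin n)}
    (hy : y ∈ (extChartAt I p).target) (hq : (extChartAt I p).symm y ∈ (extChartAt I q).source)
    (v : EuclideanSpace ℝ (Fin n)) :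
    fderivWithin ℝ (transition I p q) (range I) y v =
      mfderiv I 𝓘(ℝ, EuclideanSpace ℝ (Fin n)) (extChartAt I q) ((extChartAt I p).symm y)
        (chartFrame I p y v) := by
  have : IsManifold I 1 M := isManifold_one I
  rw [extChartAt_source] at hq
  rw [← mfderivWithin_eq_fderivWithin]
  have h := mfderiv_comp_mfderivWithin y (mdifferentiableAt_extChartAt hq)
    (mdifferentiableWithinAt_extChartAt_symm hy)
    (I.uniqueDiffOn.uniqueMDiffOn y (extChartAt_target_subset_range p hy))
  exact DFunLike.congr_fun h v

lemma inner_chartFrame_mfderiv (g : SmoothMetric I M) {q x : M} (hx : x ∈ (extChartAt I q).source)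
    (v w : TangentSpace I x) :
    g.inner ((extChartAt I q).symm (extChartAt I q x))
      (chartFrame I q (extChartAt I q x)
        (mfderiv I 𝓘(ℝ, EuclideanSpace ℝ (Fin n)) (extChartAt I q) x v))
      (chartFrame I q (extChartAt I q x)
        (mfderiv I 𝓘(ℝ, EuclideanSpace ℝ (Fin n)) (extChartAt I q) x w)) = g.inner x v w := by
  have : IsManifold I 1 M := isManifold_one I
  have h := mfderivWithin_extChartAt_symm_comp_mfderiv_extChartAt' hx
  have hv : ∀ v : TangentSpace I x, (chartFrame I q (extChartAt I q x)
        (mfderiv I 𝓘(ℝ, EuclideanSpace ℝ (Fin n)) (extChartAt I q) x v) :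
        EuclideanSpace ℝ (Fin n)) = v := fun v => DFunLike.congr_fun h v
  -- All tangent spaces are definitionally the model space. Regarding the metric as a family of
  -- forms on it removes the dependent type and allows the base point to be rewritten.
  let B : M → EuclideanSpace ℝ (Fin n) →L[ℝ] EuclideanSpace ℝ (Fin n) →L[ℝ] ℝ := g.inner
  change B ((extChartAt I q).symm (extChartAt I q x)) _ _ = B x v w
  rw [hv, hv, (extChartAt I q).left_inv hx]

/-- The transformation law of the metric coefficients. -/
lemma metricCoeff_transition (g : SmoothMetric I M) {p q : M} {y : EuclideanSpace ℝ (Fin n)}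
    (hy : y ∈ (extChartAt I p).target) (hq : (extChartAt I p).symm y ∈ (extChartAt I q).source) :
    metricCoeff g p y = (Coord.jac (range I) (transition I p q) y).transpose *
      metricCoeff g q (transition I p q y) * Coord.jac (range I) (transition I p q) y := by
  have hys := extChartAt_target_subset_range p hy
  have hτ := (transition_smooth hy hq).differentiableWithinAt (by simp)
  ext i j
  have h1 : metricCoeff g p y i j =
    g.inner ((extChartAt I p).symm y) (coordVector I p y i) (coordVector I p y j) := rfl
  rw [h1, ← inner_chartFrame_mfderiv g hq]
  refine (inner_chartFrame g q _ _ _).trans ?_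
  rw [Matrix.mul_apply, Finset.sum_comm]
  refine Finset.sum_congr rfl fun b _ => ?_
  rw [Matrix.mul_apply, Finset.sum_mul]
  refine Finset.sum_congr rfl fun a _ => ?_
  rw [Matrix.transpose_apply, jac_apply I.uniqueDiffOn hys hτ, jac_apply I.uniqueDiffOn hys hτ,
    fderivWithin_transition hy hq, fderivWithin_transition hy hq, coordVector_eq, coordVector_eq]
  simp only [transition]
  ring

/-- The metric `g` serves only to see that the Jacobian is invertible: by the transformation law a
singular Jacobian would make a positive definite coefficient matrix singular. -/
lemma changeAt_transition (g : SmoothMetric I M) {p q : M} {y : EuclideanSpace ℝ (Fin n)}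
    (hy : y ∈ (extChartAt I p).target) (hq : (extChartAt I p).symm y ∈ (extChartAt I q).source) :
    Coord.ChangeAt (range I) (transition I p q) y where
  maps := Eventually.of_forall fun _ => by
    simp only [transition, extChartAt, OpenPartialHomeomorph.extend_coe]
    exact mem_range_self _
  smooth := transition_smooth hy hq
  det_ne := by
    intro h0
    have h1 := (metricCoeff_posDef g hy).det_pos
    rw [metricCoeff_transition g hy hq, Matrix.det_mul, h0, mul_zero] at h1
    exact lt_irrefl _ h1

/-- The scalar curvature can be computed in any preferred chart. -/
theorem scalarCurvature_eq (g : SmoothMetric I M) {x q : M} (hx : x ∈ (extChartAt I q).source) :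
    scalarCurvature g x = Coord.scalar (range I) (metricCoeff g q) (extChartAt I q x) := by
  have hy := mem_extChartAt_target (I := I) x
  have hsymm : (extChartAt I x).symm (extChartAt I x x) = x := extChartAt_to_inv x
  have hq : (extChartAt I x).symm (extChartAt I x x) ∈ (extChartAt I q).source := by rwa [hsymm]
  have hτ : transition I x q (extChartAt I x x) = extChartAt I q x := by rw [transition, hsymm]
  have hev := (eventually_mem_target hy).and (eventually_mem_source hy hq)
  have h := Coord.scalar_change (s := range I) (τ := transition I x q)
    (G := metricCoeff g q) (G' := metricCoeff g x) I.uniqueDiffOn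
    (extChartAt_target_subset_range x hy) I.range_subset_closure_interior
    (hev.mono fun z hz => changeAt_transition g hz.1 hz.2)
    (by
      rw [hτ]
      exact (eventually_riemAt g ((extChartAt I q).map_source hx)).mono fun _ h => h.metricAt)
    (hev.mono fun z hz => metricCoeff_transition g hz.1 hz.2)
    (riemAt_metricCoeff g hy).metricAt
  rw [scalarCurvature, h, hτ]

/-- A function in the coordinates of the preferred chart at `p`. -/
def chartRep (I : ModelWithCorners ℝ (EuclideanSpace ℝ (Fin n)) H) (ρ : M → ℝ) (p : M)
    (y : EuclideanSpace ℝ (Fin n)) : ℝ := ρ ((extChartAt I p).symm y)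

lemma chartRep_smooth {ρ : M → ℝ} (hρ : ContMDiff I 𝓘(ℝ, ℝ) ∞ ρ) {p : M}
    {y : EuclideanSpace ℝ (Fin n)} (hy : y ∈ (extChartAt I p).target) :
    ContDiffWithinAt ℝ ∞ (chartRep I ρ p) (range I) y :=
  contMDiffWithinAt_iff_contDiffWithinAt.1 ((hρ _).comp_contMDiffWithinAt y
      (contMDiffWithinAt_extChartAt_symm_range p hy))

lemma mfderiv_coordVector {ρ : M → ℝ} (hρ : ContMDiff I 𝓘(ℝ, ℝ) ∞ ρ) {p : M}
    {y : EuclideanSpace ℝ (Fin n)} (hy : y ∈ (extChartAt I p).target) (i : Fin n) :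
    mfderiv I 𝓘(ℝ, ℝ) ρ ((extChartAt I p).symm y) (coordVector I p y i) =
      Coord.pderiv (range I) i (chartRep I ρ p) y := by
  have : IsManifold I 1 M := isManifold_one I
  have h := mfderiv_comp_mfderivWithin y ((hρ _).mdifferentiableAt (by simp))
    (mdifferentiableWithinAt_extChartAt_symm hy)
    (I.uniqueDiffOn.uniqueMDiffOn y (extChartAt_target_subset_range p hy))
  rw [mfderivWithin_eq_fderivWithin] at h
  exact (DFunLike.congr_fun h (EuclideanSpace.single i (1 : ℝ))).symm

end Charts

/-! ### Rank one perturbations of a metric on a manifold -/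

section NewMetric

set_option linter.unusedSectionVars false

variable {n : ℕ} {H : Type*} [TopologicalSpace H]
  {I : ModelWithCorners ℝ (EuclideanSpace ℝ (Fin n)) H}
  {M : Type*} [TopologicalSpace M] [ChartedSpace H M] [IsManifold I ∞ M]

/-- The differential of a function. -/
def dfun (I : ModelWithCorners ℝ (EuclideanSpace ℝ (Fin n)) H) (ρ : M → ℝ) (p : M) :
    TangentSpace I p →L[ℝ] ℝ := mfderiv I 𝓘(ℝ, ℝ) ρ p

/-- The square of the differential of a function. -/
def dsq (I : ModelWithCorners ℝ (EuclideanSpace ℝ (Fin n)) H) (ρ : M → ℝ) (p : M) :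
    TangentSpace I p →L[ℝ] TangentSpace I p →L[ℝ] ℝ := (dfun I ρ p).smulRight (dfun I ρ p)

lemma contMDiff_dsq {ρ : M → ℝ} (hρ : ContMDiff I 𝓘(ℝ, ℝ) ∞ ρ) :
    ContMDiff I (I.prod 𝓘(ℝ, EuclideanSpace ℝ (Fin n) →L[ℝ] EuclideanSpace ℝ (Fin n) →L[ℝ] ℝ)) ∞
      (fun p => Bundle.TotalSpace.mk' (EuclideanSpace ℝ (Fin n) →L[ℝ] EuclideanSpace ℝ (Fin n) →L[ℝ] ℝ)
        (E := fun x : M => TangentSpace I x →L[ℝ] TangentSpace I x →L[ℝ] ℝ) p (dsq I ρ p)) := by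
  have : IsManifold I 1 M := isManifold_one I
  intro x₀
  rw [contMDiffAt_hom_bundle]
  refine ⟨contMDiffAt_id, ?_⟩
  have h1 := (hρ x₀).mfderiv_const (m := ∞) (by simp)
  -- In the trivialisation at x₀ the section becomes the square of the coordinate expression of dρ,
  -- and squaring a covector is a smooth operation.
  have h2 : ContMDiffAt I 𝓘(ℝ, EuclideanSpace ℝ (Fin n) →L[ℝ] EuclideanSpace ℝ (Fin n) →L[ℝ] ℝ) ∞
      (fun x => (inTangentCoordinates I 𝓘(ℝ, ℝ) id ρ (mfderiv I 𝓘(ℝ, ℝ) ρ) x₀ x).smulRight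
        (inTangentCoordinates I 𝓘(ℝ, ℝ) id ρ (mfderiv I 𝓘(ℝ, ℝ) ρ) x₀ x)) x₀ := by
    have h3 : ContDiff ℝ ∞ (fun L : EuclideanSpace ℝ (Fin n) →L[ℝ] ℝ =>
        ContinuousLinearMap.smulRightL ℝ (EuclideanSpace ℝ (Fin n))
          (EuclideanSpace ℝ (Fin n) →L[ℝ] ℝ) L L) :=
      (ContinuousLinearMap.contDiff _).clm_apply contDiff_id
    exact h3.contMDiff.contMDiffAt.comp x₀ h1
  refine h2.congr_of_eventuallyEq ?_
  have hU := (isOpen_extChartAt_source (I := I) x₀).mem_nhds (mem_extChartAt_source x₀)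
  filter_upwards [hU] with x hx
  ext v w
  simp [ContinuousLinearMap.inCoordinates, inTangentCoordinates]
  rw [Bundle.Trivialization.linearMapAt_apply, if_pos (by simpa using hx)]
  simp only [hom_trivializationAt_apply, ContinuousLinearMap.inCoordinates]
  simp
  rfl

/-- The metric `g + f dρ ⊗ dρ`. -/
def rankOneMetric (g : SmoothMetric I M) {ρ f : M → ℝ} (hρ : ContMDiff I 𝓘(ℝ, ℝ) ∞ ρ)
    (hf : ContMDiff I 𝓘(ℝ, ℝ) ∞ f) (h0 : ∀ p, 0 ≤ f p) : SmoothMetric I M where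
  inner p := g.inner p + f p • dsq I ρ p
  symm p v w := by
    change g.inner p v w + f p * (dfun I ρ p v * dfun I ρ p w) =
      g.inner p w v + f p * (dfun I ρ p w * dfun I ρ p v)
    rw [g.symm, mul_comm (dfun I ρ p v)]
  pos p v hv := by
    change 0 < g.inner p v v + f p * (dfun I ρ p v * dfun I ρ p v)
    exact add_pos_of_pos_of_nonneg (g.pos p v hv) (mul_nonneg (h0 p) (mul_self_nonneg _))
  isVonNBounded p := by
    -- The new form dominates the old one, so its unit ball is contained in that of `g`.
    refine (g.isVonNBounded p).subset fun v hv => ?_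
    change g.inner p v v + f p * (dfun I ρ p v * dfun I ρ p v) < 1 at hv
    exact (le_add_of_nonneg_right (mul_nonneg (h0 p) (mul_self_nonneg _))).trans_lt hv
  contMDiff := g.contMDiff.add_section (hf.smul_section (contMDiff_dsq hρ))

variable (g : SmoothMetric I M) {ρ f : M → ℝ} (hρ : ContMDiff I 𝓘(ℝ, ℝ) ∞ ρ)
    (hf : ContMDiff I 𝓘(ℝ, ℝ) ∞ f) (h0 : ∀ p, 0 ≤ f p)

lemma rankOneMetric_inner (p : M) (v w : TangentSpace I p) :
    (rankOneMetric g hρ hf h0).inner p v w =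
      g.inner p v w + f p * (dfun I ρ p v * dfun I ρ p w) := rfl

lemma rankOneMetric_inner_eq {p : M} (hp : f p = 0) :
    (rankOneMetric g hρ hf h0).inner p = g.inner p := by
  refine ContinuousLinearMap.ext fun v => ContinuousLinearMap.ext fun w => ?_
  rw [rankOneMetric_inner, hp, zero_mul, add_zero]

lemma le_rankOneMetric (p : M) (v : TangentSpace I p) :
    g.inner p v v ≤ (rankOneMetric g hρ hf h0).inner p v v :=
  le_add_of_nonneg_right (mul_nonneg (h0 p) (mul_self_nonneg _))

lemma metricCoeff_rankOneMetric {p : M} {y : EuclideanSpace ℝ (Fin n)}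
    (hy : y ∈ (extChartAt I p).target) : metricCoeff (rankOneMetric g hρ hf h0) p y =
      Coord.perturb (range I) (metricCoeff g p) (chartRep I ρ p) (chartRep I f p) y := by
  ext i j
  simp only [metricCoeff, Matrix.of_apply, Coord.perturb, Matrix.add_apply, Matrix.smul_apply,
    Matrix.mul_apply, Coord.gradCol, Matrix.transpose_apply, ← mfderiv_coordVector hρ hy]
  rw [rankOneMetric_inner]
  simp
  rfl

lemma metricCoeff_rankOneMetric_eventuallyEq {p : M} {y : EuclideanSpace ℝ (Fin n)}
    (hy : y ∈ (extChartAt I p).target) : metricCoeff (rankOneMetric g hρ hf h0) p =ᶠ[𝓝[range I] y]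
      Coord.perturb (range I) (metricCoeff g p) (chartRep I ρ p) (chartRep I f p) :=
  (eventually_mem_target hy).mono fun _ hz => metricCoeff_rankOneMetric g hρ hf h0 hz

/-- Where `f` vanishes identically the metric coefficients do not change. -/
lemma metricCoeff_rankOneMetric_eventuallyEq_of_zero {p : M} (hp : ∀ᶠ x in 𝓝 p, f x = 0) :
    metricCoeff (rankOneMetric g hρ hf h0) p =ᶠ[𝓝[range I] (extChartAt I p p)] metricCoeff g p := by
  have hy := mem_extChartAt_target (I := I) p
  have hc := (continuousWithinAt_chart_symm hy).eventually (by rwa [extChartAt_to_inv])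
  filter_upwards [hc] with z hz
  ext i j
  simp only [metricCoeff, Matrix.of_apply]
  rw [rankOneMetric_inner, hz, zero_mul, add_zero]

end NewMetric

/-! ### Locality of the curvatures -/

namespace Coord

variable {n : ℕ} {s : Set (EuclideanSpace ℝ (Fin n))} {y : EuclideanSpace ℝ (Fin n)}
  {G G' : EuclideanSpace ℝ (Fin n) → Matrix (Fin n) (Fin n) ℝ}

lemma christoffel_congr (h : G =ᶠ[𝓝[s] y] G') (hy : y ∈ s) (k i j : Fin n) :
    christoffel s G k i j y = christoffel s G' k i j y := by
  have he : ∀ i j, (fun z => G z i j) =ᶠ[𝓝[s] y] fun z => G' z i j :=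
    fun i j => h.mono fun z hz => by simp [hz]
  simp only [christoffel, h.self_of_nhdsWithin hy, pderiv_congr _ (he _ _) hy]

lemma scalar_congr (h : G =ᶠ[𝓝[s] y] G') (hy : y ∈ s) : scalar s G y = scalar s G' y := by
  have hc : ∀ k i j, christoffel s G k i j =ᶠ[𝓝[s] y] christoffel s G' k i j := by
    intro k i j
    filter_upwards [eventually_eventually_nhdsWithin.2 h, self_mem_nhdsWithin] with z h1 h2
    exact christoffel_congr h1 h2 k i j
  simp only [scalar, ricci, riemann, h.self_of_nhdsWithin hy, pderiv_congr _ (hc _ _ _) hy,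
    christoffel_congr h hy]

lemma meanCurvature_congr {s : Set (EuclideanSpace ℝ (Fin 3))} {y : EuclideanSpace ℝ (Fin 3)}
    {G G' : EuclideanSpace ℝ (Fin 3) → Matrix (Fin 3) (Fin 3) ℝ}
    (h : G =ᶠ[𝓝[s] y] G') (hy : y ∈ s) : meanCurvature s G y = meanCurvature s G' y := by
  simp only [meanCurvature_eq, h.self_of_nhdsWithin hy, christoffel_congr h hy]

end Coord

/-! ### Functions vanishing on the face of a half-space -/

namespace Coord

lemma range_halfSpace : range (𝓡∂ 3) = {y : EuclideanSpace ℝ (Fin 3) | 0 ≤ y 0} :=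
  range_modelWithCornersEuclideanHalfSpace 3

lemma convex_halfSpace : Convex ℝ (range (𝓡∂ 3)) := (𝓡∂ 3).convex_range

variable {y : EuclideanSpace ℝ (Fin 3)} {f : EuclideanSpace ℝ (Fin 3) → ℝ}

/-- A line through y in a tangential direction stays in the face, where f vanishes near y; the
derivative along it is therefore zero. -/
lemma pderiv_succ_eq_zero (hy : y 0 = 0) (hf : DifferentiableWithinAt ℝ f (range (𝓡∂ 3)) y)
    (h0 : ∀ᶠ z in 𝓝[range (𝓡∂ 3)] y, z 0 = 0 → f z = 0) (a : Fin 2) :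
    pderiv (range (𝓡∂ 3)) a.succ f y = 0 := by
  have hc : HasDerivAt (fun t : ℝ => y + t • EuclideanSpace.single a.succ (1 : ℝ))
      (EuclideanSpace.single a.succ (1 : ℝ)) 0 := by
    simpa using ((hasDerivAt_id (0 : ℝ)).smul_const
      (EuclideanSpace.single a.succ (1 : ℝ) : EuclideanSpace ℝ (Fin 3))).const_add y
  have hz : ∀ t : ℝ, (y + t • EuclideanSpace.single a.succ (1 : ℝ)) 0 = 0 := fun t => by
    simp [hy, (Fin.succ_ne_zero a).symm]
  have hs : ∀ t : ℝ, y + t • EuclideanSpace.single a.succ (1 : ℝ) ∈ range (𝓡∂ 3) := fun t => by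
    rw [range_halfSpace]
    exact (hz t).ge
  have hy0 : y + (0 : ℝ) • EuclideanSpace.single a.succ (1 : ℝ) = y := by simp
  have h1 : HasDerivWithinAt (fun t : ℝ => f (y + t • EuclideanSpace.single a.succ (1 : ℝ)))
      (pderiv (range (𝓡∂ 3)) a.succ f y) univ 0 :=
    HasFDerivWithinAt.comp_hasDerivWithinAt_of_eq (0 : ℝ) hf.hasFDerivWithinAt
      hc.hasDerivWithinAt (fun t _ => hs t) hy0.symm
  have ht : Tendsto (fun t : ℝ => y + t • EuclideanSpace.single a.succ (1 : ℝ)) (𝓝 0)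
      (𝓝[range (𝓡∂ 3)] y) := by
    refine tendsto_nhdsWithin_iff.2 ⟨?_, Eventually.of_forall hs⟩
    simpa using hc.continuousAt.tendsto
  have h2 : (fun t : ℝ => f (y + t • EuclideanSpace.single a.succ (1 : ℝ))) =ᶠ[𝓝 0] fun _ => 0 :=
    (ht.eventually h0).mono fun t h => h (hz t)
  rw [hasDerivWithinAt_univ] at h1
  exact h1.unique ((hasDerivAt_const (0 : ℝ) (0 : ℝ)).congr_of_eventuallyEq h2)

lemma mem_halfSpace (hy : y 0 = 0) : y ∈ range (𝓡∂ 3) := by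
  rw [range_halfSpace]
  exact hy.ge

/-- A tangential derivative of f again vanishes on the face near y, so the first-order argument can
be applied a second time. -/
lemma flatAt_of_vanish (hy : y 0 = 0) (hf : ContDiffWithinAt ℝ ∞ f (range (𝓡∂ 3)) y)
    (hf' : ∀ᶠ z in 𝓝[range (𝓡∂ 3)] y, ContDiffWithinAt ℝ ∞ f (range (𝓡∂ 3)) z)
    (h0 : ∀ᶠ z in 𝓝[range (𝓡∂ 3)] y, z 0 = 0 → f z = 0) : FlatAt (range (𝓡∂ 3)) f y := by
  refine ⟨pderiv_succ_eq_zero hy (hf.differentiableWithinAt (by simp)) h0, fun a b => ?_⟩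
  refine pderiv_succ_eq_zero hy ((contDiffWithinAt_pderiv (𝓡∂ 3).uniqueDiffOn
    (mem_halfSpace hy) _ hf).differentiableWithinAt (by simp)) ?_ a
  filter_upwards [hf', eventually_eventually_nhdsWithin.2 h0] with z h1 h2 hz
  exact pderiv_succ_eq_zero hz (h1.differentiableWithinAt (by simp)) h2 b

/-- The point y is a local minimum within the half-space, and the direction of index 0 points
inward. -/
lemma pderiv_zero_nonneg (hy : y 0 = 0) (hfy : f y = 0)
    (h0 : ∀ᶠ z in 𝓝[range (𝓡∂ 3)] y, 0 ≤ f z) : 0 ≤ pderiv (range (𝓡∂ 3)) 0 f y := by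
  have hm : IsLocalMinOn f (range (𝓡∂ 3)) y := h0.mono fun z hz => by rwa [hfy]
  refine hm.fderivWithin_nonneg (mem_posTangentConeAt_of_segment_subset ?_)
  refine convex_halfSpace.segment_subset (mem_halfSpace hy) ?_
  rw [range_halfSpace]
  simp [hy]

end Coord

/-! ### The boundary in charts -/

section Boundary

set_option linter.unusedSectionVars false

variable {Ω : Type*} [TopologicalSpace Ω] [ChartedSpace (EuclideanHalfSpace 3) Ω]
  [IsManifold (𝓡∂ 3) ∞ Ω]

/-- Being an interior point may be tested in any chart of the atlas, so the chart at q serves for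
all x in its domain and not only for q. -/
lemma mem_boundary_iff {q x : Ω} (hx : x ∈ (extChartAt (𝓡∂ 3) q).source) :
    x ∈ (𝓡∂ 3).boundary Ω ↔ extChartAt (𝓡∂ 3) q x 0 = 0 := by
  have hxs := hx
  rw [extChartAt_source] at hxs
  have h1 := (𝓡∂ 3).isInteriorPoint_iff_of_mem_atlas (n := ∞) (by simp)
    (chart_mem_atlas (EuclideanHalfSpace 3) q) hxs
  have h2 : extChartAt (𝓡∂ 3) q x ∈ interior (extChartAt (𝓡∂ 3) q).target ↔
      0 < extChartAt (𝓡∂ 3) q x 0 := by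
    have h3 := interior_range_modelWithCornersEuclideanHalfSpace 3
    constructor
    · intro h
      have h4 := interior_mono (extChartAt_target_subset_range q) h
      rwa [h3] at h4
    · intro h
      refine (chartAt (EuclideanHalfSpace 3) q).mem_interior_extend_target ?_ ?_
      · exact (chartAt (EuclideanHalfSpace 3) q).map_source hxs
      · rw [h3]
        exact h
  have h5 : 0 ≤ extChartAt (𝓡∂ 3) q x 0 := by
    have : extChartAt (𝓡∂ 3) q x ∈ range (𝓡∂ 3) := mem_range_self _
    rwa [Coord.range_halfSpace] at this
  refine ((𝓡∂ 3).isBoundaryPoint_iff_not_isInteriorPoint x).trans ?_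
  rw [h1]
  refine (not_congr h2).trans ?_
  rw [not_lt]
  exact ⟨fun h => le_antisymm h h5, fun h => h.le⟩

lemma symm_mem_boundary_iff {q : Ω} {y : EuclideanSpace ℝ (Fin 3)}
    (hy : y ∈ (extChartAt (𝓡∂ 3) q).target) :
    (extChartAt (𝓡∂ 3) q).symm y ∈ (𝓡∂ 3).boundary Ω ↔ y 0 = 0 := by
  rw [mem_boundary_iff ((extChartAt (𝓡∂ 3) q).map_target hy), (extChartAt (𝓡∂ 3) q).right_inv hy]

/-- Connected components of the boundary are open in the boundary. -/
lemma eventually_mem_component {p₀ p : Ω}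
    (hp : p ∈ connectedComponentIn ((𝓡∂ 3).boundary Ω) p₀) :
    ∀ᶠ x in 𝓝 p, x ∈ (𝓡∂ 3).boundary Ω → x ∈ connectedComponentIn ((𝓡∂ 3).boundary Ω) p₀ := by
  have hpb : p ∈ (𝓡∂ 3).boundary Ω := connectedComponentIn_subset _ _ hp
  have hy := mem_extChartAt_target (I := 𝓡∂ 3) p
  have hps := mem_extChartAt_source (I := 𝓡∂ 3) p
  obtain ⟨r, hr, hball⟩ := Metric.mem_nhdsWithin_iff.1 (eventually_mem_target hy)
  -- A small flat disc in the face is convex, so its image is a connected piece of the boundary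
  -- through p and lies in the component of p; it contains all boundary points near p.
  let D : Set (EuclideanSpace ℝ (Fin 3)) :=
    Metric.ball (extChartAt (𝓡∂ 3) p p) r ∩ {z | z 0 = 0}
  have hDt : D ⊆ (extChartAt (𝓡∂ 3) p).target := fun z hz =>
    hball ⟨hz.1, Coord.mem_halfSpace hz.2⟩
  have hDc : Convex ℝ D := by
    refine (convex_ball _ _).inter ?_
    intro a ha b hb s t _ _ _
    simp only [mem_ofPred_eq] at ha hb
    simp [ha, hb]
  have hconn : IsPreconnected ((extChartAt (𝓡∂ 3) p).symm '' D) :=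
    hDc.isPreconnected.image _ ((continuousOn_extChartAt_symm p).mono hDt)
  have hsub : (extChartAt (𝓡∂ 3) p).symm '' D ⊆ (𝓡∂ 3).boundary Ω := by
    rintro _ ⟨z, hz, rfl⟩
    exact (symm_mem_boundary_iff (hDt hz)).2 hz.2
  have hpD : p ∈ (extChartAt (𝓡∂ 3) p).symm '' D :=
    ⟨extChartAt (𝓡∂ 3) p p, ⟨Metric.mem_ball_self hr, (mem_boundary_iff hps).1 hpb⟩,
      extChartAt_to_inv p⟩
  have hC := hconn.subset_connectedComponentIn hpD hsub
  rw [← connectedComponentIn_eq hp] at hC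
  have h1 := (continuousAt_extChartAt (I := 𝓡∂ 3) p).eventually (Metric.ball_mem_nhds _ hr)
  filter_upwards [h1, (isOpen_extChartAt_source (I := 𝓡∂ 3) p).mem_nhds hps] with x hx hxs hxb
  exact hC ⟨extChartAt (𝓡∂ 3) p x, ⟨hx, (mem_boundary_iff hxs).1 hxb⟩,
    (extChartAt (𝓡∂ 3) p).left_inv hxs⟩

variable {Γ : Set Ω} {f : Ω → ℝ}

/-- `Γ` is a union of components of the boundary. -/
def IsBoundaryPart (Γ : Set Ω) : Prop :=
  Γ ⊆ (𝓡∂ 3).boundary Ω ∧ ∀ p ∈ Γ, ∀ᶠ x in 𝓝 p, x ∈ (𝓡∂ 3).boundary Ω → x ∈ Γ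

lemma IsBoundaryPart.coord_zero (hΓ : IsBoundaryPart Γ) {p : Ω} (hp : p ∈ Γ) :
    extChartAt (𝓡∂ 3) p p 0 = 0 :=
  (mem_boundary_iff (mem_extChartAt_source p)).1 (hΓ.1 hp)

lemma eventually_chartRep_smooth (hf : ContMDiff (𝓡∂ 3) 𝓘(ℝ, ℝ) ∞ f) {p : Ω}
    {y : EuclideanSpace ℝ (Fin 3)} (hy : y ∈ (extChartAt (𝓡∂ 3) p).target) :
    ∀ᶠ z in 𝓝[range (𝓡∂ 3)] y, ContDiffWithinAt ℝ ∞ (chartRep (𝓡∂ 3) f p) (range (𝓡∂ 3)) z :=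
  (eventually_mem_target hy).mono fun _ hz => chartRep_smooth hf hz

lemma IsBoundaryPart.flatAt (hΓ : IsBoundaryPart Γ) (hf : ContMDiff (𝓡∂ 3) 𝓘(ℝ, ℝ) ∞ f)
    (h0 : ∀ x ∈ Γ, f x = 0) {p : Ω} (hp : p ∈ Γ) :
    Coord.FlatAt (range (𝓡∂ 3)) (chartRep (𝓡∂ 3) f p) (extChartAt (𝓡∂ 3) p p) := by
  have hy := mem_extChartAt_target (I := 𝓡∂ 3) p
  refine Coord.flatAt_of_vanish (hΓ.coord_zero hp) (chartRep_smooth hf hy)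
    (eventually_chartRep_smooth hf hy) ?_
  have h1 := (continuousWithinAt_chart_symm hy).eventually
    (by rw [extChartAt_to_inv]; exact hΓ.2 p hp)
  filter_upwards [h1, eventually_mem_target hy] with z h2 h3 h4
  exact h0 _ (h2 ((symm_mem_boundary_iff h3).2 h4))

lemma chartRep_self (p : Ω) : chartRep (𝓡∂ 3) f p (extChartAt (𝓡∂ 3) p p) = f p := by
  rw [chartRep, extChartAt_to_inv]

lemma IsBoundaryPart.pderiv_nonneg (hΓ : IsBoundaryPart Γ) (h0 : ∀ x ∈ Γ, f x = 0)
    (hpos : ∀ x, 0 ≤ f x) {p : Ω} (hp : p ∈ Γ) :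
    0 ≤ Coord.pderiv (range (𝓡∂ 3)) 0 (chartRep (𝓡∂ 3) f p) (extChartAt (𝓡∂ 3) p p) :=
  Coord.pderiv_zero_nonneg (hΓ.coord_zero hp) ((chartRep_self p).trans (h0 p hp))
    (Eventually.of_forall fun _ => hpos _)

/-- The normal derivative is nonnegative since f has a minimum on Γ. Were it zero, then together
with the vanishing tangential derivatives the whole differential would be zero. -/
lemma IsBoundaryPart.pderiv_pos (hΓ : IsBoundaryPart Γ) (hf : ContMDiff (𝓡∂ 3) 𝓘(ℝ, ℝ) ∞ f)
    (h0 : ∀ x ∈ Γ, f x = 0) (hpos : ∀ x, 0 ≤ f x) {p : Ω} (hp : p ∈ Γ)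
    (hd : mfderiv (𝓡∂ 3) 𝓘(ℝ, ℝ) f p ≠ 0) :
    0 < Coord.pderiv (range (𝓡∂ 3)) 0 (chartRep (𝓡∂ 3) f p) (extChartAt (𝓡∂ 3) p p) := by
  refine lt_of_le_of_ne (hΓ.pderiv_nonneg h0 hpos hp) fun h => hd ?_
  have hy := mem_extChartAt_target (I := 𝓡∂ 3) p
  have h1 : ∀ i, mfderiv (𝓡∂ 3) 𝓘(ℝ, ℝ) f ((extChartAt (𝓡∂ 3) p).symm (extChartAt (𝓡∂ 3) p p))
      (coordVector (𝓡∂ 3) p (extChartAt (𝓡∂ 3) p p) i) = 0 := by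
    intro i
    rw [mfderiv_coordVector hf hy]
    refine Fin.cases h.symm (fun a => (hΓ.flatAt hf h0 hp).first a) i
  have h2 : ∀ v, mfderiv (𝓡∂ 3) 𝓘(ℝ, ℝ) f ((extChartAt (𝓡∂ 3) p).symm (extChartAt (𝓡∂ 3) p p))
      v = 0 := by
    intro v
    obtain ⟨w, rfl⟩ := (chartFrame_bijective hy).2 v
    rw [chartFrame_apply, map_sum]
    refine Finset.sum_eq_zero fun i _ => ?_
    rw [map_smul, h1, smul_zero]
  have h3 : mfderiv (𝓡∂ 3) 𝓘(ℝ, ℝ) f ((extChartAt (𝓡∂ 3) p).symm (extChartAt (𝓡∂ 3) p p)) = 0 :=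
    ContinuousLinearMap.ext h2
  rwa [extChartAt_to_inv] at h3

/-- The first coordinate of a chart, cut off. -/
lemma exists_local_defining [T2Space Ω] (hΓ : IsBoundaryPart Γ) (q : Ω) :
    ∃ f : Ω → ℝ, ContMDiff (𝓡∂ 3) 𝓘(ℝ, ℝ) ∞ f ∧ (∀ x, 0 ≤ f x) ∧ (∀ x ∈ Γ, f x = 0) ∧
      ∀ᶠ x in 𝓝 q, mfderiv (𝓡∂ 3) 𝓘(ℝ, ℝ) f x ≠ 0 := by
  have : IsManifold (𝓡∂ 3) 1 Ω := isManifold_one _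
  let b : SmoothBumpFunction (𝓡∂ 3) q := Classical.arbitrary _
  have hx0 : ContMDiffOn (𝓡∂ 3) 𝓘(ℝ, ℝ) ∞ (fun x => extChartAt (𝓡∂ 3) q x 0)
      (chartAt (EuclideanHalfSpace 3) q).source :=
    (EuclideanSpace.proj (𝕜 := ℝ) (0 : Fin 3)).contMDiff.comp_contMDiffOn contMDiffOn_extChartAt
  refine ⟨fun x => b x • extChartAt (𝓡∂ 3) q x 0, b.contMDiff_smul hx0, ?_, ?_, ?_⟩
  · intro x
    refine mul_nonneg b.nonneg ?_
    have : extChartAt (𝓡∂ 3) q x ∈ range (𝓡∂ 3) := mem_range_self _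
    rwa [Coord.range_halfSpace] at this
  · intro x hx
    by_cases hxs : x ∈ (extChartAt (𝓡∂ 3) q).source
    · simp only [(mem_boundary_iff hxs).1 (hΓ.1 hx), smul_zero]
    · have : b x = 0 := by
        by_contra h
        exact hxs (by rw [extChartAt_source]; exact b.support_subset_source h)
      simp only [this, zero_smul]
  -- Near q the bump function is 1 and the product is the bare coordinate, whose differential is
  -- nonzero because that of the chart is onto.
  · filter_upwards [b.eventuallyEq_one.eventuallyEq_nhds,
      (isOpen_extChartAt_source (I := 𝓡∂ 3) q).mem_nhds (mem_extChartAt_source q)] with x hx hxs h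
    have he : (fun x => b x • extChartAt (𝓡∂ 3) q x 0) =ᶠ[𝓝 x] fun x => extChartAt (𝓡∂ 3) q x 0 :=
      hx.mono fun z hz => by simp [hz]
    have hxs' := hxs
    rw [extChartAt_source] at hxs'
    rw [he.mfderiv_eq] at h
    have hd := mfderiv_comp x
      ((EuclideanSpace.proj (𝕜 := ℝ) (0 : Fin 3)).contMDiff (n := 1).mdifferentiableAt (by simp))
      (mdifferentiableAt_extChartAt (I := 𝓡∂ 3) hxs')
    have hcomp : (fun x => extChartAt (𝓡∂ 3) q x 0) =
      (EuclideanSpace.proj (𝕜 := ℝ) (0 : Fin 3)) ∘ extChartAt (𝓡∂ 3) q := rfl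
    rw [hcomp, hd] at h
    obtain ⟨v, hv⟩ := (isInvertible_mfderiv_extChartAt hxs).bijective.2
      (EuclideanSpace.single 0 (1 : ℝ) : EuclideanSpace ℝ (Fin 3))
    have h2 := DFunLike.congr_fun h v
    have h3 : mfderiv 𝓘(ℝ, EuclideanSpace ℝ (Fin 3)) 𝓘(ℝ, ℝ)
      (EuclideanSpace.proj (𝕜 := ℝ) (0 : Fin 3)) (extChartAt (𝓡∂ 3) q x) =
      (EuclideanSpace.proj (𝕜 := ℝ) (0 : Fin 3)) := by
      rw [mfderiv_eq_fderiv]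
      exact (EuclideanSpace.proj (𝕜 := ℝ) (0 : Fin 3)).fderiv
    rw [h3] at h2
    have h4 : (EuclideanSpace.proj (𝕜 := ℝ) (0 : Fin 3))
      (mfderiv (𝓡∂ 3) 𝓘(ℝ, EuclideanSpace ℝ (Fin 3)) (extChartAt (𝓡∂ 3) q) x v) = 0 := h2
    rw [hv] at h4
    simp at h4

end Boundary

/-! ### The squared norm of the differential of a function -/

namespace Coord

variable {n : ℕ} {s : Set (EuclideanSpace ℝ (Fin n))} {y : EuclideanSpace ℝ (Fin n)}
  {G G' : EuclideanSpace ℝ (Fin n) → Matrix (Fin n) (Fin n) ℝ}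
  {f f' : EuclideanSpace ℝ (Fin n) → ℝ}

lemma gradSq_eq_mul : gradSq s G f y =
    ((gradCol s f y).transpose * ((G y)⁻¹ * gradCol s f y)) () () := by
  rw [gradSq, Matrix.mul_apply]
  exact Finset.sum_congr rfl fun i _ => mul_comm _ _

lemma gradSq_nonneg (hG : RiemAt s G y) : 0 ≤ gradSq s G f y := by
  have h := hG.posDef.inv.posSemidef.dotProduct_mulVec_nonneg (fun i => gradCol s f y i ())
  refine h.trans_eq ?_
  simp only [dotProduct, Matrix.mulVec, gradSq, gradVec, Matrix.mul_apply, Pi.star_apply,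
    star_trivial]
  exact Finset.sum_congr rfl fun i _ => mul_comm _ _

lemma smooth_gradSq (hs : UniqueDiffOn ℝ s) (hy : y ∈ s) (hG : MetricAt s G y)
    (hf : ContDiffWithinAt ℝ ∞ f s y) : ContDiffWithinAt ℝ ∞ (gradSq s G f) s y :=
  ContDiffWithinAt.sum fun i _ =>
    (hG.smooth_inv.mul (smooth_gradCol hs hy hf) i ()).mul (smooth_gradCol hs hy hf i ())

lemma gradSq_congr (hf : f =ᶠ[𝓝[s] y] f') (hy : y ∈ s) : gradSq s G f y = gradSq s G f' y := by
  have h : gradCol s f y = gradCol s f' y := by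
    ext i u
    exact pderiv_congr _ hf hy
  simp only [gradSq, gradVec, h]

lemma gradSq_change {τ : EuclideanSpace ℝ (Fin n) → EuclideanSpace ℝ (Fin n)}
    (hs : UniqueDiffOn ℝ s) (hy : y ∈ s) (hτ : ChangeAt s τ y) (h : G' y = (jac s τ y).transpose * G (τ y) * jac s τ y)
    (hf : DifferentiableWithinAt ℝ f s (τ y)) :
    gradSq s G' (fun z => f (τ z)) y = gradSq s G f (τ y) := by
  have hc : gradCol s (fun z => f (τ z)) y = (jac s τ y).transpose * gradCol s f (τ y) := by
    ext i u
    rw [Matrix.mul_apply]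
    refine (pderiv_comp hs hy i hτ.tendsto (hτ.smooth.differentiableWithinAt (by simp)) hf).trans ?_
    exact Finset.sum_congr rfl fun a _ => mul_comm _ _
  have hJ : ((jac s τ y).transpose)⁻¹ * (jac s τ y).transpose = 1 :=
    Matrix.nonsing_inv_mul _ (by
      rw [Matrix.det_transpose]
      exact isUnit_iff_ne_zero.2 hτ.det_ne)
  rw [gradSq_eq_mul, gradSq_eq_mul, hc, h, Matrix.mul_inv_rev, Matrix.mul_inv_rev,
    Matrix.transpose_mul, Matrix.transpose_transpose]
  refine congrFun (congrFun ?_ ()) ()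
  calc (gradCol s f (τ y)).transpose * jac s τ y * ((jac s τ y)⁻¹ * ((G (τ y))⁻¹ *
        ((jac s τ y).transpose)⁻¹) * ((jac s τ y).transpose * gradCol s f (τ y)))
      = (gradCol s f (τ y)).transpose * (jac s τ y * (jac s τ y)⁻¹) * ((G (τ y))⁻¹ *
        (((jac s τ y).transpose)⁻¹ * (jac s τ y).transpose) * gradCol s f (τ y)) := by
        simp only [Matrix.mul_assoc]
    _ = _ := by rw [hτ.mul_inv, hJ, Matrix.mul_one, Matrix.mul_one]

lemma gradSq_mul (hs : UniqueDiffOn ℝ s) (hy : y ∈ s) (hf : DifferentiableWithinAt ℝ f s y)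
    (hf' : DifferentiableWithinAt ℝ f' s y) (h0 : f' y = 0) :
    gradSq s G (fun z => f z * f' z) y = f y ^ 2 * gradSq s G f' y := by
  have h : gradCol s (fun z => f z * f' z) y = f y • gradCol s f' y := by
    ext i u
    refine (pderiv_mul hs hy i hf hf').trans ?_
    rw [h0]
    simp [gradCol]
  simp only [gradSq, gradVec, h, Matrix.mul_smul, Matrix.smul_apply, smul_eq_mul, Finset.mul_sum]
  exact Finset.sum_congr rfl fun i _ => by ring

end Coord

section NormSq

set_option linter.unusedSectionVars false

variable {n : ℕ} {H : Type*} [TopologicalSpace H]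
  {I : ModelWithCorners ℝ (EuclideanSpace ℝ (Fin n)) H}
  {M : Type*} [TopologicalSpace M] [ChartedSpace H M] [IsManifold I ∞ M]
  {g : SmoothMetric I M} {f : M → ℝ}

/-- The squared norm of the differential of `f`. -/
def dnormSq (g : SmoothMetric I M) (f : M → ℝ) (x : M) : ℝ :=
  Coord.gradSq (range I) (metricCoeff g x) (chartRep I f x) (extChartAt I x x)

lemma dnormSq_nonneg (x : M) : 0 ≤ dnormSq g f x :=
  Coord.gradSq_nonneg (riemAt_metricCoeff g (mem_extChartAt_target x))

/-- Each value of `dnormSq` is computed in the chart at that very point. Moving to one fixed chart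
is what makes its smoothness accessible. -/
lemma dnormSq_eq (hf : ContMDiff I 𝓘(ℝ, ℝ) ∞ f) {x q : M} (hx : x ∈ (extChartAt I q).source) :
    dnormSq g f x =
      Coord.gradSq (range I) (metricCoeff g q) (chartRep I f q) (extChartAt I q x) := by
  have hy := mem_extChartAt_target (I := I) x
  have hys := extChartAt_target_subset_range x hy
  have hsymm : (extChartAt I x).symm (extChartAt I x x) = x := extChartAt_to_inv x
  have hq : (extChartAt I x).symm (extChartAt I x x) ∈ (extChartAt I q).source := by rwa [hsymm]
  have hτ : transition I x q (extChartAt I x x) = extChartAt I q x := by rw [transition, hsymm]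
  have hyq := (extChartAt I q).map_source hx
  have h := Coord.gradSq_change (f := chartRep I f q) I.uniqueDiffOn hys
    (changeAt_transition g hy hq)
    (metricCoeff_transition g hy hq)
    (by rw [hτ]; exact (chartRep_smooth hf hyq).differentiableWithinAt (by simp))
  rw [hτ] at h
  rw [← h, dnormSq]
  refine Coord.gradSq_congr ?_ hys
  filter_upwards [eventually_mem_source hy hq] with z hz
  rw [chartRep, chartRep, transition, (extChartAt I q).left_inv hz]

lemma dnormSq_smooth (hf : ContMDiff I 𝓘(ℝ, ℝ) ∞ f) :
    ContMDiff I 𝓘(ℝ, ℝ) ∞ (dnormSq g f) := by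
  intro q
  have hy := mem_extChartAt_target (I := I) q
  have h1 := Coord.smooth_gradSq I.uniqueDiffOn (extChartAt_target_subset_range q hy)
    (riemAt_metricCoeff g hy).metricAt (chartRep_smooth hf hy)
  have h2 : ContMDiffAt I 𝓘(ℝ, ℝ) ∞ (fun x => Coord.gradSq (range I) (metricCoeff g q)
      (chartRep I f q) (extChartAt I q x)) q :=
    ContMDiffWithinAt.comp (t := range I) q h1.contMDiffWithinAt
      (contMDiffAt_extChartAt (x := q) (n := ∞)).contMDiffWithinAt fun _ _ => mem_range_self _
  refine h2.congr_of_eventuallyEq ?_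
  filter_upwards [(isOpen_extChartAt_source (I := I) q).mem_nhds (mem_extChartAt_source q)]
    with x hx
  exact dnormSq_eq hf hx

end NormSq

/-! ### A defining function of a part of the boundary -/

section Defining

set_option linter.unusedSectionVars false

variable {Ω : Type*} [TopologicalSpace Ω] [ChartedSpace (EuclideanHalfSpace 3) Ω]
  [IsManifold (𝓡∂ 3) ∞ Ω] {Γ : Set Ω} {f : Ω → ℝ}

lemma IsBoundaryPart.dnormSq_pos (hΓ : IsBoundaryPart Γ) (hf : ContMDiff (𝓡∂ 3) 𝓘(ℝ, ℝ) ∞ f)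
    (h0 : ∀ x ∈ Γ, f x = 0) (g : SmoothMetric (𝓡∂ 3) Ω) {p : Ω} (hp : p ∈ Γ)
    (hd : 0 < Coord.pderiv (range (𝓡∂ 3)) 0 (chartRep (𝓡∂ 3) f p) (extChartAt (𝓡∂ 3) p p)) :
    0 < dnormSq g f p := by
  rw [dnormSq, (hΓ.flatAt hf h0 hp).gradSq]
  exact mul_pos ((riemAt_metricCoeff g (mem_extChartAt_target p)).inv_diag_pos 0) (by positivity)

/-- A boundary part has a nonnegative defining function with nonvanishing normal derivative. -/
lemma exists_defining [T2Space Ω] [CompactSpace Ω] (hΓ : IsBoundaryPart Γ) (hc : IsClosed Γ) :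
    ∃ f : Ω → ℝ, ContMDiff (𝓡∂ 3) 𝓘(ℝ, ℝ) ∞ f ∧ (∀ x, 0 ≤ f x) ∧ (∀ x, f x = 0 ↔ x ∈ Γ) ∧
      ∀ p ∈ Γ, 0 < Coord.pderiv (range (𝓡∂ 3)) 0 (chartRep (𝓡∂ 3) f p)
        (extChartAt (𝓡∂ 3) p p) := by
  choose b hb1 hb2 hb3 hb4 using fun q : Ω => exists_local_defining (Γ := Γ) hΓ q
  obtain ⟨t, -, ht⟩ := hc.isCompact.elim_nhds_subcover _ (fun q _ => hb4 q)
  obtain ⟨h, hh1, hh2, hh3, -⟩ := exists_contMDiff_zero_iff_one_iff_of_isClosed (n := (⊤ : ℕ∞)) (𝓡∂ 3) hc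
    isClosed_empty (disjoint_empty Γ)
  have hhn : ∀ x, 0 ≤ h x := fun x => (hh2 (mem_range_self x)).1
  have hsum : ∀ x, 0 ≤ ∑ q ∈ t, b q x := fun x => Finset.sum_nonneg fun q _ => hb2 q x
  have hsm : ContMDiff (𝓡∂ 3) 𝓘(ℝ, ℝ) ∞ fun x => ∑ q ∈ t, b q x :=
    contMDiff_finsetSum fun q _ => hb1 q
  -- The function h pins the zero set to Γ, and the finitely many local functions supply the
  -- derivative. Every normal derivative is nonnegative, so nothing cancels and no partition of
  -- unity is needed.
  refine ⟨fun x => h x + ∑ q ∈ t, b q x, hh1.add hsm,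
    fun x => add_nonneg (hhn x) (hsum x), fun x => ?_, fun p hp => ?_⟩
  · rw [add_eq_zero_iff_of_nonneg (hhn x) (hsum x), ← hh3]
    exact ⟨fun h => h.1, fun hx => ⟨hx, Finset.sum_eq_zero fun q _ => hb3 q x hx⟩⟩
  · have hy := mem_extChartAt_target (I := 𝓡∂ 3) p
    have hys := extChartAt_target_subset_range p hy
    have hdiff : ∀ {k : Ω → ℝ}, ContMDiff (𝓡∂ 3) 𝓘(ℝ, ℝ) ∞ k →
      DifferentiableWithinAt ℝ (chartRep (𝓡∂ 3) k p) (range (𝓡∂ 3)) (extChartAt (𝓡∂ 3) p p) :=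
      fun hk => (chartRep_smooth hk hy).differentiableWithinAt (by simp)
    have h1 : Coord.pderiv (range (𝓡∂ 3)) 0 (chartRep (𝓡∂ 3) (fun x => h x + ∑ q ∈ t, b q x) p)
        (extChartAt (𝓡∂ 3) p p) =
        Coord.pderiv (range (𝓡∂ 3)) 0 (chartRep (𝓡∂ 3) h p) (extChartAt (𝓡∂ 3) p p) +
        ∑ q ∈ t, Coord.pderiv (range (𝓡∂ 3)) 0 (chartRep (𝓡∂ 3) (b q) p)
          (extChartAt (𝓡∂ 3) p p) := by
      refine (Coord.pderiv_add (𝓡∂ 3).uniqueDiffOn hys 0 (hdiff hh1) (hdiff hsm)).trans ?_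
      congr 1
      exact Coord.pderiv_sum (𝓡∂ 3).uniqueDiffOn hys t 0 fun q _ => hdiff (hb1 q)
    rw [h1]
    refine add_pos_of_nonneg_of_pos
      (hΓ.pderiv_nonneg (fun x hx => (hh3 x).1 hx) hhn hp) ?_
    obtain ⟨q, hqt, hq⟩ := mem_iUnion₂.1 (ht hp)
    exact Finset.sum_pos' (fun q _ => hΓ.pderiv_nonneg (hb3 q) (hb2 q) hp)
      ⟨q, hqt, hΓ.pderiv_pos (hb1 q) (hb3 q) (hb2 q) hp hq⟩

/-- The defining function can be chosen with differential of unit length. -/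
theorem exists_unit_defining [T2Space Ω] [CompactSpace Ω] (hΓ : IsBoundaryPart Γ)
    (hc : IsClosed Γ) (g : SmoothMetric (𝓡∂ 3) Ω) :
    ∃ f : Ω → ℝ, ContMDiff (𝓡∂ 3) 𝓘(ℝ, ℝ) ∞ f ∧ (∀ x, 0 ≤ f x) ∧ (∀ x, f x = 0 ↔ x ∈ Γ) ∧
      ∀ p ∈ Γ, 0 < Coord.pderiv (range (𝓡∂ 3)) 0 (chartRep (𝓡∂ 3) f p)
        (extChartAt (𝓡∂ 3) p p) ∧ dnormSq g f p = 1 := by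
  obtain ⟨f, hf, hn, hz, hd⟩ := exists_defining hΓ hc
  have hf0 : ∀ x ∈ Γ, f x = 0 := fun x => (hz x).2
  have hpos : ∀ x, 0 < dnormSq g f x + f x := by
    intro x
    by_cases hx : x ∈ Γ
    · rw [hf0 x hx, add_zero]
      exact hΓ.dnormSq_pos hf hf0 g hx (hd x hx)
    · exact add_pos_of_nonneg_of_pos (dnormSq_nonneg x)
        (lt_of_le_of_ne (hn x) fun h => hx ((hz x).1 h.symm))
  -- On Γ this is 1/|df|, the normalising factor. Adding f under the root keeps it positive off Γ,
  -- where df may vanish, so a is smooth on all of Ω.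
  let a : Ω → ℝ := fun x => (Real.sqrt (dnormSq g f x + f x))⁻¹
  have hapos : ∀ x, 0 < a x := fun x => inv_pos.2 (Real.sqrt_pos.2 (hpos x))
  have ha : ContMDiff (𝓡∂ 3) 𝓘(ℝ, ℝ) ∞ a := by
    intro x
    have h1 : ContDiffAt ℝ ∞ (fun t : ℝ => (Real.sqrt t)⁻¹) (dnormSq g f x + f x) :=
      (Real.contDiffAt_sqrt (hpos x).ne').inv (Real.sqrt_pos.2 (hpos x)).ne'
    exact h1.contMDiffAt.comp (f := fun x => dnormSq g f x + f x) x (((dnormSq_smooth hf).add hf) x)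
  refine ⟨fun x => a x * f x, ha.mul hf, fun x => mul_nonneg (hapos x).le (hn x), fun x => ?_,
    fun p hp => ?_⟩
  · rw [mul_eq_zero_iff_left (hapos x).ne', hz]
  · have hy := mem_extChartAt_target (I := 𝓡∂ 3) p
    have hys := extChartAt_target_subset_range p hy
    have hd1 := (chartRep_smooth ha hy).differentiableWithinAt (n := ∞) (by simp)
    have hd2 := (chartRep_smooth hf hy).differentiableWithinAt (n := ∞) (by simp)
    have hfp : chartRep (𝓡∂ 3) f p (extChartAt (𝓡∂ 3) p p) = 0 :=
      (chartRep_self p).trans (hf0 p hp)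
    constructor
    · refine lt_of_lt_of_eq ?_ (Coord.pderiv_mul (𝓡∂ 3).uniqueDiffOn hys 0 hd1 hd2).symm
      rw [hfp, chartRep_self]
      have := mul_pos (hapos p) (hd p hp)
      linarith
    · refine (Coord.gradSq_mul (𝓡∂ 3).uniqueDiffOn hys hd1 hd2 hfp).trans ?_
      rw [chartRep_self]
      change a p ^ 2 * dnormSq g f p = 1
      have h2 := hpos p
      simp only [a, hf0 p hp, add_zero] at h2 ⊢
      rw [inv_pow, Real.sq_sqrt h2.le, inv_mul_cancel₀ h2.ne']

end Defining

/-! ### The profile function -/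

lemma hasDerivAt_expNegInvGlue (x : ℝ) :
    HasDerivAt expNegInvGlue ((x⁻¹) ^ 2 * expNegInvGlue x) x := by
  have h := expNegInvGlue.hasDerivAt_polynomial_eval_inv_mul 1 x
  simpa using h

/-- A smooth function which decreases from `c` to `0` on `[0, ε]`, and is small compared with its
derivative. -/
lemma exists_profile {c ε : ℝ} (hc : 0 < c) (hε : 0 < ε) :
    ∃ φ : ℝ → ℝ, ContDiff ℝ ∞ φ ∧ (∀ t, 0 ≤ φ t) ∧ φ 0 = c ∧ (∀ t, 0 ≤ t → φ t ≤ c) ∧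
      (∀ t, t < ε → 0 < φ t) ∧ (∀ t, ε ≤ t → φ t = 0) ∧
      ∀ t, 0 ≤ t → deriv φ t ≤ -(φ t / ε ^ 2) := by
  have hE : 0 < expNegInvGlue ε := expNegInvGlue.pos_of_pos hε
  -- The profile is c e^(1/ε) e^(-1/(ε - t)) for t < ε. Its logarithmic derivative -(ε - t)⁻² is at
  -- most -ε⁻² on [0, ε), and beyond ε everything is zero.
  refine ⟨fun t => c / expNegInvGlue ε * expNegInvGlue (ε - t), ?_, ?_, ?_, ?_, ?_, ?_, ?_⟩
  · exact contDiff_const.mul (expNegInvGlue.contDiff.comp (contDiff_const.sub contDiff_id))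
  · exact fun t => mul_nonneg (by positivity) (expNegInvGlue.nonneg _)
  · simp [hE.ne']
  · intro t ht
    have h1 : expNegInvGlue (ε - t) ≤ expNegInvGlue ε :=
      expNegInvGlue.monotone (by linarith)
    calc c / expNegInvGlue ε * expNegInvGlue (ε - t) ≤ c / expNegInvGlue ε * expNegInvGlue ε := by
          gcongr
      _ = c := div_mul_cancel₀ _ hE.ne'
  · exact fun t ht => mul_pos (by positivity) (expNegInvGlue.pos_of_pos (by linarith))
  · intro t ht
    simp [expNegInvGlue.zero_of_nonpos (sub_nonpos.2 ht)]
  · intro t ht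
    have h1 : HasDerivAt (fun t => c / expNegInvGlue ε * expNegInvGlue (ε - t))
        (c / expNegInvGlue ε * (((ε - t)⁻¹) ^ 2 * expNegInvGlue (ε - t) * -1)) t :=
      ((hasDerivAt_expNegInvGlue (ε - t)).comp t ((hasDerivAt_id t).const_sub ε)).const_mul _
    rw [h1.deriv]
    have h2 : expNegInvGlue (ε - t) / ε ^ 2 ≤ ((ε - t)⁻¹) ^ 2 * expNegInvGlue (ε - t) := by
      rcases le_or_gt ε t with h | h
      · simp [expNegInvGlue.zero_of_nonpos (sub_nonpos.2 h)]
      · rw [div_eq_inv_mul, ← inv_pow]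
        have h3 : 0 < ε - t := by linarith
        refine mul_le_mul_of_nonneg_right ?_ (expNegInvGlue.nonneg _)
        gcongr
        linarith
    have h4 := mul_le_mul_of_nonneg_left h2 (div_pos hc hE).le
    rw [mul_div_assoc]
    linarith

/-! ### Bending the metric near the boundary -/

section Bend

set_option linter.unusedSectionVars false

variable {n : ℕ} {H : Type*} [TopologicalSpace H]
  {I : ModelWithCorners ℝ (EuclideanSpace ℝ (Fin n)) H}
  {M : Type*} [TopologicalSpace M] [ChartedSpace H M] [IsManifold I ∞ M]

/-- The metric `g + φ(ρ) dρ ⊗ dρ`. -/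
def bendMetric (g : SmoothMetric I M) {ρ : M → ℝ} (hρ : ContMDiff I 𝓘(ℝ, ℝ) ∞ ρ)
    {φ : ℝ → ℝ} (hφ : ContDiff ℝ ∞ φ) (h0 : ∀ t, 0 ≤ φ t) : SmoothMetric I M :=
  rankOneMetric g hρ (f := fun x => φ (ρ x)) (hφ.contMDiff.comp hρ) fun x => h0 (ρ x)

variable (g : SmoothMetric I M) {ρ : M → ℝ} (hρ : ContMDiff I 𝓘(ℝ, ℝ) ∞ ρ)
    {φ : ℝ → ℝ} (hφ : ContDiff ℝ ∞ φ) (h0 : ∀ t, 0 ≤ φ t)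

lemma metricCoeff_bendMetric_eventuallyEq {p : M} {y : EuclideanSpace ℝ (Fin n)}
    (hy : y ∈ (extChartAt I p).target) : metricCoeff (bendMetric g hρ hφ h0) p =ᶠ[𝓝[range I] y]
      Coord.perturb (range I) (metricCoeff g p) (chartRep I ρ p)
        (fun z => φ (chartRep I ρ p z)) :=
  metricCoeff_rankOneMetric_eventuallyEq g hρ _ _ hy

lemma eventuallyEq_of_profile_zero {ε : ℝ} (hz : ∀ t, ε ≤ t → φ t = 0) {p : M} (hp : ε < ρ p) :
    metricCoeff (bendMetric g hρ hφ h0) p =ᶠ[𝓝[range I] (extChartAt I p p)] metricCoeff g p :=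
  metricCoeff_rankOneMetric_eventuallyEq_of_zero g hρ _ _
    ((hρ.continuous.continuousAt.eventually (lt_mem_nhds hp)).mono fun _ hx => hz _ (le_of_lt hx))

lemma scalarCurvature_bendMetric_of_lt {ε : ℝ} (hz : ∀ t, ε ≤ t → φ t = 0) {p : M}
    (hp : ε < ρ p) : scalarCurvature (bendMetric g hρ hφ h0) p = scalarCurvature g p :=
  Coord.scalar_congr (eventuallyEq_of_profile_zero g hρ hφ h0 hz hp) (mem_range_self _)

end Bend

/-! ### Mean and scalar curvature of the bent metric near the boundary -/

section BendBoundary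

variable {Ω : Type*} [TopologicalSpace Ω] [ChartedSpace (EuclideanHalfSpace 3) Ω]
  [IsManifold (𝓡∂ 3) ∞ Ω] {Γ : Set Ω}
  (g : SmoothMetric (𝓡∂ 3) Ω) {ρ : Ω → ℝ} (hρ : ContMDiff (𝓡∂ 3) 𝓘(ℝ, ℝ) ∞ ρ)

lemma boundaryMeanCurvature_bendMetric_of_lt {φ : ℝ → ℝ} (hφ : ContDiff ℝ ∞ φ)
    (h0 : ∀ t, 0 ≤ φ t) {ε : ℝ} (hz : ∀ t, ε ≤ t → φ t = 0) {p : Ω} (hp : ε < ρ p) :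
    boundaryMeanCurvature (bendMetric g hρ hφ h0) p = boundaryMeanCurvature g p :=
  Coord.meanCurvature_congr (eventuallyEq_of_profile_zero g hρ hφ h0 hz hp) (mem_range_self _)

/-- The normalisation |dρ| = 1 is used here: it makes the scaling factor the same constant at every
point of Γ. -/
lemma boundaryMeanCurvature_bendMetric (hΓ : IsBoundaryPart Γ) (hρ0 : ∀ x ∈ Γ, ρ x = 0)
    {φ : ℝ → ℝ} (hφ : ContDiff ℝ ∞ φ) (h0 : ∀ t, 0 ≤ φ t) {p : Ω} (hp : p ∈ Γ)
    (hd : 0 < Coord.pderiv (range (𝓡∂ 3)) 0 (chartRep (𝓡∂ 3) ρ p) (extChartAt (𝓡∂ 3) p p))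
    (h1 : dnormSq g ρ p = 1) :
    boundaryMeanCurvature (bendMetric g hρ hφ h0) p =
      (Real.sqrt (1 + φ 0))⁻¹ * boundaryMeanCurvature g p := by
  have hy := mem_extChartAt_target (I := 𝓡∂ 3) p
  have hys := extChartAt_target_subset_range p hy
  have hR := riemAt_metricCoeff g hy
  have hρy := chartRep_smooth hρ hy
  have hdet := (hR.perturb (𝓡∂ 3).uniqueDiffOn hys hρy
    (hφ.contDiffAt.comp_contDiffWithinAt _ hρy) (h0 _)).metricAt.det_ne
  have h := Coord.meanCurvature_perturb (𝓡∂ 3).uniqueDiffOn hys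
    (𝓡∂ 3).range_subset_closure_interior
    ((eventually_riemAt g hy).mono fun _ h => h.metricAt) hρy hφ (hΓ.flatAt hρ hρ0 hp) hd.ne'
    (hR.inv_diag_pos 0) hdet (h0 _)
  rw [boundaryMeanCurvature,
    Coord.meanCurvature_congr (metricCoeff_bendMetric_eventuallyEq g hρ hφ h0 hy) hys, h,
    chartRep_self, hρ0 p hp]
  change (Real.sqrt (1 + φ 0 * dnormSq g ρ p))⁻¹ * _ = _
  rw [h1, mul_one]
  rfl

/-- At `x`, all bendings by functions decaying fast enough do not decrease the scalar curvature. -/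
def BendsUp (Φ δ : ℝ) (x : Ω) : Prop :=
  ∀ (φ : ℝ → ℝ) (hφ : ContDiff ℝ ∞ φ) (h0 : ∀ t, 0 ≤ φ t) (ε : ℝ), 0 < ε → ε < δ →
    φ (ρ x) ≤ Φ → deriv φ (ρ x) ≤ -(φ (ρ x) / ε ^ 2) →
    scalarCurvature g x ≤ scalarCurvature (bendMetric g hρ hφ h0) x ∧
    (0 < φ (ρ x) → scalarCurvature g x < scalarCurvature (bendMetric g hρ hφ h0) x)

lemma BendsUp.mono {Φ δ δ' : ℝ} {x : Ω} (h : BendsUp g hρ Φ δ x) (hδ : δ' ≤ δ) :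
    BendsUp g hρ Φ δ' x :=
  fun φ hφ h0 ε h1 h2 => h φ hφ h0 ε h1 (h2.trans_le hδ)

/-- Near q the gain in scalar curvature is at least -a φ' - C φ ≥ (a/ε² - C) φ, and the bracket is
positive for small ε. The neighbourhood does not depend on φ or ε, so both may be chosen afterwards.
-/
lemma eventually_bendsUp (hΓ : IsBoundaryPart Γ) (hρ0 : ∀ x ∈ Γ, ρ x = 0) {q : Ω} (hq : q ∈ Γ)
    (hd : 0 < Coord.pderiv (range (𝓡∂ 3)) 0 (chartRep (𝓡∂ 3) ρ q) (extChartAt (𝓡∂ 3) q q))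
    (hH : 0 < boundaryMeanCurvature g q) (Φ : ℝ) :
    ∃ δ > 0, ∀ᶠ x in 𝓝 q, BendsUp g hρ Φ δ x := by
  have hy := mem_extChartAt_target (I := 𝓡∂ 3) q
  have hys := extChartAt_target_subset_range q hy
  have hR := eventually_riemAt g hy
  have hr := eventually_chartRep_smooth hρ hy
  obtain ⟨a, ha, C, hC⟩ := Coord.scalar_perturb_ge (𝓡∂ 3).uniqueDiffOn Coord.convex_halfSpace
    (𝓡∂ 3).range_subset_closure_interior hys hR hr Φ fun c hc =>
      Coord.levelBend_frozen_neg (𝓡∂ 3).uniqueDiffOn (𝓡∂ 3).range_subset_closure_interior hys hR hr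
        (hΓ.flatAt hρ hρ0 hq) hd hH hc.1
  -- This threshold guarantees C ε² < a; the absolute value and the added 1 cover C ≤ 0.
  refine ⟨Real.sqrt (a / (|C| + 1)), Real.sqrt_pos.2 (by positivity), ?_⟩
  have ht : Tendsto (extChartAt (𝓡∂ 3) q) (𝓝 q) (𝓝[range (𝓡∂ 3)] (extChartAt (𝓡∂ 3) q q)) :=
    tendsto_nhdsWithin_iff.2 ⟨continuousAt_extChartAt q, Eventually.of_forall fun _ => mem_range_self _⟩
  filter_upwards [ht.eventually hC,
    (isOpen_extChartAt_source (I := 𝓡∂ 3) q).mem_nhds (mem_extChartAt_source q)]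
    with x hx hxs φ hφ h0 ε hε hεδ hΦ hder
  have hrep : chartRep (𝓡∂ 3) ρ q (extChartAt (𝓡∂ 3) q x) = ρ x := by
    rw [chartRep, (extChartAt (𝓡∂ 3) q).left_inv hxs]
  have hφx := h0 (ρ x)
  have hε2 : 0 < ε ^ 2 := by positivity
  have hder0 : deriv φ (ρ x) ≤ 0 := hder.trans (neg_nonpos.2 (by positivity))
  have h1 := hx φ hφ h0 (by rwa [hrep]) (by rwa [hrep])
  have hyx := (extChartAt (𝓡∂ 3) q).map_source hxs
  rw [hrep, ← Coord.scalar_congr (metricCoeff_bendMetric_eventuallyEq g hρ hφ h0 hyx)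
    (extChartAt_target_subset_range q hyx), ← scalarCurvature_eq g hxs,
    ← scalarCurvature_eq (bendMetric g hρ hφ h0) hxs] at h1
  have h2 : C * ε ^ 2 < a := by
    have h3 : ε ^ 2 < a / (|C| + 1) := (Real.lt_sqrt hε.le).1 hεδ
    rw [lt_div_iff₀ (by positivity)] at h3
    nlinarith [le_abs_self C]
  have h4 : a * (φ (ρ x) / ε ^ 2) ≤ -(a * deriv φ (ρ x)) := by
    have := mul_le_mul_of_nonneg_left hder ha.le
    linarith
  have h5 : a * (φ (ρ x) / ε ^ 2) - C * φ (ρ x) = (a - C * ε ^ 2) / ε ^ 2 * φ (ρ x) := by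
    field_simp
  have h6 : 0 < (a - C * ε ^ 2) / ε ^ 2 := div_pos (sub_pos.2 h2) hε2
  constructor
  · have := mul_nonneg h6.le hφx
    linarith
  · intro hpos
    have := mul_pos h6 hpos
    linarith

/-- The property survives shrinking δ, so a finite cover of Γ leaves a common positive threshold. -/
lemma exists_uniform_bendsUp (hΓ : IsBoundaryPart Γ) (hc : IsCompact Γ) (hρ0 : ∀ x ∈ Γ, ρ x = 0)
    (hd : ∀ q ∈ Γ, 0 < Coord.pderiv (range (𝓡∂ 3)) 0 (chartRep (𝓡∂ 3) ρ q)
      (extChartAt (𝓡∂ 3) q q))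
    (hH : ∀ q ∈ Γ, 0 < boundaryMeanCurvature g q) (Φ : ℝ) :
    ∃ δ > 0, ∀ᶠ x in 𝓝ˢ Γ, BendsUp g hρ Φ δ x := by
  refine hc.induction_on (p := fun s => ∃ δ > 0, ∀ᶠ x in 𝓝ˢ s, BendsUp g hρ Φ δ x)
    ⟨1, one_pos, by simp⟩ ?_ ?_ ?_
  · rintro s t hst ⟨δ, hδ, h⟩
    exact ⟨δ, hδ, nhdsSet_mono hst h⟩
  · rintro s t ⟨δ, hδ, h⟩ ⟨δ', hδ', h'⟩
    refine ⟨min δ δ', lt_min hδ hδ', ?_⟩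
    rw [nhdsSet_union, eventually_sup]
    exact ⟨h.mono fun x hx => hx.mono g hρ (min_le_left _ _),
      h'.mono fun x hx => hx.mono g hρ (min_le_right _ _)⟩
  · intro q hq
    obtain ⟨δ, hδ, h⟩ := eventually_bendsUp g hρ hΓ hρ0 hq (hd q hq) (hH q hq) Φ
    refine ⟨{x | ∀ᶠ z in 𝓝 x, BendsUp g hρ Φ δ z},
      mem_nhdsWithin_of_mem_nhds (eventually_eventually_nhds.2 h), δ, hδ, ?_⟩
    rw [eventually_nhdsSet_iff_forall]
    exact fun x hx => hx

end BendBoundary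

/-! ### Assembly of the new fill-in -/

section Main

set_option linter.unusedSectionVars false

variable {S : Type*} [TopologicalSpace S] [ChartedSpace (EuclideanSpace ℝ (Fin 2)) S]
  [IsManifold (𝓡 2) ∞ S]
  {Ω : Type*} [TopologicalSpace Ω] [ChartedSpace (EuclideanHalfSpace 3) Ω]
  [IsManifold (𝓡∂ 3) ∞ Ω]

lemma BartnikData.compactSpace (B : BartnikData S) : CompactSpace S := by
  obtain ⟨e⟩ := B.sphere
  have : CompactSpace (Metric.sphere (0 : EuclideanSpace ℝ (Fin 3)) 1) :=
    isCompact_iff_compactSpace.1 (isCompact_sphere _ _)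
  exact e.symm.compactSpace

lemma IsFillIn.isBoundaryPart {B : BartnikData S} {g : SmoothMetric (𝓡∂ 3) Ω} {ι : S → Ω}
    (h : IsFillIn B g ι) : IsBoundaryPart (range ι) := by
  obtain ⟨p₀, -, hp₀⟩ := h.component
  rw [hp₀]
  exact ⟨connectedComponentIn_subset _ _, fun p hp => eventually_mem_component hp⟩

/-- As ρ is constant along Σ, the added term dρ ⊗ dρ is invisible to the induced metric, and the
embedding remains isometric. -/
lemma dfun_mfderiv_eq_zero {ρ : Ω → ℝ} (hρ : ContMDiff (𝓡∂ 3) 𝓘(ℝ, ℝ) ∞ ρ) {ι : S → Ω}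
    (hι : ContMDiff (𝓡 2) (𝓡∂ 3) ∞ ι) (h0 : ∀ x, ρ (ι x) = 0) (x : S) (v : TangentSpace (𝓡 2) x) :
    dfun (𝓡∂ 3) ρ (ι x) (mfderiv (𝓡 2) (𝓡∂ 3) ι x v) = 0 := by
  have h1 := mfderiv_comp x ((hρ (ι x)).mdifferentiableAt (by simp))
    ((hι x).mdifferentiableAt (by simp))
  have h2 : ρ ∘ ι = fun _ => 0 := funext h0
  rw [h2, mfderiv_const] at h1
  exact (DFunLike.congr_fun h1 v).symm

end Main

theorem lemma3p3 {S : Type*} [TopologicalSpace S] [ChartedSpace (EuclideanSpace ℝ (Fin 2)) S]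
    [IsManifold (𝓡 2) ∞ S]
    {Ω : Type*} [TopologicalSpace Ω] [ChartedSpace (EuclideanHalfSpace 3) Ω]
    [IsManifold (𝓡∂ 3) ∞ Ω]
    (B : BartnikData S) (g : SmoothMetric (𝓡∂ 3) Ω) (ι : S → Ω) (hfill : IsFillIn B g ι)
    (lam : ℝ) (hlam0 : 0 < lam) (hlam1 : lam < 1)
    (U : Set Ω) (hU : U ∈ 𝓝ˢ (range ι)) :
    ∃ g' : SmoothMetric (𝓡∂ 3) Ω,
      IsFillIn (B.scale lam hlam0) g' ι ∧
      (∀ (p : Ω) (v : TangentSpace (𝓡∂ 3) p), g.inner p v v ≤ g'.inner p v v) ∧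
      (∀ p ∉ U, g'.inner p = g.inner p) ∧
      (∀ p : Ω, min 0 (scalarCurvature g p) ≤ scalarCurvature g' p) ∧
      (∃ V ∈ 𝓝ˢ (range ι), ∀ p ∈ V, min 0 (scalarCurvature g p) < scalarCurvature g' p) ∧
      (IsValidFillIn B g ι → IsValidFillIn (B.scale lam hlam0) g' ι) := by
  have : T2Space Ω := hfill.t2
  have : CompactSpace Ω := hfill.compact
  have : CompactSpace S := B.compactSpace
  have hΓ := hfill.isBoundaryPart
  have hcomp : IsCompact (range ι) := isCompact_range hfill.isometricEmbedding.smooth.continuous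
  obtain ⟨ρ, hρ, hρn, hρz, hρd⟩ := exists_unit_defining hΓ hcomp.isClosed g
  have hρ0 : ∀ x ∈ range ι, ρ x = 0 := fun x => (hρz x).2
  have hH : ∀ q ∈ range ι, 0 < boundaryMeanCurvature g q := by
    rintro _ ⟨x, rfl⟩
    rw [← hfill.mean_curvature]
    exact B.H_pos x
  -- The value φ(0) = λ⁻² - 1 is forced by √(1 + φ(0)) = λ⁻¹.
  have hΦ : 0 < (lam ^ 2)⁻¹ - 1 :=
    sub_pos.2 ((one_lt_inv₀ (by positivity)).2 (pow_lt_one₀ hlam0.le hlam1 two_ne_zero))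
  obtain ⟨δ, hδ, hbend⟩ := exists_uniform_bendsUp g hρ hΓ hcomp hρ0 (fun q hq => (hρd q hq).1) hH
    ((lam ^ 2)⁻¹ - 1)
  have hbd : ∀ᶠ x in 𝓝ˢ (range ι), x ∈ (𝓡∂ 3).boundary Ω → x ∈ range ι :=
    eventually_nhdsSet_iff_forall.2 hΓ.2
  -- In W bending raises the scalar curvature, there is no boundary other than Σ, and one stays
  -- inside U.
  obtain ⟨W, hW, hΓW, hWsub⟩ := mem_nhdsSet_iff_exists.1 ((hbend.and hbd).and hU)
  -- Off W, which is compact and disjoint from Σ, the function ρ has a positive lower bound. A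
  -- profile supported below it therefore alters the metric only inside W.
  obtain ⟨ε₀, hε₀, hlow⟩ := hW.isClosed_compl.isCompact.exists_forall_le' hρ.continuous.continuousOn
    (a := 0) fun x hx => lt_of_le_of_ne (hρn x) fun h => hx (hΓW ((hρz x).1 h.symm))
  have hmin : 0 < min ε₀ δ := lt_min hε₀ hδ
  have hεε₀ : min ε₀ δ / 2 < ε₀ := (half_lt_self hmin).trans_le (min_le_left _ _)
  have hεδ : min ε₀ δ / 2 < δ := (half_lt_self hmin).trans_le (min_le_right _ _)
  have hε : 0 < min ε₀ δ / 2 := half_pos hmin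
  generalize min ε₀ δ / 2 = ε at hεε₀ hεδ hε
  obtain ⟨φ, hφ, hφn, hφ0, hφle, hφpos, hφz, hφd⟩ := exists_profile hΦ hε
  have hfar : ∀ x ∉ W, ε < ρ x := fun x hx => hεε₀.trans_le (hlow x hx)
  have hup := fun x (hx : x ∈ W) => (hWsub hx).1.1 φ hφ hφn ε hε hεδ (hφle _ (hρn x))
    (hφd _ (hρn x))
  have hge : ∀ p, scalarCurvature g p ≤ scalarCurvature (bendMetric g hρ hφ hφn) p := by
    intro p
    by_cases hp : p ∈ W
    · exact (hup p hp).1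
    · exact (scalarCurvature_bendMetric_of_lt g hρ hφ hφn hφz (hfar p hp)).ge
  have hfill' : IsFillIn (B.scale lam hlam0) (bendMetric g hρ hφ hφn) ι := by
    refine ⟨hfill.t2, hfill.compact, hfill.connected,
      ⟨hfill.isometricEmbedding.smooth, hfill.isometricEmbedding.isEmbedding, fun x v w => ?_⟩,
      hfill.component, fun x => ?_⟩
    · refine (rankOneMetric_inner g hρ _ _ _ _ _).trans ?_
      rw [dfun_mfderiv_eq_zero hρ hfill.isometricEmbedding.smooth
        (fun x => hρ0 _ (mem_range_self x)), zero_mul, mul_zero, add_zero]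
      exact hfill.isometricEmbedding.isometric x v w
    · obtain ⟨h1, h2⟩ := hρd (ι x) (mem_range_self x)
      rw [boundaryMeanCurvature_bendMetric g hρ hΓ hρ0 hφ hφn (mem_range_self x) h1 h2, hφ0,
        add_sub_cancel, Real.sqrt_inv, Real.sqrt_sq hlam0.le, inv_inv, ← hfill.mean_curvature]
      rfl
  refine ⟨bendMetric g hρ hφ hφn, hfill', le_rankOneMetric g hρ _ _, fun p hp => ?_,
    fun p => (min_le_right _ _).trans (hge p), ⟨ρ ⁻¹' Iio ε, ?_, fun p hp => ?_⟩, fun hv => ?_⟩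
  · refine rankOneMetric_inner_eq g hρ _ _ (hφz _ ?_)
    exact (hfar p fun h => hp (hWsub h).2).le
  -- The strict inequality holds on {ρ < ε}, exactly where the profile is positive.
  · refine (isOpen_Iio.preimage hρ.continuous).mem_nhdsSet.2 fun x hx => ?_
    rw [mem_preimage, hρ0 x hx]
    exact hε
  · have hpW : p ∈ W := by
      by_contra h
      exact lt_asymm (hfar p h) hp
    exact (min_le_right _ _).trans_lt ((hup p hpW).2 (hφpos _ hp))
  · refine ⟨hfill', fun p => (hv.scalar_nonneg p).trans (hge p), hv.minimal.imp id ?_⟩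
    -- The other boundary points lie outside W, hence where the metric is unchanged nearby, so they
    -- keep zero mean curvature.
    intro h p hp
    rw [boundaryMeanCurvature_bendMetric_of_lt g hρ hφ hφn hφz, h p hp]
    exact hfar p fun hW => hp.2 ((hWsub hW).1.2 hp.1)

end
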